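/- **Setting.** Let $\Omega_1,\Omega_2,\Omega_3>0$, $\bar\tau=(\bar\tau_1,\bar\tau_2,\bar\tau_3)\in(0,\infty)^3$, $s_0\in(0,1)$, and $$\varphi(t,r_2,r_3)=\frac{\sin(\Omega_1 t)}{\pi t}\,\frac{\sin(\Omega_2 r_2)}{\pi r_2}\,\frac{\sin(\Omega_3 r_3)}{\pi r_3},$$ where a factor is $\Omega_j/\pi$ at $0$. For sample sizes $n=(n_1,n_2,n_3)$ let $\tau_j=\tau_{n_j}>0$ be the sampling periods, and let $D\supseteq[0,\bar\tau]:=\prod_j[0,\bar\tau_j]$ be a set which contains all sampling points $(i_1\tau_1,i_2\tau_2,i_3\tau_3)$, $1\le i_j\le n_j$ (the common domain of the signals). *Noise.* $\{\varepsilon_{\boldsymbol i}\}_{\boldsymbol i\in\mathbb Z^3}$ is a weakly stationary, square integrable random field with mean zero such that, for some $\sigma\in(0,\infty)$ and a standard Brownian motion $B$ on $[0,1]^3$ (a.s. continuous, zero on the lower faces, independent centred normal increments over disjoint blocks with the volumes of the blocks as variances), $$Z_n(v)=(n_1n_2n_3)^{-1/2}\sum_{i_1=1}^{\lfloor n_1v_1\rfloor}\sum_{i_2=1}^{\lfloor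 n_2v_2\rfloor}\sum_{i_3=1}^{\lfloor n_3v_3\rfloor}\varepsilon_{i_1,i_2,i_3}\ \Rightarrow\ \sigma B(v)$$ weakly in the Skorohod space $D[0,1]^3$ as $\min_j n_j\to\infty$. *Random local alternative.* $\Delta(x;\omega)$, $x\in D$, is a random function independent of $\{\varepsilon_{\boldsymbol i}\}$, $f_0$ is a reference signal, and the data are $$y_{i_1,i_2,i_3}=f_n(i_1\tau_1,i_2\tau_2,i_3\tau_3;\omega)+\varepsilon_{i_1,i_2,i_3},\qquad f_n(x;\omega)-f_0(x)=\frac{\Delta(x;\omega)}{(n_1n_2n_3)^{1/2}}\quad(x\in D),$$ so that the disturbance is $\Delta(x;\omega)/n^{3/2}$ when $n_1=n_2=n_3=n$. Assume that one of the following holds: (a) the paths $\Delta(\cdot;\omega)$ are a.s. continuous on $D$, and $n_j\tau_{n_j}\to\bar\tau_j$ as $n_j\to\infty$, $j=1,2,3$; (b) the paths $\Delta(\cdot;\omega)$ are a.s. of bounded variation on $[0,\bar\tau]$ in the sense of Hardy and Krause, and $n_j\tau_{n_j}=\bar\tau_j$ for all $n_j\ge1$, $j=1,2,3$. **Theorem.**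 Let $$\mathcal F_n(s,t,r_2,r_3)=\sqrt{\tau_1\tau_2\tau_3}\sum_{l_1=1}^{\lfloor n_1s\rfloor}\sum_{l_2=1}^{n_2}\sum_{l_3=1}^{n_3}\bigl[y_{l_1,l_2,l_3}-f_0(l_1\tau_1,l_2\tau_2,l_3\tau_3)\bigr]\varphi(t-l_1\tau_1,r_2-l_2\tau_2,r_3-l_3\tau_3).$$ Then, as $\min_j n_j\to\infty$, $$\mathcal F_n\ \Rightarrow\ \mathcal F^{\Delta}$$ weakly in the Skorohod space $D\bigl([s_0,1]\times[0,\bar\tau_1]\times[0,\bar\tau_2]\times[0,\bar\tau_3]\bigr)$, where $$\mathcal F^\Delta(s,t,r_2,r_3)=\mathcal F(s,t,r_2,r_3)+\frac1{\sqrt{\bar\tau_1\bar\tau_2\bar\tau_3}}\int_0^{s\bar\tau_1}\!\!\int_0^{\bar\tau_2}\!\!\int_0^{\bar\tau_3}\varphi(t-z_1,r_2-z_2,r_3-z_3)\,\Delta(z_1,z_2,z_3;\omega)\,dz_3\,dz_2\,dz_1,$$ $$\mathcal F(s,t,r_2,r_3)=\sqrt{\bar\tau_1\bar\tau_2\bar\tau_3}\;\sigma\int_0^s\!\int_0^1\!\int_0^1\varphi(t-\bar\tau_1z_1,r_2-\bar\tau_2z_2,r_3-\bar\tau_3z_3)\,dB(z_1,z_2,z_3),$$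 and $B$ is independent of $\Delta$. The integral with respect to $B$ is the multivariate Riemann–Stieltjes integral defined by integration by parts; a.s. this integral and the drift integral exist for all arguments. -/

import Mathlib

open MeasureTheory ProbabilityTheory Filter Topology Set
open scoped ENNReal NNReal

namespace SignalDetection

noncomputable section

/-! ### Alternating sums, ladders, variation in the sense of Vitali and of Hardy and Krause -/

section Variation

variable {ι : Type*} [Fintype ι] [DecidableEq ι]

/-- The point `a_v : b_{-v}`, with coordinates from `a` on `v` and from `b` off `v`. -/
def corner (v : Finset ι) (a b : ι → ℝ) : ι → ℝ := fun j => if j ∈ v then a j else b j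

/-- The alternating sum `∑_v (-1)^{|v|} f (a_v : b_{-v})`. -/
def altSum (f : (ι → ℝ) → ℝ) (a b : ι → ℝ) : ℝ :=
  ∑ v : Finset ι, (-1 : ℝ) ^ v.card * f (corner v a b)

/-- `Y` is a ladder on `[a, b]`: it contains `a` and finitely many points of `(a, b)`. -/
def IsLadder (Y : Finset ℝ) (a b : ℝ) : Prop :=
  a ∈ Y ∧ ∀ y ∈ Y, y = a ∨ y ∈ Ioo a b

/-- The successor of `y` in the ladder `Y` on `[a, b]`: the least element of `Y` above `y`,
and `b` if there is none. -/
def ladderSucc (Y : Finset ℝ) (b y : ℝ) : ℝ :=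
  if h : (Y.filter (fun z => y < z)).Nonempty then (Y.filter (fun z => y < z)).min' h else b

/-- The successor taken in every coordinate of a multidimensional ladder. -/
def succPt (Y : ι → Finset ℝ) (b y : ι → ℝ) : ι → ℝ := fun j => ladderSucc (Y j) (b j) (y j)

/-- The variation of `f` on `[a, b]` in the sense of Vitali. -/
def vitaliVar (f : (ι → ℝ) → ℝ) (a b : ι → ℝ) : ℝ≥0∞ :=
  ⨆ (Y : ι → Finset ℝ) (_ : ∀ j, IsLadder (Y j) (a j) (b j)),
    ∑ y ∈ Fintype.piFinset Y, ENNReal.ofReal |altSum f y (succPt Y b y)|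

/-- The point `x_v : z_{-v}`, where `x` has coordinates indexed by `v` only. -/
def glue (v : Finset ι) (x : v → ℝ) (z : ι → ℝ) : ι → ℝ :=
  fun j => if h : j ∈ v then x ⟨j, h⟩ else z j

/-- The function `x_v ↦ f (x_v : z_{-v})`. -/
def slice (f : (ι → ℝ) → ℝ) (v : Finset ι) (z : ι → ℝ) : (v → ℝ) → ℝ :=
  fun x => f (glue v x z)

/-- The part `x_v` of a vector `x`. -/
def part (v : Finset ι) (x : ι → ℝ) : v → ℝ := fun j => x j

/-- The variation of `f` on `[a, b]` in the sense of Hardy and Krause (anchored at `b`). -/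
def hkVar (f : (ι → ℝ) → ℝ) (a b : ι → ℝ) : ℝ≥0∞ :=
  ∑ u ∈ (Finset.univ : Finset (Finset ι)).filter (fun u => u.Nonempty),
    vitaliVar (slice f u b) (part u a) (part u b)

/-- `f` is of bounded variation on `[a, b]` in the sense of Hardy and Krause. -/
def BVHK (f : (ι → ℝ) → ℝ) (a b : ι → ℝ) : Prop := hkVar f a b < ⊤

/-! ### The multivariate Riemann-Stieltjes integral -/

/-- `∫_a^b h df = I` as the limit of Riemann-Stieltjes sums over ladders whose mesh tends to `0`,
with arbitrary tags `c y ∈ [y, y⁺]`. -/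
def HasRSIntegral (h f : (ι → ℝ) → ℝ) (a b : ι → ℝ) (I : ℝ) : Prop :=
  ∀ η : ℝ, 0 < η → ∃ δ : ℝ, 0 < δ ∧
    ∀ Y : ι → Finset ℝ, (∀ j, IsLadder (Y j) (a j) (b j)) →
      (∀ j, ∀ y ∈ Y j, ladderSucc (Y j) (b j) y - y < δ) →
      ∀ c : (ι → ℝ) → (ι → ℝ),
        (∀ y ∈ Fintype.piFinset Y, c y ∈ Icc y (succPt Y b y)) →
        |∑ y ∈ Fintype.piFinset Y, h (c y) * altSum f y (succPt Y b y) - I| < η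

open Classical in
/-- The value of the Riemann-Stieltjes integral `∫_a^b h df` (and `0` if it does not exist). -/
def rsIntegral (h f : (ι → ℝ) → ℝ) (a b : ι → ℝ) : ℝ :=
  if H : ∃ I, HasRSIntegral h f a b I then H.choose else 0

/-- All the integrals on the right-hand side of the integration by parts formula
for `∫_a^b f dh` exist. -/
def StieltjesExists (f h : (ι → ℝ) → ℝ) (a b : ι → ℝ) : Prop :=
  ∀ v : Finset ι, ∀ w ⊆ vᶜ, ∃ I : ℝ,
    HasRSIntegral (slice h v (corner w a b)) (slice f v (corner w a b)) (part v a) (part v b) I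

/-- The integral `∫_a^b f dh`, defined for integrators `h` of possibly unbounded variation through
integration by parts: it is the sum over all `v` of
`(-1)^{|v|} ∫_{a_v}^{b_v} [h df]_{a_{-v}}^{b_{-v}}`. The term `v = ∅` is the
increment `[h f]_a^b` (the integral over no coordinates is the value of `h f` at the corner), the
term in which `v` is the set of all coordinates is `(-1)^q ∫_a^b h df`. -/
def stieltjes (f h : (ι → ℝ) → ℝ) (a b : ι → ℝ) : ℝ :=
  ∑ v : Finset ι, (-1 : ℝ) ^ v.card * ∑ w ∈ (vᶜ).powerset, (-1 : ℝ) ^ w.card *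
    rsIntegral (slice h v (corner w a b)) (slice f v (corner w a b)) (part v a) (part v b)

end Variation

/-! ### The Skorohod space on a hyperrectangle -/

section Skorohod

variable {q : ℕ} {a b : Fin q → ℝ}

/-- The quadrant at `t` in `[a, b]` with `s p < t p` for `p ∈ L` and `s p ≥ t p` for `p ∉ L`. -/
def quadrant (L : Finset (Fin q)) (t : Icc a b) : Set (Icc a b) :=
  {s | ∀ p, if p ∈ L then (s : Fin q → ℝ) p < (t : Fin q → ℝ) p
    else (t : Fin q → ℝ) p ≤ (s : Fin q → ℝ) p}

/-- Continuity from above with limits in all quadrants. -/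
def IsCadlag (f : Icc a b → ℝ) : Prop :=
  (∀ t L, ∃ l : ℝ, Tendsto f (𝓝[quadrant L t] t) (𝓝 l)) ∧
    ∀ t, Tendsto f (𝓝[quadrant ∅ t] t) (𝓝 (f t))

variable (a b) in
/-- The Skorohod space `D[a, b]`. -/
def DSpace : Type := {f : Icc a b → ℝ // IsCadlag f}

instance : CoeFun (DSpace a b) (fun _ => Icc a b → ℝ) := ⟨fun f => f.1⟩

instance : Zero (DSpace a b) :=
  ⟨⟨fun _ => 0, fun _ _ => ⟨0, tendsto_const_nhds⟩, fun _ => tendsto_const_nhds⟩⟩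

variable (a b) in
/-- The time changes of `[a, b]`: a strictly increasing continuous bijection of `[a_p, b_p]`
in every coordinate `p`. -/
abbrev TimeChange : Type := ∀ p : Fin q, Icc (a p) (b p) ≃o Icc (a p) (b p)

/-- The action of a time change on `[a, b]`. -/
def TimeChange.act (lam : TimeChange a b) (t : Icc a b) : Icc a b :=
  ⟨fun p => lam p ⟨t.1 p, t.2.1 p, t.2.2 p⟩, fun p => (lam p _).2.1, fun p => (lam p _).2.2⟩

/-- The cost of matching `x` with `y` through a time change: the larger one of
`sup |x - y ∘ λ|` and `sup |λ - id|`. -/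
def skorohodCost (x y : DSpace a b) (lam : TimeChange a b) : ℝ≥0∞ :=
  max (⨆ t, edist (x t) (y (lam.act t))) (⨆ t, edist t (lam.act t))

theorem skorohodCost_symm_le (x y : DSpace a b) (lam : TimeChange a b) :
    skorohodCost y x (fun p => (lam p).symm) ≤ skorohodCost x y lam := by
  have key : ∀ t : Icc a b, lam.act (TimeChange.act (fun p => (lam p).symm) t) = t := by
    intro t
    apply Subtype.ext
    funext p
    simp [TimeChange.act]
  refine max_le_max (iSup_le fun t => ?_) (iSup_le fun t => ?_)
  · refine le_trans (le_of_eq ?_)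
      (le_iSup _ (TimeChange.act (fun p => (lam p).symm) t))
    rw [key, edist_comm]
  · refine le_trans (le_of_eq ?_)
      (le_iSup _ (TimeChange.act (fun p => (lam p).symm) t))
    rw [key, edist_comm]

theorem skorohodCost_trans_le (x y z : DSpace a b) (lam mu : TimeChange a b) :
    skorohodCost x z (fun p => (lam p).trans (mu p)) ≤
      skorohodCost x y lam + skorohodCost y z mu := by
  have key : ∀ t : Icc a b,
      TimeChange.act (fun p => (lam p).trans (mu p)) t = mu.act (lam.act t) := by
    intro t
    apply Subtype.ext
    funext p
    simp [TimeChange.act]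
  refine max_le (iSup_le fun t => ?_) (iSup_le fun t => ?_)
  · rw [key]
    refine (edist_triangle _ (y (lam.act t)) _).trans (add_le_add ?_ ?_)
    · exact (le_iSup (fun t => edist (x t) (y (lam.act t))) t).trans (le_max_left _ _)
    · exact (le_iSup (fun t => edist (y t) (z (mu.act t))) (lam.act t)).trans (le_max_left _ _)
  · rw [key]
    refine (edist_triangle _ (lam.act t) _).trans (add_le_add ?_ ?_)
    · exact (le_iSup (fun t => edist t (lam.act t)) t).trans (le_max_right _ _)
    · exact (le_iSup (fun t => edist t (mu.act t)) (lam.act t)).trans (le_max_right _ _)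

/-- The Skorohod metric: the infimum over all time changes `λ` of
`max (sup |x - y ∘ λ|, sup |λ - id|)`. -/
instance : PseudoEMetricSpace (DSpace a b) where
  edist x y := ⨅ lam : TimeChange a b, skorohodCost x y lam
  edist_self x := by
    refine le_antisymm ((iInf_le _ (fun p => OrderIso.refl _)).trans ?_) zero_le
    refine max_le (iSup_le fun t => ?_) (iSup_le fun t => ?_)
    · exact (edist_self (x t)).le
    · exact (edist_self t).le
  edist_comm x y := le_antisymm
    (le_iInf fun lam => (iInf_le _ _).trans (skorohodCost_symm_le y x lam))
    (le_iInf fun lam => (iInf_le _ _).trans (skorohodCost_symm_le x y lam))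
  edist_triangle x y z := by
    refine ENNReal.le_iInf_add_iInf ?_
    intro lam mu
    exact (iInf_le _ _).trans (skorohodCost_trans_le x y z lam mu)

instance : MeasurableSpace (DSpace a b) := borel _

instance : BorelSpace (DSpace a b) := ⟨rfl⟩

variable (a b)

/-- The path on `[a, b]` of a function on `ℝ^q`. -/
def path (f : (Fin q → ℝ) → ℝ) : Icc a b → ℝ := fun t => f t

open Classical in
/-- The path of `f` as an element of `D[a, b]` (the zero path if `f` is not in `D[a, b]`). -/
def toD (f : (Fin q → ℝ) → ℝ) : DSpace a b :=
  if h : IsCadlag (path a b f) then ⟨path a b f, h⟩ else 0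

/-- Weak convergence `X_i ⇒ Y` along `l` in the Skorohod space `D[a, b]`: the processes have
almost surely paths in `D[a, b]` and converge in distribution as random elements of it. -/
def WeakConvD {κ Ω Ω' : Type*} [MeasurableSpace Ω] [MeasurableSpace Ω']
    (X : κ → Ω → (Fin q → ℝ) → ℝ) (l : Filter κ) (Y : Ω' → (Fin q → ℝ) → ℝ)
    (P : Measure Ω) [IsProbabilityMeasure P] (P' : Measure Ω') [IsProbabilityMeasure P'] : Prop :=
  (∀ i, ∀ᵐ ω ∂P, IsCadlag (path a b (X i ω))) ∧
    (∀ᵐ ω ∂P', IsCadlag (path a b (Y ω))) ∧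
    TendstoInDistribution (fun i ω => toD a b (X i ω)) l (fun ω => toD a b (Y ω))
      (fun _ => P) P'

end Skorohod

/-! ### Brownian motion with three parameters and the noise assumption -/

/-- `B` is a standard Brownian motion on `[0,1]^3`: continuous paths almost surely, vanishing on
the lower faces, and independent centred normal increments over disjoint blocks `(s, t]`, with
the volumes of the blocks as variances. -/
structure IsBrownianMotion {Ω : Type*} [MeasurableSpace Ω] (P : Measure Ω)
    (B : Ω → (Fin 3 → ℝ) → ℝ) : Prop where
  measurable : ∀ t ∈ Icc (0 : Fin 3 → ℝ) 1, Measurable (fun ω => B ω t)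
  continuous : ∀ᵐ ω ∂P, ContinuousOn (B ω) (Icc 0 1)
  zero : ∀ t ∈ Icc (0 : Fin 3 → ℝ) 1, (∃ j, t j = 0) → ∀ᵐ ω ∂P, B ω t = 0
  law : ∀ s t : Fin 3 → ℝ, 0 ≤ s → s ≤ t → t ≤ 1 →
    HasLaw (fun ω => altSum (B ω) s t) (gaussianReal 0 (∏ j, (t j - s j)).toNNReal) P
  indep : ∀ (k : ℕ) (s t : Fin k → Fin 3 → ℝ),
    (∀ i, 0 ≤ s i ∧ s i ≤ t i ∧ t i ≤ 1) →
    (Pairwise fun i i' => Disjoint (univ.pi fun j => Ioc (s i j) (t i j))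
      (univ.pi fun j => Ioc (s i' j) (t i' j))) →
    iIndepFun (fun i ω => altSum (B ω) (s i) (t i)) P

/-- The partial sum process
`Z_n(v) = (n₁ n₂ n₃)^{-1/2} ∑_{1 ≤ i_j ≤ ⌊n_j v_j⌋} ε_i`. -/
def partialSum {Ω : Type*} (ε : (Fin 3 → ℤ) → Ω → ℝ) (n : Fin 3 → ℕ) (ω : Ω)
    (v : Fin 3 → ℝ) : ℝ :=
  (√(∏ j, (n j : ℝ)))⁻¹ * ∑ i ∈ Finset.Icc (1 : Fin 3 → ℤ) (fun j => ⌊(n j : ℝ) * v j⌋), ε i ω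

/-- The assumption on the noise: a weakly stationary random field with mean zero that satisfies
the functional central limit theorem `Z_n ⇒ σ B` in `D[0,1]^3` as `min n_j → ∞`
(the filter `atTop` on triples). -/
structure NoiseAssumption {Ω Ω' : Type*} [MeasurableSpace Ω] [MeasurableSpace Ω']
    (P : Measure Ω) [IsProbabilityMeasure P] (P' : Measure Ω') [IsProbabilityMeasure P']
    (ε : (Fin 3 → ℤ) → Ω → ℝ) (σ : ℝ) (B : Ω' → (Fin 3 → ℝ) → ℝ) : Prop where
  measurable : ∀ i, Measurable (ε i)
  memLp : ∀ i, MemLp (ε i) 2 P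
  mean : ∀ i, ∫ ω, ε i ω ∂P = 0
  stationary : ∀ i i' k, covariance (ε (i + k)) (ε (i' + k)) P = covariance (ε i) (ε i') P
  sigma_pos : 0 < σ
  fclt : WeakConvD 0 1 (fun (n : Fin 3 → ℕ) ω v => partialSum ε n ω v) atTop
    (fun ω' v => σ * B ω' v) P P'

/-! ### The detection process and its limit -/

/-- The product reconstruction kernel `φ(x) = ∏_j sin(Ω_j x_j) / (π x_j)`, with the factor
`Ω_j / π` where `x_j = 0`. -/
def kernel (Om : Fin 3 → ℝ) (x : Fin 3 → ℝ) : ℝ :=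
  ∏ j, Om j / Real.pi * Real.sinc (Om j * x j)

/-- The sampling point `(i_1 τ_{n_1}, i_2 τ_{n_2}, i_3 τ_{n_3})`, where `τ j m` is the sampling
period in coordinate `j` for `m` sampling points. -/
def samplePt (τ : Fin 3 → ℕ → ℝ) (n : Fin 3 → ℕ) (i : Fin 3 → ℤ) : Fin 3 → ℝ :=
  fun j => (i j : ℝ) * τ j (n j)

/-- The indices `1 ≤ i_j ≤ n_j` of the observations. -/
def indexBox (n : Fin 3 → ℕ) : Finset (Fin 3 → ℤ) :=
  Finset.Icc 1 (fun j => (n j : ℤ))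

/-- The detection process `F_n(s, t, r_2, r_3)` for the data `y`; the argument is
`x = (s, t, r_2, r_3)`, so that `Fin.tail x = (t, r_2, r_3)`. -/
def detectionProcess (Om : Fin 3 → ℝ) (τ : Fin 3 → ℕ → ℝ) (f0 : (Fin 3 → ℝ) → ℝ)
    (n : Fin 3 → ℕ) (y : (Fin 3 → ℤ) → ℝ) (x : Fin 4 → ℝ) : ℝ :=
  √(∏ j, τ j (n j)) *
    ∑ l ∈ Finset.Icc (1 : Fin 3 → ℤ)
        (Function.update (fun j => (n j : ℤ)) 0 ⌊(n 0 : ℝ) * x 0⌋),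
      (y l - f0 (samplePt τ n l)) * kernel Om (Fin.tail x - samplePt τ n l)

/-- The limit under the null hypothesis,
`√(τ̄_1 τ̄_2 τ̄_3) σ ∫_0^s ∫_0^1 ∫_0^1 φ(t - τ̄_1 z_1, r_2 - τ̄_2 z_2, r_3 - τ̄_3 z_3) dB(z)`,
for the path `β` of the Brownian motion, at `x = (s, t, r_2, r_3)`. -/
def nullLimit (Om τbar : Fin 3 → ℝ) (σ : ℝ) (β : (Fin 3 → ℝ) → ℝ) (x : Fin 4 → ℝ) : ℝ :=
  √(∏ j, τbar j) * σ *
    stieltjes (fun z => kernel Om (Fin.tail x - τbar * z)) β 0 (Function.update 1 0 (x 0))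

/-- The drift `(τ̄_1 τ̄_2 τ̄_3)^{-1/2} ∫_0^{s τ̄_1} ∫_0^{τ̄_2} ∫_0^{τ̄_3} φ((t, r_2, r_3) - z) d(z) dz`
for the path `d` of the disturbance, at `x = (s, t, r_2, r_3)`. -/
def drift (Om τbar : Fin 3 → ℝ) (d : (Fin 3 → ℝ) → ℝ) (x : Fin 4 → ℝ) : ℝ :=
  (√(∏ j, τbar j))⁻¹ *
    ∫ z in Icc (0 : Fin 3 → ℝ) (Function.update τbar 0 (x 0 * τbar 0)),
      kernel Om (Fin.tail x - z) * d z

end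

end SignalDetection

open SignalDetection

namespace SignalDetection

/-! ### Ladders: successors, telescoping sums, fine meshes -/

section Ladder

/-! The residuals are `Δ / √(n₁ n₂ n₃) + ε` and the detection process is linear in them, so it
splits into a noise part and a drift part.

Noise. Each factor of the kernel is `C¹`, so on `(0, b]` it is its value at `b` minus the integral
of its derivative over the rest of the interval. Equivalently, it is the integral of the indicator
of `z ≤ b v` against a density with respect to `δ_1 + dv` (`integral_weight`). Multiplying over the
coordinates and exchanging sum and integral writes the noise part, without remainder, as an integral
of the partial sum process (`residualField_eq_partsIntegral`). Integration by parts writes the `dB`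
integral as the same functional of `B` (`stieltjes_prod_kfac`). Only the parameters `⌊n₁ s⌋ / n₁`
and `n_j τ_j` differ from their limits, and for a continuous path the functional is continuous in
them. As Brownian paths are continuous, Skorohod closeness to them is uniform closeness, which
carries over to the fields (`eventually_residualField_near`).

Drift. The drift part is a Riemann sum. In both cases the samples of the disturbance are bounded and
converge almost everywhere (`IsSampleable`). In case (a) this is continuity. In case (b) the
oscillation of a function of bounded Hardy-Krause variation is controlled by an antitone function,
and antitone functions are continuous almost everywhere (`BVHK.ae_continuousAt`). Dominated
convergence, with the argument of the process moving along with `n`, makes the convergence uniform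
on the compact parameter box.

Combination. By independence and Fubini the path of the disturbance can be frozen. An extended
continuous mapping theorem (`tendsto_integral_of_continuous_convergence`) treats the frozen path,
and dominated convergence integrates over the paths. The limit is measurable because it is an almost
sure limit of the same finite sums, fed with the increments of the Brownian path
(`aemeasurable_toD_limitPath`). -/

theorem ladderSucc_mem_Icc {Y : Finset ℝ} {a b : ℝ} (hY : IsLadder Y a b) (hab : a ≤ b)
    {y : ℝ} (hy : y ∈ Y) : y ≤ ladderSucc Y b y ∧ ladderSucc Y b y ≤ b := by
  have hle : ∀ z ∈ Y, z ≤ b := fun z hz =>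
    (hY.2 z hz).elim (fun h => h ▸ hab) (fun h => h.2.le)
  unfold ladderSucc
  split_ifs with h
  · have := Finset.min'_mem _ h
    rw [Finset.mem_filter] at this
    exact ⟨this.2.le, hle _ this.1⟩
  · exact ⟨hle y hy, le_rfl⟩

theorem IsLadder.left_le {Y : Finset ℝ} {a b : ℝ} (hY : IsLadder Y a b) {y : ℝ} (hy : y ∈ Y) :
    a ≤ y :=
  (hY.2 y hy).elim (fun h => h.ge) (fun h => h.1.le)

/-- A new largest point takes over the role of the right end point; this drives the induction on the
maximum below. -/
theorem ladderSucc_insert_of_lt {Y : Finset ℝ} {m b y : ℝ} (hm : ∀ z ∈ Y, z < m) (hy : y < m) :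
    ladderSucc (insert m Y) b y = ladderSucc Y m y := by
  unfold ladderSucc
  have h1 : ((insert m Y).filter (fun z => y < z)) = insert m (Y.filter (fun z => y < z)) := by
    rw [Finset.filter_insert, if_pos hy]
  rw [dif_pos (by rw [h1]; exact Finset.insert_nonempty _ _)]
  split_ifs with h
  · refine le_antisymm (Finset.min'_le _ _ ?_) (Finset.le_min' _ _ _ ?_)
    · rw [h1]; exact Finset.mem_insert_of_mem (Finset.min'_mem _ h)
    · intro z hz
      rw [h1, Finset.mem_insert] at hz
      rcases hz with rfl | hz
      · exact (hm _ (Finset.mem_filter.1 (Finset.min'_mem _ h)).1).le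
      · exact Finset.min'_le _ _ hz
  · rw [Finset.not_nonempty_iff_eq_empty] at h
    have h2 : ((insert m Y).filter (fun z => y < z)) = {m} := by rw [h1, h]; rfl
    simp [h2]

theorem ladderSucc_insert_max {Y : Finset ℝ} {m b : ℝ} (hm : ∀ z ∈ Y, z < m) :
    ladderSucc (insert m Y) b m = b := by
  unfold ladderSucc
  rw [dif_neg]
  rintro ⟨z, hz⟩
  simp only [Finset.mem_filter, Finset.mem_insert] at hz
  rcases hz with ⟨rfl | hz, h⟩
  · exact lt_irrefl _ h
  · exact lt_asymm h (hm z hz)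

/-- The end point `b` is quantified inside the statement because the induction step replaces it by
the new maximum `m`. -/
theorem sum_ladderSucc_sub (f : ℝ → ℝ) (a : ℝ) (Y : Finset ℝ) :
    ∀ b, a ∈ Y → (∀ y ∈ Y, a ≤ y) → ∑ y ∈ Y, (f (ladderSucc Y b y) - f y) = f b - f a := by
  induction Y using Finset.induction_on_max with
  | empty => simp
  | insert m Y hm ih =>
    intro b ha hle
    have hmY : m ∉ Y := fun h => lt_irrefl _ (hm m h)
    rw [Finset.sum_insert hmY, ladderSucc_insert_max hm,
      Finset.sum_congr rfl (fun y hy => by rw [ladderSucc_insert_of_lt hm (hm y hy)])]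
    -- If the maximum is the least point `a` itself, the ladder has no other point.
    rcases Finset.mem_insert.1 ha with rfl | ha
    · have : Y = ∅ := by
        rw [Finset.eq_empty_iff_forall_notMem]
        exact fun y hy => absurd (hm y hy) (not_lt.2 (hle y (Finset.mem_insert_of_mem hy)))
      simp [this]
    · rw [ih m ha (fun y hy => hle y (Finset.mem_insert_of_mem hy))]; ring

theorem IsLadder.telescope {Y : Finset ℝ} {a b : ℝ} (hY : IsLadder Y a b) (f : ℝ → ℝ) :
    ∑ y ∈ Y, (f (ladderSucc Y b y) - f y) = f b - f a :=
  sum_ladderSucc_sub f a Y b hY.1 (fun _ hy => hY.left_le hy)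

theorem ladderSucc_insert_left {Y : Finset ℝ} {a' b x y : ℝ}
    (hY : IsLadder Y a' b) (hx : x ≤ a') (hy : y ∈ Y) :
    ladderSucc (insert x Y) b y = ladderSucc Y b y := by
  have : ((insert x Y).filter (fun z => y < z)) = Y.filter (fun z => y < z) := by
    rw [Finset.filter_insert, if_neg (not_lt.2 (hx.trans (hY.left_le hy)))]
  simp only [ladderSucc, this]

theorem IsLadder.insert_left {Y : Finset ℝ} {a' b x : ℝ}
    (hY : IsLadder Y a' b) (hx : x ≤ a') (hb : a' < b) : IsLadder (insert x Y) x b := by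
  refine ⟨Finset.mem_insert_self _ _, fun y hy => ?_⟩
  rcases Finset.mem_insert.1 hy with rfl | hy
  · exact Or.inl rfl
  · rcases (hY.left_le hy).trans' hx |>.eq_or_lt with h | h
    · exact Or.inl h.symm
    · refine Or.inr ⟨h, ?_⟩
      rcases hY.2 y hy with rfl | h'
      · exact hb
      · exact h'.2

/-- The equidistant ladder with `N` cells. -/
theorem exists_ladder_mesh_lt {a b δ : ℝ} (hab : a < b) (hδ : 0 < δ) :
    ∃ Y : Finset ℝ, IsLadder Y a b ∧ ∀ y ∈ Y, ladderSucc Y b y - y < δ := by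
  obtain ⟨N, hN⟩ := exists_nat_gt ((b - a) / δ)
  have hba : 0 < b - a := sub_pos.2 hab
  have hN0 : (0 : ℝ) < N := (div_pos hba hδ).trans hN
  have hstep : (b - a) / N < δ := by
    rw [div_lt_iff₀ hN0]; rw [div_lt_iff₀ hδ] at hN; linarith
  have hlt : ∀ k : ℕ, k < N → a + k * ((b - a) / N) < b := by
    intro k hk
    have : (k : ℝ) * ((b - a) / N) < N * ((b - a) / N) :=
      mul_lt_mul_of_pos_right (by exact_mod_cast hk) (div_pos hba hN0)
    rw [mul_div_cancel₀ _ hN0.ne'] at this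
    linarith
  refine ⟨(Finset.range N).image (fun k : ℕ => a + k * ((b - a) / N)), ⟨?_, ?_⟩, ?_⟩
  · exact Finset.mem_image.2 ⟨0, by simpa using hN0, by simp⟩
  · intro y hy
    obtain ⟨k, hk, rfl⟩ := Finset.mem_image.1 hy
    rcases Nat.eq_zero_or_pos k with rfl | hk0
    · left; simp
    · refine Or.inr ⟨?_, hlt k (Finset.mem_range.1 hk)⟩
      have : 0 < (k : ℝ) * ((b - a) / N) := by positivity
      linarith
  · intro y hy
    obtain ⟨k, hk, rfl⟩ := Finset.mem_image.1 hy
    have hk := Finset.mem_range.1 hk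
    unfold ladderSucc
    rcases Nat.lt_or_ge (k + 1) N with h1 | h1
    · have hmem : a + ((k + 1 : ℕ) : ℝ) * ((b - a) / N) ∈
          ((Finset.range N).image (fun k : ℕ => a + (k : ℝ) * ((b - a) / N))).filter
            (fun z => a + (k : ℝ) * ((b - a) / N) < z) := by
        refine Finset.mem_filter.2 ⟨Finset.mem_image.2 ⟨k + 1, Finset.mem_range.2 h1, rfl⟩, ?_⟩
        have : 0 < (b - a) / N := by positivity
        push_cast; nlinarith
      rw [dif_pos ⟨_, hmem⟩]
      have := Finset.min'_le _ _ hmem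
      push_cast at this
      linarith
    · have hNk : (N : ℝ) = k + 1 := by
        have : N = k + 1 := by omega
        exact_mod_cast this
      rw [dif_neg]
      · have : b = a + (k + 1) * ((b - a) / N) := by rw [← hNk]; field_simp; ring
        linarith
      · rintro ⟨z, hz⟩
        obtain ⟨hz, hlt'⟩ := Finset.mem_filter.1 hz
        obtain ⟨k', hk', rfl⟩ := Finset.mem_image.1 hz
        have hk' := Finset.mem_range.1 hk'
        have : (k' : ℝ) ≤ k := by exact_mod_cast (by omega : k' ≤ k)
        have : (k' : ℝ) * ((b - a) / N) ≤ k * ((b - a) / N) := by gcongr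
        linarith

end Ladder

/-! ### Alternating sums and their additivity over grids -/

section AltSum

variable {ι : Type*} [Fintype ι] [DecidableEq ι]

/-- Expanding the product of the sums `-f (a j) + f (b j)` over subsets gives exactly the signs of
the alternating sum. -/
theorem altSum_const_mul_prod (C : ℝ) (f : ι → ℝ → ℝ) (a b : ι → ℝ) :
    altSum (fun z => C * ∏ j, f j (z j)) a b = C * ∏ j, (f j (b j) - f j (a j)) := by
  have : ∀ j, f j (b j) - f j (a j) = -f j (a j) + f j (b j) := fun j => by ring
  simp_rw [this, Finset.prod_add, altSum, Finset.mul_sum, Finset.powerset_univ]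
  refine Finset.sum_congr rfl fun v _ => ?_
  have h1 : ∏ j, f j (corner v a b j) =
      (∏ j ∈ v, f j (a j)) * ∏ j ∈ Finset.univ \ v, f j (b j) := by
    rw [← Finset.prod_sdiff (Finset.subset_univ v), mul_comm]
    congr 1
    · exact Finset.prod_congr rfl fun j hj => by simp [corner, hj]
    · exact Finset.prod_congr rfl fun j hj => by simp [corner, (Finset.mem_sdiff.1 hj).2]
  rw [h1, Finset.prod_neg]
  ring

theorem altSum_sum {κ : Type*} (s : Finset κ) (f : κ → (ι → ℝ) → ℝ) (a b : ι → ℝ) :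
    altSum (fun z => ∑ k ∈ s, f k z) a b = ∑ k ∈ s, altSum (f k) a b := by
  simp only [altSum, Finset.mul_sum]
  rw [Finset.sum_comm]

theorem altSum_congr {f g : (ι → ℝ) → ℝ} {a b : ι → ℝ}
    (h : ∀ v : Finset ι, f (corner v a b) = g (corner v a b)) : altSum f a b = altSum g a b := by
  simp only [altSum, h]

/-- Alternating sums are additive over the cells of a grid. -/
theorem sum_altSum_piFinset {κ : Type*} [DecidableEq κ] (T : ι → Finset κ) (α β : ι → κ → ℝ)
    (a b : ι → ℝ)
    (htel : ∀ j, ∀ f : ℝ → ℝ, ∑ t ∈ T j, (f (β j t) - f (α j t)) = f (b j) - f (a j))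
    (h : (ι → ℝ) → ℝ) :
    ∑ t ∈ Fintype.piFinset T, altSum h (fun j => α j (t j)) (fun j => β j (t j)) =
      altSum h a b := by
  classical
  -- Only finitely many coordinates occur. On the finite grid `S` the function `h` equals a linear
  -- combination `h'` of products of one-dimensional indicators, so additivity need only be checked
  -- for products.
  let S : ι → Finset ℝ := fun j => (T j).image (α j) ∪ (T j).image (β j) ∪ {a j, b j}
  let h' : (ι → ℝ) → ℝ := fun z =>
    ∑ g ∈ Fintype.piFinset S, h g * ∏ j, (if z j = g j then (1 : ℝ) else 0)
  have hh' : ∀ z ∈ Fintype.piFinset S, h z = h' z := by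
    intro z hz
    simp only [h']
    rw [Finset.sum_eq_single z]
    · simp
    · intro g _ hgz
      obtain ⟨j, hj⟩ := Function.ne_iff.1 hgz
      rw [Finset.prod_eq_zero (Finset.mem_univ j) (if_neg (Ne.symm hj)), mul_zero]
    · exact fun hn => absurd hz hn
  have hcorner : ∀ p q : ι → ℝ, (∀ j, p j ∈ S j) → (∀ j, q j ∈ S j) →
      altSum h p q = altSum h' p q := by
    intro p q hp hq
    refine altSum_congr fun v => hh' _ (Fintype.mem_piFinset.2 fun j => ?_)
    unfold corner
    split_ifs
    · exact hp j
    · exact hq j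
  rw [hcorner a b (fun j => by simp [S]) (fun j => by simp [S])]
  rw [Finset.sum_congr rfl (fun t ht => hcorner _ _
    (fun j => by
      have := Fintype.mem_piFinset.1 ht j
      simp only [S, Finset.mem_union, Finset.mem_image]
      exact Or.inl (Or.inl ⟨_, this, rfl⟩))
    (fun j => by
      have := Fintype.mem_piFinset.1 ht j
      simp only [S, Finset.mem_union, Finset.mem_image]
      exact Or.inl (Or.inr ⟨_, this, rfl⟩)))]
  simp only [h', altSum_sum]
  rw [Finset.sum_comm]
  refine Finset.sum_congr rfl fun g _ => ?_
  -- For a product, the sum over the cells factors, and each factor telescopes by `htel`.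
  have key := fun p q => altSum_const_mul_prod (h g) (fun j x => if x = g j then (1 : ℝ) else 0) p q
  simp only [key]
  rw [← Finset.mul_sum]
  congr 1
  have := Finset.prod_univ_sum T (fun j t => ((if β j t = g j then (1 : ℝ) else 0) -
    (if α j t = g j then (1 : ℝ) else 0)))
  rw [← this]
  exact Finset.prod_congr rfl fun j _ => htel j (fun x => if x = g j then 1 else 0)

theorem sum_altSum_ladder {Y : ι → Finset ℝ} {a b : ι → ℝ} (hY : ∀ j, IsLadder (Y j) (a j) (b j))
    (f : (ι → ℝ) → ℝ) :
    ∑ y ∈ Fintype.piFinset Y, altSum f y (succPt Y b y) = altSum f a b :=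
  sum_altSum_piFinset Y (fun _ y => y) (fun j y => ladderSucc (Y j) (b j) y) a b
    (fun j f => (hY j).telescope f) f

end AltSum

/-! ### Superadditivity of the Vitali variation -/

section BoundedVariation

variable {ι : Type*} [Fintype ι] [DecidableEq ι]

/-- Prepending `x` to a ladder on `[x', b]` gives a ladder on `[x, b]` that keeps all the old cells.
The increments over the new cells add up to the difference of the two alternating sums. -/
theorem sum_ladder_add_le_vitaliVar (f : (ι → ℝ) → ℝ) {x x' b : ι → ℝ} (hx : x ≤ x')
    (hb : ∀ j, x' j < b j) {Y' : ι → Finset ℝ} (hY' : ∀ j, IsLadder (Y' j) (x' j) (b j)) :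
    ∑ y ∈ Fintype.piFinset Y', ENNReal.ofReal |altSum f y (succPt Y' b y)| +
      ENNReal.ofReal |altSum f x b - altSum f x' b| ≤ vitaliVar f x b := by
  have hYl := fun j => (hY' j).insert_left (hx j) (hb j)
  refine le_trans ?_ (le_iSup₂_of_le _ hYl le_rfl)
  have h1 := sum_altSum_ladder hYl f
  have h2 := sum_altSum_ladder hY' f
  have hsub : Fintype.piFinset Y' ⊆ Fintype.piFinset (fun j => insert (x j) (Y' j)) :=
    Fintype.piFinset_subset _ _ fun j => Finset.subset_insert _ _
  have hs : ∀ y ∈ Fintype.piFinset Y',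
      succPt (fun j => insert (x j) (Y' j)) b y = succPt Y' b y :=
    fun y hy => funext fun j =>
      ladderSucc_insert_left (hY' j) (hx j) (Fintype.mem_piFinset.1 hy j)
  have h3 : ∑ y ∈ Fintype.piFinset Y', altSum f y (succPt (fun j => insert (x j) (Y' j)) b y) =
      altSum f x' b := by
    rw [← h2]
    exact Finset.sum_congr rfl fun y hy => by rw [hs y hy]
  rw [← Finset.sum_sdiff hsub, add_comm,
    Finset.sum_congr rfl (fun y hy => by rw [← hs y hy])]
  refine add_le_add ?_ le_rfl
  rw [← ENNReal.ofReal_sum_of_nonneg (fun _ _ => abs_nonneg _)]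
  refine ENNReal.ofReal_le_ofReal ?_
  rw [← h1, ← h3, ← Finset.sum_sdiff hsub, add_sub_cancel_right]
  exact Finset.abs_sum_le_sum_abs _ _

theorem isLadder_singleton (a b : ℝ) : IsLadder {a} a b := ⟨by simp, by simp⟩

theorem vitaliVar_add_le (f : (ι → ℝ) → ℝ) {x x' b : ι → ℝ} (hx : x ≤ x') (hb : ∀ j, x' j < b j) :
    vitaliVar f x' b + ENNReal.ofReal |altSum f x b - altSum f x' b| ≤ vitaliVar f x b := by
  conv_lhs => rw [vitaliVar]
  rw [ENNReal.iSup_add]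
  refine iSup_le fun Y' => ?_
  by_cases hY' : ∀ j, IsLadder (Y' j) (x' j) (b j)
  · rw [iSup_pos hY']
    exact sum_ladder_add_le_vitaliVar f hx hb hY'
  -- Families that are not ladders contribute `0` to the supremum; the one-point ladder supplies the
  -- bound for them.
  · rw [iSup_neg hY', bot_eq_zero, zero_add]
    exact le_add_self.trans
      (sum_ladder_add_le_vitaliVar f hx hb fun j => isLadder_singleton (x' j) (b j))

theorem vitaliVar_anti (f : (ι → ℝ) → ℝ) {x x' b : ι → ℝ} (hx : x ≤ x') (hb : ∀ j, x' j < b j) :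
    vitaliVar f x' b ≤ vitaliVar f x b :=
  le_self_add.trans (vitaliVar_add_le f hx hb)

end BoundedVariation

/-! ### Hardy-Krause variation: an expansion into slices, control of increments, boundedness -/

section HardyKrause

variable {ι : Type*} [Fintype ι] [DecidableEq ι]

theorem altSum_eq_zero_of_eq (f : (ι → ℝ) → ℝ) {a b : ι → ℝ} {j : ι} (h : a j = b j) :
    altSum f a b = 0 := by
  -- In coordinate `j` the increment is zero, so it may be written as a sum over no cells at all;
  -- the grid is then empty.
  have key := sum_altSum_piFinset (fun i => if i = j then (∅ : Finset Unit) else {()})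
    (fun i _ => a i) (fun i _ => b i) a b (fun i g => by
      by_cases hi : i = j
      · subst hi; simp [h]
      · simp [hi]) f
  rw [← key, Finset.sum_eq_zero]
  intro t ht
  have := Fintype.mem_piFinset.1 ht j
  simp at this

theorem abs_altSum_le_vitaliVar (f : (ι → ℝ) → ℝ) {x b : ι → ℝ} :
    ENNReal.ofReal |altSum f x b| ≤ vitaliVar f x b := by
  have h := sum_altSum_ladder (fun j => isLadder_singleton (x j) (b j)) f
  refine le_trans ?_ (le_iSup₂_of_le _ (fun j => isLadder_singleton (x j) (b j)) le_rfl)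
  rw [← h, ← ENNReal.ofReal_sum_of_nonneg (fun _ _ => abs_nonneg _)]
  exact ENNReal.ofReal_le_ofReal (Finset.abs_sum_le_sum_abs _ _)

theorem glue_corner_part {ι : Type*} [DecidableEq ι] (u : Finset ι) (v : Finset u) (x b : ι → ℝ) :
    glue u (corner v (part u x) (part u b)) b =
      corner (v.map (Function.Embedding.subtype _)) x b := by
  funext j
  by_cases hj : j ∈ u
  · by_cases hv : (⟨j, hj⟩ : u) ∈ v
    · simp [glue, corner, part, hj, hv]
    · simp [glue, corner, part, hj, hv]
  · simp [glue, corner, hj]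

theorem altSum_slice {ι : Type*} [DecidableEq ι] (f : (ι → ℝ) → ℝ) (u : Finset ι) (x b : ι → ℝ) :
    altSum (slice f u b) (part u x) (part u b) =
      ∑ v ∈ u.powerset, (-1 : ℝ) ^ v.card * f (corner v x b) := by
  unfold altSum slice
  refine Finset.sum_bij' (fun v _ => v.map (Function.Embedding.subtype _))
    (fun v _ => v.subtype (· ∈ u)) ?_ (fun _ _ => Finset.mem_univ _) ?_ ?_ ?_
  · intro v _
    rw [Finset.mem_powerset]
    intro j hj
    obtain ⟨i, _, rfl⟩ := Finset.mem_map.1 hj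
    exact i.2
  · intro v _
    ext i
    simp
  · intro v hv
    rw [Finset.mem_powerset] at hv
    exact Finset.subtype_map_of_mem fun j hj => hv hj
  · intro v _
    rw [glue_corner_part, Finset.card_map]

/-- This is the expansion of the product of `-1 + 1_{j ∉ v}` over `j`, in which any index outside
`v` produces a zero factor. -/
theorem sum_supersets_neg_one_pow (v : Finset ι) :
    ∑ u : Finset ι, (if v ⊆ u then (-1 : ℝ) ^ u.card else 0) =
      if v = Finset.univ then (-1 : ℝ) ^ (Fintype.card ι) else 0 := by
  have h := Finset.prod_add (fun _ : ι => (-1 : ℝ)) (fun j => if j ∈ v then (0 : ℝ) else 1)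
    Finset.univ
  rw [Finset.powerset_univ] at h
  have h2 : ∀ u : Finset ι, (∏ _j ∈ u, (-1 : ℝ)) * ∏ j ∈ Finset.univ \ u,
      (if j ∈ v then (0 : ℝ) else 1) = if v ⊆ u then (-1 : ℝ) ^ u.card else 0 := by
    intro u
    rw [Finset.prod_const]
    split_ifs with hvu
    · rw [Finset.prod_eq_one, mul_one]
      intro j hj
      rw [if_neg fun hjv => (Finset.mem_sdiff.1 hj).2 (hvu hjv)]
    · obtain ⟨j, hjv, hju⟩ := Finset.not_subset.1 hvu
      rw [Finset.prod_eq_zero (i := j) (by simp [hju]) (by simp [hjv]), mul_zero]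
  rw [← Finset.sum_congr rfl fun u _ => h2 u, ← h]
  split_ifs with hv
  · subst hv
    simp
  · obtain ⟨j, hj⟩ : ∃ j, j ∉ v := by
      by_contra! hcon
      exact hv (Finset.eq_univ_iff_forall.2 hcon)
    exact Finset.prod_eq_zero (Finset.mem_univ j) (by simp [hj])

/-- The expansion of `f x` into alternating sums over the boxes `[x_u, b_u]`. -/
theorem eq_sum_altSum_slice (f : (ι → ℝ) → ℝ) (x b : ι → ℝ) :
    f x = ∑ u : Finset ι, (-1 : ℝ) ^ u.card * altSum (slice f u b) (part u x) (part u b) := by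
  simp_rw [altSum_slice]
  have h1 : ∀ u : Finset ι, (-1 : ℝ) ^ u.card * ∑ v ∈ u.powerset,
      (-1 : ℝ) ^ v.card * f (corner v x b) = ∑ v : Finset ι,
        (-1 : ℝ) ^ v.card * f (corner v x b) * (if v ⊆ u then (-1 : ℝ) ^ u.card else 0) := by
    intro u
    rw [Finset.mul_sum]
    have : u.powerset = Finset.univ.filter (· ⊆ u) := by ext; simp
    rw [this, Finset.sum_filter]
    refine Finset.sum_congr rfl fun v _ => ?_
    split_ifs <;> ring
  -- After the exchange of sums the signs over the supersets of `v` cancel unless `v` is everything,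
  -- and then the corner is `x`.
  rw [Finset.sum_congr rfl fun u _ => h1 u, Finset.sum_comm]
  simp_rw [← Finset.mul_sum, sum_supersets_neg_one_pow]
  rw [Finset.sum_eq_single Finset.univ (by intro v _ hv; simp [hv]) (by simp)]
  have : corner Finset.univ x b = x := by funext j; simp [corner]
  have h2 : ((-1 : ℝ) ^ Fintype.card ι) * ((-1 : ℝ) ^ Fintype.card ι) = 1 := by
    rw [← mul_pow]; simp
  rw [this, if_pos rfl, Finset.card_univ]
  linear_combination (-f x) * h2

theorem BVHK.vitaliVar_lt_top {f : (ι → ℝ) → ℝ} {a b : ι → ℝ} (h : BVHK f a b) {u : Finset ι}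
    (hu : u.Nonempty) : vitaliVar (slice f u b) (part u a) (part u b) < ⊤ :=
  (ENNReal.sum_lt_top.1 h) u (by simpa using hu)

theorem abs_sub_altSum_slice_le {f : (ι → ℝ) → ℝ} {a b : ι → ℝ} (h : BVHK f a b) {x x' : ι → ℝ}
    (hax : a ≤ x) (hx : x ≤ x') (hb : ∀ j, x' j < b j) {u : Finset ι} (hu : u.Nonempty) :
    |altSum (slice f u b) (part u x) (part u b) - altSum (slice f u b) (part u x') (part u b)| ≤
      (vitaliVar (slice f u b) (part u x) (part u b)).toReal -
        (vitaliVar (slice f u b) (part u x') (part u b)).toReal := by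
  have h1 := vitaliVar_add_le (slice f u b) (x := part u x) (x' := part u x') (b := part u b)
    (fun j => hx j) (fun j => hb j)
  have h2 : vitaliVar (slice f u b) (part u x) (part u b) < ⊤ :=
    (vitaliVar_anti (slice f u b) (x := part u a) (x' := part u x) (b := part u b)
      (fun j => hax j) (fun j => (hx j).trans_lt (hb j))).trans_lt (h.vitaliVar_lt_top hu)
  have h3 : vitaliVar (slice f u b) (part u x') (part u b) < ⊤ :=
    (le_self_add.trans h1).trans_lt h2
  have h4 := ENNReal.toReal_mono h2.ne h1
  rw [ENNReal.toReal_add h3.ne ENNReal.ofReal_ne_top, ENNReal.toReal_ofReal (abs_nonneg _)] at h4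
  linarith

open Classical in
/-- The sum of the variations of all slices over `[x, b]`, as an antitone function of `x`. -/
noncomputable def tailVar (f : (ι → ℝ) → ℝ) (b x : ι → ℝ) : ℝ :=
  ∑ u ∈ (Finset.univ : Finset (Finset ι)).filter (fun u => u.Nonempty),
    (vitaliVar (slice f u b) (part u x) (part u b)).toReal

/-- In the expansion into slices the term of the empty set is the constant `f b` and cancels;
superadditivity bounds every other term. Only points ordered coordinatewise are compared. -/
theorem abs_sub_le_tailVar {f : (ι → ℝ) → ℝ} {a b : ι → ℝ} (h : BVHK f a b) {x x' : ι → ℝ}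
    (hax : a ≤ x) (hx : x ≤ x') (hb : ∀ j, x' j < b j) :
    |f x - f x'| ≤ tailVar f b x - tailVar f b x' := by
  rw [eq_sum_altSum_slice f x b, eq_sum_altSum_slice f x' b, tailVar, tailVar,
    ← Finset.sum_sub_distrib, ← Finset.sum_sub_distrib, Finset.sum_filter]
  refine (Finset.abs_sum_le_sum_abs _ _).trans (Finset.sum_le_sum fun u _ => ?_)
  rw [← mul_sub, abs_mul, abs_pow, abs_neg, abs_one, one_pow, one_mul]
  split_ifs with hu
  · exact abs_sub_altSum_slice_le h hax hx hb hu
  · rw [Finset.not_nonempty_iff_eq_empty] at hu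
    subst hu
    rw [Subsingleton.elim (part ∅ x) (part ∅ x'), sub_self, abs_zero]

theorem BVHK.bounded {f : (ι → ℝ) → ℝ} {a b : ι → ℝ} (h : BVHK f a b) :
    ∃ M, ∀ x ∈ Icc a b, |f x| ≤ M := by
  refine ⟨|f b| + ∑ u ∈ (Finset.univ : Finset (Finset ι)).filter (fun u => u.Nonempty),
    (vitaliVar (slice f u b) (part u a) (part u b)).toReal, fun x hx => ?_⟩
  rw [eq_sum_altSum_slice f x b, ← Finset.sum_filter_add_sum_filter_not _ (fun u => u.Nonempty),
    add_comm]
  refine (abs_add_le _ _).trans (add_le_add (le_of_eq ?_) ?_)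
  · have : (Finset.univ : Finset (Finset ι)).filter (fun u => ¬ u.Nonempty) = {∅} := by
      ext u; simp
    rw [this, Finset.sum_singleton, altSum_slice]
    have : corner ∅ x b = b := by funext j; simp [corner]
    simp [this]
  · refine (Finset.abs_sum_le_sum_abs _ _).trans (Finset.sum_le_sum fun u hu => ?_)
    rw [abs_mul, abs_pow, abs_neg, abs_one, one_pow, one_mul]
    -- Monotonicity of the variation requires points strictly below `b`; if a coordinate in `u`
    -- reaches `b`, the alternating sum vanishes.
    by_cases hlt : ∀ j ∈ u, x j < b j
    · rw [← ENNReal.ofReal_le_iff_le_toReal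
        (h.vitaliVar_lt_top (Finset.mem_filter.1 hu).2).ne]
      exact (abs_altSum_le_vitaliVar _).trans
        (vitaliVar_anti _ (fun j => hx.1 j) (fun j => hlt j j.2))
    · push Not at hlt
      obtain ⟨j, hj, hle⟩ := hlt
      rw [altSum_eq_zero_of_eq _ (j := (⟨j, hj⟩ : u)) (le_antisymm (hx.2 j) hle), abs_zero]
      exact ENNReal.toReal_nonneg

end HardyKrause

/-! ### Almost everywhere continuity -/

section Antitone

variable {ι : Type*} [Fintype ι]

/-- The superlevel sets at rational levels are lower sets, whose frontiers are null. Off these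
countably many frontiers the function can jump over no rational level. -/
theorem ae_continuousAt_of_antitone {g : (ι → ℝ) → ℝ} (hg : Antitone g) :
    ∀ᵐ z, ContinuousAt g z := by
  have hq : ∀ q : ℚ, ∀ᵐ z : ι → ℝ, z ∉ frontier {x | (q : ℝ) < g x} := fun q => by
    have hl : IsLowerSet {x : ι → ℝ | (q : ℝ) < g x} := fun x y hyx hx => lt_of_lt_of_le hx (hg hyx)
    exact measure_eq_zero_iff_ae_notMem.1 hl.null_frontier
  have mem_gt : ∀ q : ℚ, ∀ {z : ι → ℝ}, z ∈ {x | (q : ℝ) < g x} → (q : ℝ) < g z := fun _ _ h => h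
  filter_upwards [ae_all_iff.2 hq] with z hz
  rw [ContinuousAt, tendsto_order]
  constructor
  · intro c hc
    obtain ⟨q, hcq, hq⟩ := exists_rat_btwn hc
    have hint : z ∈ interior {x | (q : ℝ) < g x} := by
      by_contra hcon
      exact hz q ⟨subset_closure hq, hcon⟩
    filter_upwards [mem_interior_iff_mem_nhds.1 hint] with y hy
    exact hcq.trans hy
  · intro c hc
    obtain ⟨q, hq, hqc⟩ := exists_rat_btwn hc
    have hcl : z ∉ closure {x | (q : ℝ) < g x} := fun hcon =>
      hz q ⟨hcon, fun hint => lt_asymm hq (mem_gt q (interior_subset hint))⟩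
    filter_upwards [isClosed_closure.isOpen_compl.mem_nhds hcl] with y hy
    exact lt_of_le_of_lt (not_lt.1 fun h => hy (subset_closure h)) hqc

/-- The function inherits continuity from its antitone control `tailVar`. -/
theorem BVHK.ae_continuousAt [DecidableEq ι] {f : (ι → ℝ) → ℝ} {a b : ι → ℝ} (h : BVHK f a b) :
    ∀ᵐ z : ι → ℝ, (∀ j, z j ∈ Ioo (a j) (b j)) → ContinuousAt f z := by
  classical
  -- An extension of `tailVar` to the whole space: the join with `a` moves points into the range
  -- where the variation is finite, and the value `0` elsewhere preserves antitonicity because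
  -- `tailVar` is nonnegative.
  let W : (ι → ℝ) → ℝ := fun x => if ∀ j, x j < b j ∧ a j < b j then tailVar f b (x ⊔ a) else 0
  have hW : Antitone W := by
    intro x y hxy
    simp only [W]
    by_cases hy : ∀ j, y j < b j ∧ a j < b j
    · have hx : ∀ j, x j < b j ∧ a j < b j := fun j => ⟨(hxy j).trans_lt (hy j).1, (hy j).2⟩
      rw [if_pos hx, if_pos hy]
      have := abs_sub_le_tailVar h (x := x ⊔ a) (x' := y ⊔ a) le_sup_right
        (sup_le_sup_right hxy a) (fun j => max_lt (hy j).1 (hy j).2)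
      linarith [abs_nonneg (f (x ⊔ a) - f (y ⊔ a))]
    · rw [if_neg hy]
      split_ifs
      · exact Finset.sum_nonneg fun _ _ => ENNReal.toReal_nonneg
      · exact le_rfl
  filter_upwards [ae_continuousAt_of_antitone hW] with z hz hmem
  have hbox : ∀ᶠ x in 𝓝 z, ∀ j, x j ∈ Ioo (a j) (b j) := by
    rw [eventually_all]
    exact fun j => (continuous_apply j).continuousAt.eventually (isOpen_Ioo.mem_nhds (hmem j))
  have hWx : ∀ x : ι → ℝ, (∀ j, x j ∈ Ioo (a j) (b j)) → W x = tailVar f b x := by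
    intro x hx
    simp only [W]
    rw [if_pos fun j => ⟨(hx j).2, (hx j).1.trans (hx j).2⟩, sup_eq_left.2 fun j => (hx j).1.le]
  have hinf : Tendsto (fun x => x ⊓ z) (𝓝 z) (𝓝 z) := by
    have : Continuous (fun x : ι → ℝ => x ⊓ z) := 
      continuous_pi fun j => (continuous_apply j).min continuous_const
    simpa using this.tendsto z
  -- Points near `z` need not be comparable with `z`, but both `x` and `z` lie above `x ⊓ z`, so the
  -- increment is split there.
  have hlim : Tendsto (fun x => (W (x ⊓ z) - W z) + (W (x ⊓ z) - W x)) (𝓝 z) (𝓝 0) := by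
    have h1 : Tendsto (fun x => W (x ⊓ z)) (𝓝 z) (𝓝 (W z)) := hz.tendsto.comp hinf
    have := (h1.sub_const (W z)).add (h1.sub hz.tendsto)
    simpa using this
  rw [ContinuousAt, tendsto_iff_norm_sub_tendsto_zero]
  refine squeeze_zero' (Eventually.of_forall fun _ => norm_nonneg _) ?_ hlim
  filter_upwards [hbox] with x hx
  have hm : ∀ j, (x ⊓ z) j ∈ Ioo (a j) (b j) := fun j =>
    ⟨lt_min (hx j).1 (hmem j).1, (min_le_left _ _).trans_lt (hx j).2⟩
  have h1 := abs_sub_le_tailVar h (x := x ⊓ z) (x' := z) (fun j => (hm j).1.le) inf_le_right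
    fun j => (hmem j).2
  have h2 := abs_sub_le_tailVar h (x := x ⊓ z) (x' := x) (fun j => (hm j).1.le) inf_le_left
    fun j => (hx j).2
  rw [hWx _ hm, hWx _ hx, hWx _ hmem, Real.norm_eq_abs]
  calc |f x - f z| = |(f (x ⊓ z) - f z) - (f (x ⊓ z) - f x)| := by ring_nf
    _ ≤ |f (x ⊓ z) - f z| + |f (x ⊓ z) - f x| := abs_sub _ _
    _ ≤ _ := add_le_add h1 h2

end Antitone

/-! ### The extended continuous mapping theorem -/

section ContinuousMapping

/-- The truncated distance `min (d x y) 1` as a real number. -/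
noncomputable def truncDist {E : Type*} [PseudoEMetricSpace E] (x y : E) : ℝ :=
  (min (edist x y) 1).toReal

section truncDist

variable {E : Type*} [PseudoEMetricSpace E]

theorem truncDist_nonneg (x y : E) : 0 ≤ truncDist x y := ENNReal.toReal_nonneg

theorem truncDist_self (x : E) : truncDist x x = 0 := by simp [truncDist]

theorem truncDist_triangle (x y z : E) : truncDist x z ≤ truncDist x y + truncDist y z := by
  have hfin : ∀ u v : E, min (edist u v) 1 ≠ ⊤ := fun u v =>
    ((min_le_right _ _).trans_lt ENNReal.one_lt_top).ne
  unfold truncDist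
  rw [← ENNReal.toReal_add (hfin _ _) (hfin _ _)]
  refine ENNReal.toReal_mono (ENNReal.add_ne_top.2 ⟨hfin _ _, hfin _ _⟩) ?_
  rcases le_total (edist x y) 1 with h1 | h1
  · rcases le_total (edist y z) 1 with h2 | h2
    · rw [min_eq_left h1, min_eq_left h2]
      exact (min_le_left _ _).trans (edist_triangle _ _ _)
    · rw [min_eq_right h2]
      exact (min_le_right _ _).trans le_add_self
  · rw [min_eq_right h1]
    exact (min_le_right _ _).trans le_self_add

theorem truncDist_comm (x y : E) : truncDist x y = truncDist y x := by
  simp [truncDist, edist_comm]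

theorem tendsto_truncDist (z : E) : Tendsto (fun y => truncDist z y) (𝓝 z) (𝓝 0) := by
  have h : Tendsto (fun y => min (edist z y) 1) (𝓝 z) (𝓝 0) := by
    have : Continuous fun y => min (edist z y) 1 :=
      (continuous_const.edist continuous_id).min continuous_const
    simpa using this.tendsto z
  exact (ENNReal.tendsto_toReal ENNReal.zero_ne_top).comp h

theorem lt_of_truncDist_lt {x y : E} {c : ℝ} (hc : c ≤ 1) (h : truncDist x y < c) :
    edist x y < ENNReal.ofReal c := by
  by_contra! hcon
  have h1 : ENNReal.ofReal c ≤ min (edist x y) 1 := le_min hcon (by simpa using hc)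
  have h2 := ENNReal.toReal_mono ((min_le_right _ _).trans_lt ENNReal.one_lt_top).ne h1
  rw [ENNReal.toReal_ofReal ((truncDist_nonneg x y).trans h.le)] at h2
  exact absurd h (not_lt.2 h2)

end truncDist

section upperEnv

variable {Ω E κ : Type*} [PseudoEMetricSpace E]

/-- The terms whose supremum is `upperEnv`. -/
noncomputable def envTerm (X : κ → Ω → E) (ψ : κ → Ω → ℝ) (M : ℝ) (S : Set κ) (A : Set Ω) (c : ℝ)
    (z : E) (p : Option {p : κ × Ω // p.1 ∈ S ∧ p.2 ∈ A}) : ℝ :=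
  p.elim (-M) fun p => ψ p.1.1 p.1.2 - c * truncDist (X p.1.1 p.1.2) z

/-- The `c`-Lipschitz upper envelope of the values `ψ` attained at the points `X`. -/
noncomputable def upperEnv (X : κ → Ω → E) (ψ : κ → Ω → ℝ) (M : ℝ) (S : Set κ) (A : Set Ω) (c : ℝ)
    (z : E) : ℝ :=
  ⨆ p, envTerm X ψ M S A c z p

variable {X : κ → Ω → E} {ψ : κ → Ω → ℝ} {M : ℝ} {S : Set κ} {A : Set Ω} {c : ℝ}

theorem envTerm_le (hM : 0 ≤ M) (hψ : ∀ i ω, |ψ i ω| ≤ M) (hc : 0 ≤ c) (z : E)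
    (p : Option {p : κ × Ω // p.1 ∈ S ∧ p.2 ∈ A}) : envTerm X ψ M S A c z p ≤ M := by
  rcases p with _ | p
  · simp only [envTerm, Option.elim]; linarith
  · have h1 := (abs_le.1 (hψ p.1.1 p.1.2)).2
    have h2 := mul_nonneg hc (truncDist_nonneg (X p.1.1 p.1.2) z)
    simp only [envTerm, Option.elim]
    linarith

theorem envTerm_le_upperEnv (hM : 0 ≤ M) (hψ : ∀ i ω, |ψ i ω| ≤ M) (hc : 0 ≤ c) (z : E)
    (p : Option {p : κ × Ω // p.1 ∈ S ∧ p.2 ∈ A}) :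
    envTerm X ψ M S A c z p ≤ upperEnv X ψ M S A c z :=
  le_ciSup (f := envTerm X ψ M S A c z) ⟨M, by rintro _ ⟨p, rfl⟩; exact envTerm_le hM hψ hc z p⟩ p

/-- The index `none`, with value `-M`, keeps the supremum over a nonempty family and bounded below
even if no pair is admissible. -/
theorem abs_upperEnv_le (hM : 0 ≤ M) (hψ : ∀ i ω, |ψ i ω| ≤ M) (hc : 0 ≤ c) (z : E) :
    |upperEnv X ψ M S A c z| ≤ M :=
  abs_le.2 ⟨envTerm_le_upperEnv (X := X) (S := S) (A := A) hM hψ hc z none,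
    ciSup_le fun p => envTerm_le hM hψ hc z p⟩

theorem upperEnv_le_add (hM : 0 ≤ M) (hψ : ∀ i ω, |ψ i ω| ≤ M) (hc : 0 ≤ c) (z z' : E) :
    upperEnv X ψ M S A c z ≤ upperEnv X ψ M S A c z' + c * truncDist z z' := by
  refine ciSup_le fun p => ?_
  have h1 := envTerm_le_upperEnv (X := X) (S := S) (A := A) hM hψ hc z' p
  refine le_trans ?_ (add_le_add h1 le_rfl)
  rcases p with _ | p
  · have := mul_nonneg hc (truncDist_nonneg z z')
    simp only [envTerm, Option.elim]; linarith
  · have := mul_le_mul_of_nonneg_left (truncDist_triangle (X p.1.1 p.1.2) z z') hc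
    simp only [envTerm, Option.elim]; linarith

/-- The envelope is `c`-Lipschitz for the truncated distance whatever the functions `ψ` are, so no
regularity of `ψ` enters. -/
theorem continuous_upperEnv (hM : 0 ≤ M) (hψ : ∀ i ω, |ψ i ω| ≤ M) (hc : 0 ≤ c) :
    Continuous (upperEnv X ψ M S A c) := by
  rw [continuous_iff_continuousAt]
  intro z
  rw [ContinuousAt, tendsto_iff_norm_sub_tendsto_zero]
  refine squeeze_zero (fun _ => norm_nonneg _) (fun y => ?_)
    (by simpa using (tendsto_truncDist z).const_mul c)
  have h1 := upperEnv_le_add (X := X) (S := S) (A := A) hM hψ hc z y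
  have h2 := upperEnv_le_add (X := X) (S := S) (A := A) hM hψ hc y z
  rw [truncDist_comm y z] at h2
  exact abs_le.2 ⟨by linarith, by linarith⟩

theorem le_upperEnv (hM : 0 ≤ M) (hψ : ∀ i ω, |ψ i ω| ≤ M) (hc : 0 ≤ c) {i : κ} (hi : i ∈ S)
    {ω : Ω} (hω : ω ∈ A) : ψ i ω ≤ upperEnv X ψ M S A c (X i ω) := by
  have := envTerm_le_upperEnv (X := X) hM hψ hc (X i ω) (some ⟨(i, ω), hi, hω⟩)
  simpa [envTerm, truncDist_self] using this

/-- Terms at distance less than `δ` from `z` are at most `L` by assumption. For the others the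
penalty is at least `c * δ ≥ 2 * M`, which pushes them below `-M ≤ L`. -/
theorem upperEnv_le (hψ : ∀ i ω, |ψ i ω| ≤ M) (hc : 0 ≤ c) {z : E} {L δ : ℝ} (hL : -M ≤ L)
    (hδ1 : δ ≤ 1) (hcδ : 2 * M ≤ c * δ)
    (h : ∀ i ∈ S, ∀ ω ∈ A, edist (X i ω) z < ENNReal.ofReal δ → ψ i ω ≤ L) :
    upperEnv X ψ M S A c z ≤ L := by
  refine ciSup_le fun p => ?_
  rcases p with _ | ⟨⟨i, ω⟩, hi, hω⟩
  · exact hL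
  · simp only [envTerm, Option.elim]
    rcases lt_or_ge (truncDist (X i ω) z) δ with hlt | hge
    · have := h i hi ω hω (lt_of_truncDist_lt hδ1 hlt)
      have := mul_nonneg hc (truncDist_nonneg (X i ω) z)
      linarith
    · have := mul_le_mul_of_nonneg_left hge hc
      have := (abs_le.1 (hψ i ω)).2
      linarith

end upperEnv

theorem integrable_of_abs_le {α : Type*} [MeasurableSpace α] {μ : Measure α} [IsFiniteMeasure μ]
    {f : α → ℝ} {M : ℝ} (hf : AEStronglyMeasurable f μ) (hb : ∀ x, |f x| ≤ M) : Integrable f μ :=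
  Integrable.of_bound hf M (Eventually.of_forall hb)

section ExtendedMapping

variable {Ω Ω' E κ : Type*} [MeasurableSpace Ω] [MeasurableSpace Ω'] [PseudoEMetricSpace E]
  [MeasurableSpace E] [BorelSpace E] {P : Measure Ω} [IsProbabilityMeasure P] {P' : Measure Ω'}
  [IsProbabilityMeasure P'] {l : Filter κ} [l.IsCountablyGenerated] {X : κ → Ω → E} {Y : Ω' → E}
  {ψ : κ → Ω → ℝ} {H : Ω' → ℝ} {M : ℝ} {A : Set Ω}

/-- The functions `ψ i` vary with `i`, so weak convergence does not apply to them. They are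
majorized, for `i` far out, by one fixed continuous function of `X i`, the envelope. Weak
convergence applies to the envelope, and as it sharpens, its excess over `H` at `Y` tends to `0`. -/
theorem eventually_integral_le_of_continuous_convergence
    (h : TendstoInDistribution X l Y (fun _ => P) P')
    (hψ : ∀ i ω, |ψ i ω| ≤ M) (hψm : ∀ i, AEStronglyMeasurable (ψ i) P)
    (hH : ∀ ω', |H ω'| ≤ M) (hHm : AEStronglyMeasurable H P') (hA : ∀ᵐ ω ∂P, ω ∈ A)
    (hconv : ∀ᵐ ω' ∂P', ∀ ε : ℝ, 0 < ε → ∃ s ∈ l, ∃ δ : ℝ, 0 < δ ∧ ∀ i ∈ s, ∀ ω ∈ A,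
      edist (X i ω) (Y ω') < ENNReal.ofReal δ → |ψ i ω - H ω'| < ε) {η : ℝ} (hη : 0 < η) :
    ∀ᶠ i in l, ∫ ω, ψ i ω ∂P ≤ ∫ ω', H ω' ∂P' + η := by
  obtain ⟨ω₀⟩ : Nonempty Ω' := P'.nonempty_of_neZero
  have hM : 0 ≤ M := (abs_nonneg _).trans (hH ω₀)
  obtain ⟨S, hS⟩ := l.exists_antitone_basis
  -- The number `N` plays two parts: the indices are restricted to the `N`-th basis set of the
  -- filter, and the Lipschitz constant is `N`.
  let U : ℕ → E → ℝ := fun N => upperEnv X ψ M (S N) A N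
  have hUc : ∀ N, Continuous (U N) := fun N => continuous_upperEnv hM hψ N.cast_nonneg
  have hUb : ∀ N z, |U N z| ≤ M := fun N z => abs_upperEnv_le hM hψ N.cast_nonneg z
  have hYm : ∀ N, AEStronglyMeasurable (fun ω' => U N (Y ω')) P' := fun N =>
    ((hUc N).measurable.comp_aemeasurable h.aemeasurable_limit).aestronglyMeasurable
  have hXm : ∀ N i, AEStronglyMeasurable (fun ω => U N (X i ω)) P := fun N i =>
    ((hUc N).measurable.comp_aemeasurable (h.forall_aemeasurable i)).aestronglyMeasurable
  -- Taking the maximum with `H` makes the lower half of the pointwise limit trivial, so only an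
  -- upper bound on the envelope is needed.
  have hlim : Tendsto (fun N : ℕ => ∫ ω', max (U N (Y ω')) (H ω') ∂P') atTop
      (𝓝 (∫ ω', H ω' ∂P')) := by
    refine tendsto_integral_of_dominated_convergence (fun _ => M)
      (fun N => (hYm N).sup hHm) (integrable_const _) (fun N => Eventually.of_forall fun ω' => ?_) ?_
    · rcases max_choice (U N (Y ω')) (H ω') with h | h <;> rw [h]
      · exact hUb N _
      · exact hH _
    · filter_upwards [hconv] with ω' hω'
      rw [tendsto_order]
      refine ⟨fun c hc => Eventually.of_forall fun N => hc.trans_le (le_max_right _ _),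
        fun c hc => ?_⟩
      -- The tolerance `(c - H) / 2` bounds the nearby values by the midpoint of `c` and `H`, which
      -- leaves a strict inequality for the supremum.
      obtain ⟨s, hs, δ, hδ, hsδ⟩ := hω' ((c - H ω') / 2) (by linarith)
      obtain ⟨N₀, -, hN₀⟩ := hS.1.mem_iff.1 hs
      have hδ' : 0 < min δ 1 := lt_min hδ one_pos
      obtain ⟨N₁, hN₁⟩ := exists_nat_ge (2 * M / min δ 1)
      filter_upwards [eventually_ge_atTop (max N₀ N₁)] with N hN
      refine max_lt (lt_of_le_of_lt (upperEnv_le (L := (c + H ω') / 2) hψ N.cast_nonneg ?_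
        (min_le_right δ 1) ?_ fun i hi ω hω hd => ?_) ?_) hc
      · have := (abs_le.1 (hH ω')).1
        linarith
      · rw [div_le_iff₀ hδ'] at hN₁
        refine hN₁.trans (mul_le_mul_of_nonneg_right ?_ hδ'.le)
        exact_mod_cast (le_max_right _ _).trans hN
      · have := hsδ i (hN₀ (hS.2 ((le_max_left _ _).trans hN) hi)) ω hω
          (hd.trans_le (ENNReal.ofReal_le_ofReal (min_le_left _ _)))
        linarith [(abs_lt.1 this).2]
      · linarith
  obtain ⟨N, hN⟩ := (hlim.eventually (gt_mem_nhds
    (show ∫ ω', H ω' ∂P' < ∫ ω', H ω' ∂P' + η by linarith))).exists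
  have hUY : ∫ ω', U N (Y ω') ∂P' < ∫ ω', H ω' ∂P' + η := by
    refine lt_of_le_of_lt (integral_mono (integrable_of_abs_le (hYm N) fun _ => hUb N _) ?_
      fun ω' => le_max_left _ _) hN
    refine integrable_of_abs_le (M := M) ((hYm N).sup hHm) fun ω' => ?_
    rcases max_choice (U N (Y ω')) (H ω') with h | h <;> rw [h]
    · exact hUb N _
    · exact hH _
  have hUX : Tendsto (fun i => ∫ ω, U N (X i ω) ∂P) l (𝓝 (∫ ω', U N (Y ω') ∂P')) := by
    have := ProbabilityMeasure.tendsto_iff_forall_integral_tendsto.1 h.tendsto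
      (BoundedContinuousFunction.ofNormedAddCommGroup (U N) (hUc N) M (hUb N))
    simp only [ProbabilityMeasure.coe_mk,
      BoundedContinuousFunction.coe_ofNormedAddCommGroup] at this
    rw [integral_map h.aemeasurable_limit (hUc N).measurable.aestronglyMeasurable] at this
    refine this.congr fun i => ?_
    rw [integral_map (h.forall_aemeasurable i) (hUc N).measurable.aestronglyMeasurable]
  filter_upwards [hUX.eventually (gt_mem_nhds hUY), hS.1.mem_of_mem trivial (i := N)] with i hi hiS
  refine le_trans (integral_mono_ae (integrable_of_abs_le (hψm i) (hψ i))
    (integrable_of_abs_le (hXm N i) fun _ => hUb N _) ?_)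
    hi.le
  filter_upwards [hA] with ω hω
  exact le_upperEnv hM hψ N.cast_nonneg hiS hω

/-- The extended continuous mapping theorem: if `X i ⇒ Y` and the bounded functions `ψ i ω` are
close to `H ω'` whenever `X i ω` is close to `Y ω'`, then their expectations converge. -/
theorem tendsto_integral_of_continuous_convergence
    (h : TendstoInDistribution X l Y (fun _ => P) P')
    (hψ : ∀ i ω, |ψ i ω| ≤ M) (hψm : ∀ i, AEStronglyMeasurable (ψ i) P)
    (hH : ∀ ω', |H ω'| ≤ M) (hHm : AEStronglyMeasurable H P') (hA : ∀ᵐ ω ∂P, ω ∈ A)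
    (hconv : ∀ᵐ ω' ∂P', ∀ ε : ℝ, 0 < ε → ∃ s ∈ l, ∃ δ : ℝ, 0 < δ ∧ ∀ i ∈ s, ∀ ω ∈ A,
      edist (X i ω) (Y ω') < ENNReal.ofReal δ → |ψ i ω - H ω'| < ε) :
    Tendsto (fun i => ∫ ω, ψ i ω ∂P) l (𝓝 (∫ ω', H ω' ∂P')) := by
  rw [Metric.tendsto_nhds]
  intro η hη
  have h1 := eventually_integral_le_of_continuous_convergence h hψ hψm hH hHm hA hconv
    (half_pos hη)
  -- The lower bound is the upper bound for the negated functions.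
  have h2 := eventually_integral_le_of_continuous_convergence (ψ := fun i ω => -ψ i ω)
    (H := fun ω' => -H ω') h (fun i ω => by rw [abs_neg]; exact hψ i ω) (fun i => (hψm i).neg)
    (fun ω' => by rw [abs_neg]; exact hH ω') hHm.neg hA
    (hconv.mono fun ω' hω' ε hε => by
      obtain ⟨s, hs, δ, hδ, hsδ⟩ := hω' ε hε
      refine ⟨s, hs, δ, hδ, fun i hi ω hω hd => ?_⟩
      rw [← neg_sub', abs_neg]
      exact hsδ i hi ω hω hd) (half_pos hη)
  filter_upwards [h1, h2] with i hi1 hi2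
  rw [integral_neg, integral_neg] at hi2
  rw [Real.dist_eq, abs_lt]
  constructor <;> linarith

end ExtendedMapping

end ContinuousMapping

/-! ### Paths in the Skorohod space -/

section SkorohodSpace

variable {q : ℕ} {a b : Fin q → ℝ}

theorem IsCadlag.finset_sum {κ : Type*} (s : Finset κ) {f : κ → (Fin q → ℝ) → ℝ}
    (h : ∀ i, IsCadlag (path a b (f i))) : IsCadlag (path a b fun x => ∑ i ∈ s, f i x) := by
  refine ⟨fun t L => ?_, fun t => tendsto_finsetSum s fun i _ => (h i).2 t⟩
  choose l hl using fun i => (h i).1 t L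
  exact ⟨∑ i ∈ s, l i, tendsto_finsetSum s fun i _ => hl i⟩

theorem IsCadlag.const_mul {f : (Fin q → ℝ) → ℝ} (h : IsCadlag (path a b f)) (c : ℝ) :
    IsCadlag (path a b fun x => c * f x) := by
  refine ⟨fun t L => ?_, fun t => (h.2 t).const_mul c⟩
  obtain ⟨l, hl⟩ := h.1 t L
  exact ⟨c * l, hl.const_mul c⟩

theorem isCadlag_of_continuousOn {f : (Fin q → ℝ) → ℝ} (hf : ContinuousOn f (Icc a b)) :
    IsCadlag (path a b f) := by
  have hc : Continuous (path a b f) := hf.comp_continuous continuous_subtype_val fun t => t.2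
  exact ⟨fun t L => ⟨_, hc.continuousAt.mono_left nhdsWithin_le_nhds⟩,
    fun t => hc.continuousAt.mono_left nhdsWithin_le_nhds⟩

theorem isCadlag_step_mul {f : (Fin q → ℝ) → ℝ} (hf : ContinuousOn f (Icc a b)) (p : Fin q)
    (c : ℝ) : IsCadlag (path a b fun x => if c ≤ x p then f x else 0) := by
  have hc : Continuous (path a b f) := hf.comp_continuous continuous_subtype_val fun t => t.2
  have hp : Continuous fun t : Icc a b => (t : Fin q → ℝ) p :=
    (continuous_apply p).comp continuous_subtype_val
  -- Within a quadrant at `t` the step is eventually constant. Only the tie `c = t p` depends on the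
  -- quadrant, and there the closed inequality gives continuity from above.
  have key : ∀ t : Icc a b, ∀ L : Finset (Fin q),
      Tendsto (path a b fun x => if c ≤ x p then f x else 0) (𝓝[quadrant L t] t)
        (𝓝 (if c < (t : Fin q → ℝ) p ∨ (c = (t : Fin q → ℝ) p ∧ p ∉ L) then f t else 0)) := by
    intro t L
    rcases lt_trichotomy c ((t : Fin q → ℝ) p) with h | h | h
    · rw [if_pos (Or.inl h)]
      refine (hc.continuousAt.mono_left nhdsWithin_le_nhds).congr' ?_
      filter_upwards [nhdsWithin_le_nhds (hp.continuousAt.eventually (lt_mem_nhds h))] with s hs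
      simp only [path]
      rw [if_pos (le_of_lt hs)]
    · by_cases hL : p ∈ L
      · rw [if_neg (by rintro (h' | h'); exacts [h'.ne h, h'.2 hL])]
        refine tendsto_const_nhds.congr' ?_
        filter_upwards [self_mem_nhdsWithin] with s hs
        have := hs p
        rw [if_pos hL, ← h] at this
        simp only [path]
        rw [if_neg (not_le.2 this)]
      · rw [if_pos (Or.inr ⟨h, hL⟩)]
        refine (hc.continuousAt.mono_left nhdsWithin_le_nhds).congr' ?_
        filter_upwards [self_mem_nhdsWithin] with s hs
        have := hs p
        rw [if_neg hL, ← h] at this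
        simp only [path]
        rw [if_pos this]
    · rw [if_neg (by rintro (h' | h'); exacts [lt_asymm h h', h.ne' h'.1])]
      refine tendsto_const_nhds.congr' ?_
      filter_upwards [nhdsWithin_le_nhds (hp.continuousAt.eventually (gt_mem_nhds h))] with s hs
      simp only [path]
      rw [if_neg (not_le.2 hs)]
  refine ⟨fun t L => ⟨_, key t L⟩, fun t => ?_⟩
  have := key t ∅
  simpa [path, ← le_iff_lt_or_eq] using this

/-- The identity is an admissible time change. -/
theorem edist_toD_le {f g : (Fin q → ℝ) → ℝ} (hf : IsCadlag (path a b f))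
    (hg : IsCadlag (path a b g)) {r : ℝ} (h : ∀ x ∈ Icc a b, |f x - g x| ≤ r) :
    edist (toD a b f) (toD a b g) ≤ ENNReal.ofReal r := by
  refine (iInf_le _ (fun p => OrderIso.refl _)).trans
    (max_le (iSup_le fun t => ?_) (iSup_le fun t => (edist_self t).trans_le zero_le))
  have h1 : ((toD a b f : DSpace a b) : Icc a b → ℝ) = path a b f := by simp [toD, hf]
  have h2 : ((toD a b g : DSpace a b) : Icc a b → ℝ) = path a b g := by simp [toD, hg]
  rw [h1, h2, edist_dist, Real.dist_eq]
  exact ENNReal.ofReal_le_ofReal (h t t.2)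

/-- Near a continuous path the Skorohod topology is uniform: the time change moves the argument only
a little, and `β` is uniformly continuous. -/
theorem exists_forall_abs_sub_lt_of_edist_toD_lt {β : (Fin q → ℝ) → ℝ}
    (hβ : ContinuousOn β (Icc a b)) {ε : ℝ} (hε : 0 < ε) :
    ∃ δ : ℝ, 0 < δ ∧ ∀ f : (Fin q → ℝ) → ℝ, IsCadlag (path a b f) →
      edist (toD a b f) (toD a b β) < ENNReal.ofReal δ → ∀ x ∈ Icc a b, |f x - β x| < ε := by
  obtain ⟨δ, hδ, hu⟩ := Metric.uniformContinuousOn_iff.1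
    (isCompact_Icc.uniformContinuousOn_of_continuous hβ) (ε / 2) (half_pos hε)
  -- The bound `δ` controls the displacement of the argument, the bound `ε / 2` the difference of
  -- the values.
  refine ⟨min δ (ε / 2), lt_min hδ (half_pos hε), fun f hf hlt x hx => ?_⟩
  obtain ⟨lam, hlam⟩ := iInf_lt_iff.1 hlt
  have h1 : ((toD a b f : DSpace a b) : Icc a b → ℝ) = path a b f := by simp [toD, hf]
  have h2 : ((toD a b β : DSpace a b) : Icc a b → ℝ) = path a b β := by
    simp [toD, isCadlag_of_continuousOn hβ]
  let y : Icc a b := lam.act ⟨x, hx⟩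
  have h3 : edist (f x) (β y) < ENNReal.ofReal (min δ (ε / 2)) := by
    refine lt_of_le_of_lt ?_ ((le_max_left _ _).trans_lt hlam)
    refine le_trans ?_ (le_iSup _ (⟨x, hx⟩ : Icc a b))
    rw [h1, h2]
    exact le_rfl
  have h4 : edist (⟨x, hx⟩ : Icc a b) y < ENNReal.ofReal (min δ (ε / 2)) :=
    lt_of_le_of_lt (le_iSup (fun t : Icc a b => edist t (lam.act t)) ⟨x, hx⟩)
      ((le_max_right _ _).trans_lt hlam)
  have hpos : 0 < min δ (ε / 2) := lt_min hδ (half_pos hε)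
  rw [edist_dist, ENNReal.ofReal_lt_ofReal_iff hpos] at h3 h4
  have h5 := hu x hx y y.2 (h4.trans_le (min_le_left _ _))
  calc |f x - β x| = dist (f x) (β x) := rfl
    _ ≤ dist (f x) (β y) + dist (β y) (β x) := dist_triangle _ _ _
    _ < ε / 2 + ε / 2 := add_lt_add (h3.trans_le (min_le_right _ _)) (by rwa [dist_comm])
    _ = ε := add_halves ε

/-- This is the source of measurability in the Skorohod space: the random paths used are finite
combinations of deterministic paths with random coefficients. -/
theorem continuous_toD_sum {κ : Type*} (s : Finset κ) {g : κ → (Fin q → ℝ) → ℝ}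
    (hg : ∀ i, IsCadlag (path a b (g i))) {M : ℝ} (hM : ∀ i, ∀ x ∈ Icc a b, |g i x| ≤ M) :
    Continuous fun c : κ → ℝ => toD a b fun x => ∑ i ∈ s, c i * g i x := by
  rw [continuous_iff_continuousAt]
  intro c
  rw [ContinuousAt, tendsto_iff_edist_tendsto_0]
  have hcad : ∀ c : κ → ℝ, IsCadlag (path a b fun x => ∑ i ∈ s, c i * g i x) := fun c =>
    IsCadlag.finset_sum s fun i => (hg i).const_mul (c i)
  have hlim : Tendsto (fun c' : κ → ℝ => ENNReal.ofReal (∑ i ∈ s, |c' i - c i| * M)) (𝓝 c)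
      (𝓝 0) := by
    have : Continuous fun c' : κ → ℝ => ENNReal.ofReal (∑ i ∈ s, |c' i - c i| * M) := by
      exact ENNReal.continuous_ofReal.comp (by fun_prop)
    simpa using this.tendsto c
  refine tendsto_of_tendsto_of_tendsto_of_le_of_le tendsto_const_nhds hlim (fun _ => zero_le)
    fun c' => edist_toD_le (hcad c') (hcad c) fun x hx => ?_
  rw [← Finset.sum_sub_distrib]
  refine (Finset.abs_sum_le_sum_abs _ _).trans (Finset.sum_le_sum fun i _ => ?_)
  rw [← sub_mul, abs_mul]
  exact mul_le_mul_of_nonneg_left (hM i x hx) (abs_nonneg _)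

end SkorohodSpace

/-! ### Lebesgue measure on the unit cube -/

section UnitCube

variable {ι : Type*} [Fintype ι]

/-- Lebesgue measure on the unit cube `(0, 1]^ι`. -/
noncomputable def unitCube (ι : Type*) [Fintype ι] : Measure (ι → ℝ) :=
  Measure.pi fun _ => volume.restrict (Ioc 0 1)

instance isProbabilityMeasure_Ioc : IsProbabilityMeasure (volume.restrict (Ioc (0 : ℝ) 1)) :=
  ⟨by simp⟩

instance isProbabilityMeasure_unitCube : IsProbabilityMeasure (unitCube ι) := by
  unfold unitCube; infer_instance

theorem ae_unitCube : ∀ᵐ u ∂unitCube ι, ∀ j, u j ∈ Ioc (0 : ℝ) 1 := by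
  rw [ae_all_iff]
  intro j
  have h := (Measure.quasiMeasurePreserving_eval (fun _ : ι => volume.restrict (Ioc (0 : ℝ) 1)) j)
  exact h.ae (ae_restrict_mem measurableSet_Ioc)

theorem exists_bound_Icc {ι : Type*} {g : (ι → ℝ) → ℝ} {a b : ι → ℝ} (hg : ContinuousOn g (Icc a b)) :
    ∃ M, 0 ≤ M ∧ ∀ u ∈ Icc a b, |g u| ≤ M := by
  obtain ⟨M, hM⟩ := isCompact_Icc.exists_bound_of_continuousOn hg
  exact ⟨max M 0, le_max_right _ _, fun u hu => (hM u hu).trans (le_max_left _ _)⟩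

theorem Continuous.integrable_unitCube {g : (ι → ℝ) → ℝ} (hg : Continuous g) :
    Integrable g (unitCube ι) := by
  obtain ⟨M, -, hM⟩ := exists_bound_Icc (a := 0) (b := 1) hg.continuousOn
  refine Integrable.of_bound hg.aestronglyMeasurable M ?_
  filter_upwards [ae_unitCube] with u hu
  exact hM u ⟨fun j => (hu j).1.le, fun j => (hu j).2⟩

theorem integral_cell_eq {f f' : ℝ → ℝ} (hf : ∀ x, HasDerivAt f (f' x) x) (hf' : Continuous f')
    {b p q : ℝ} (hb : 0 < b) (hp : 0 ≤ p) (hpq : p ≤ q) (hq : q ≤ b) :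
    ∫ u in Ioc (0 : ℝ) 1, (if p < b * u ∧ b * u ≤ q then b * f' (b * u) else 0) = f q - f p := by
  have h1 : ∀ u : ℝ, (if p < b * u ∧ b * u ≤ q then b * f' (b * u) else 0) =
      (Ioc (p / b) (q / b)).indicator (fun u => b * f' (b * u)) u := by
    intro u
    rw [indicator_apply]
    refine if_congr ?_ rfl rfl
    rw [mem_Ioc, div_lt_iff₀' hb, le_div_iff₀' hb]
  simp_rw [h1]
  rw [setIntegral_indicator measurableSet_Ioc]
  have h2 : Ioc (0 : ℝ) 1 ∩ Ioc (p / b) (q / b) = Ioc (p / b) (q / b) := by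
    rw [inter_eq_right]
    exact Ioc_subset_Ioc (by positivity) (by rwa [div_le_one hb])
  rw [h2, ← intervalIntegral.integral_of_le (by gcongr)]
  have h3 : ∀ u ∈ uIcc (p / b) (q / b), HasDerivAt (fun u => f (b * u)) (b * f' (b * u)) u := by
    intro u _
    have := (hf (b * u)).comp u ((hasDerivAt_id u).const_mul b)
    simpa [mul_comm, Function.comp_def] using this
  rw [intervalIntegral.integral_eq_sub_of_hasDerivAt h3]
  · simp only [mul_div_cancel₀ _ hb.ne']
  · exact (by fun_prop : Continuous fun u => b * f' (b * u)).intervalIntegrable _ _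

end UnitCube

/-! ### Riemann-Stieltjes integrals with smooth product integrators -/

section RiemannStieltjes

variable {ι : Type*} [Fintype ι] [DecidableEq ι]

/-- On a nondegenerate box there are ladders of arbitrarily small mesh, so both values are close to
one common sum. -/
theorem HasRSIntegral.unique {h f : (ι → ℝ) → ℝ} {a b : ι → ℝ} {I J : ℝ} (hab : ∀ j, a j < b j)
    (hI : HasRSIntegral h f a b I) (hJ : HasRSIntegral h f a b J) : I = J := by
  refine eq_of_forall_dist_le fun η hη => ?_
  obtain ⟨δ₁, hδ₁, h₁⟩ := hI (η / 2) (half_pos hη)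
  obtain ⟨δ₂, hδ₂, h₂⟩ := hJ (η / 2) (half_pos hη)
  choose Y hY hmesh using fun j => exists_ladder_mesh_lt (hab j) (lt_min hδ₁ hδ₂)
  have htag : ∀ y ∈ Fintype.piFinset Y, y ∈ Icc y (succPt Y b y) := fun y hy =>
    ⟨le_rfl, fun j => (ladderSucc_mem_Icc (hY j) (hab j).le (Fintype.mem_piFinset.1 hy j)).1⟩
  have e₁ := h₁ Y hY (fun j y hy => (hmesh j y hy).trans_le (min_le_left _ _)) id htag
  have e₂ := h₂ Y hY (fun j y hy => (hmesh j y hy).trans_le (min_le_right _ _)) id htag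
  rw [abs_lt] at e₁ e₂
  rw [Real.dist_eq, abs_le]
  constructor <;> linarith [e₁.1, e₁.2, e₂.1, e₂.2]

theorem HasRSIntegral.rsIntegral_eq {h f : (ι → ℝ) → ℝ} {a b : ι → ℝ} {I : ℝ}
    (hab : ∀ j, a j < b j) (hI : HasRSIntegral h f a b I) : rsIntegral h f a b = I := by
  have H : ∃ I, HasRSIntegral h f a b I := ⟨I, hI⟩
  rw [rsIntegral, dif_pos H]
  exact H.choose_spec.unique hab hI

theorem HasRSIntegral.congr {h h' f : (ι → ℝ) → ℝ} {a b : ι → ℝ} {I : ℝ} (hab : a ≤ b)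
    (hI : HasRSIntegral h f a b I) (hh : ∀ x ∈ Icc a b, h x = h' x) :
    HasRSIntegral h' f a b I := by
  intro η hη
  obtain ⟨δ, hδ, H⟩ := hI η hη
  refine ⟨δ, hδ, fun Y hY hmesh c hc => ?_⟩
  rw [← Finset.sum_congr rfl fun y hy => ?_]
  · exact H Y hY hmesh c hc
  · have hy' := fun j => Fintype.mem_piFinset.1 hy j
    rw [hh (c y) ⟨fun j => ((hY j).left_le (hy' j)).trans ((hc y hy).1 j),
      fun j => ((hc y hy).2 j).trans (ladderSucc_mem_Icc (hY j) (hab j) (hy' j)).2⟩]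

/-- The telescoping sum for the indicator of `z ≤ x` says that `z` lies in exactly one half-open
cell. -/
theorem sum_ladder_cell {Y : Finset ℝ} {b z : ℝ} (hY : IsLadder Y 0 b) (hb : 0 ≤ b) (hz : 0 < z)
    (hzb : z ≤ b) :
    ∑ y ∈ Y, (if y < z ∧ z ≤ ladderSucc Y b y then (1 : ℝ) else 0) = 1 := by
  have h := hY.telescope fun x => if z ≤ x then (1 : ℝ) else 0
  rw [if_pos hzb, if_neg (not_le.2 hz), sub_zero] at h
  refine (Finset.sum_congr rfl fun y hy => ?_).trans h
  have := (ladderSucc_mem_Icc hY hb hy).1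
  by_cases h1 : z ≤ y
  · rw [if_neg fun h => absurd h.1 (not_lt.2 h1), if_pos h1, if_pos (h1.trans this), sub_self]
  · rw [if_neg h1, sub_zero]
    exact if_congr (and_iff_right (not_le.1 h1)) rfl rfl

/-- Riemann-Stieltjes integrals of continuous functions with respect to products of `C¹`
functions. -/
theorem hasRSIntegral_prod {h : (ι → ℝ) → ℝ} (hh : Continuous h) (C : ℝ) {f f' : ι → ℝ → ℝ}
    (hf : ∀ j x, HasDerivAt (f j) (f' j x) x) (hf' : ∀ j, Continuous (f' j)) {b : ι → ℝ}
    (hb : ∀ j, 0 < b j) :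
    HasRSIntegral h (fun z => C * ∏ j, f j (z j)) 0 b
      (C * ∫ u, h (b * u) * ∏ j, (b j * f' j (b j * u j)) ∂unitCube ι) := by
  intro η hη
  have hFc : Continuous fun u : ι → ℝ => ∏ j, (b j * f' j (b j * u j)) := by fun_prop
  have hhc : Continuous fun u : ι → ℝ => h (b * u) := by fun_prop
  have hhF : Continuous fun u : ι → ℝ => h (b * u) * ∏ j, (b j * f' j (b j * u j)) := hhc.mul hFc
  obtain ⟨K, hK0, hK⟩ := exists_bound_Icc (a := 0) (b := 1) hFc.continuousOn
  -- The total error will be at most `|C| * K` times this tolerance; the added `1` avoids division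
  -- by zero and makes the final bound strict.
  obtain ⟨δ, hδ, hu⟩ := Metric.uniformContinuousOn_iff.1
    ((isCompact_Icc (a := (0 : ι → ℝ)) (b := b)).uniformContinuousOn_of_continuous hh.continuousOn)
    (η / (|C| * K + 1)) (by positivity)
  refine ⟨δ, hδ, fun Y hY hmesh c hc => ?_⟩
  let cell : (ι → ℝ) → (ι → ℝ) → ℝ := fun y u =>
    ∏ j, if y j < b j * u j ∧ b j * u j ≤ ladderSucc (Y j) (b j) (y j) then (1 : ℝ) else 0
  have hcellm : ∀ y, Measurable (cell y) := fun y => by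
    refine Finset.measurable_prod _ fun j _ => Measurable.ite ?_ measurable_const measurable_const
    exact (measurableSet_lt measurable_const ((measurable_pi_apply j).const_mul _)).inter
      (measurableSet_le ((measurable_pi_apply j).const_mul _) measurable_const)
  have hcell01 : ∀ y u, 0 ≤ cell y u ∧ cell y u ≤ 1 := fun y u =>
    ⟨Finset.prod_nonneg fun j _ => by split_ifs <;> norm_num,
      Finset.prod_le_one (fun j _ => by split_ifs <;> norm_num)
        fun j _ => by split_ifs <;> norm_num⟩
  have hint : ∀ y, ∀ {g : (ι → ℝ) → ℝ}, Continuous g →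
      Integrable (fun u => g u * cell y u) (unitCube ι) := fun y g hg =>
    (Continuous.integrable_unitCube hg).mul_bdd (c := 1) (hcellm y).aestronglyMeasurable
      (Eventually.of_forall fun u => by
        rw [Real.norm_eq_abs, abs_of_nonneg (hcell01 y u).1]; exact (hcell01 y u).2)
  have hone : ∀ᵐ u ∂unitCube ι, ∑ y ∈ Fintype.piFinset Y, cell y u = 1 := by
    filter_upwards [ae_unitCube] with u hu
    simp only [cell]
    rw [← Finset.prod_univ_sum Y fun j y =>
      if y < b j * u j ∧ b j * u j ≤ ladderSucc (Y j) (b j) y then (1 : ℝ) else 0]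
    refine Finset.prod_eq_one fun j _ => sum_ladder_cell (hY j) (hb j).le
      (mul_pos (hb j) (hu j).1) ?_
    nlinarith [hb j, (hu j).2]
  have hFcell : ∀ y ∈ Fintype.piFinset Y,
      ∫ u, (∏ j, (b j * f' j (b j * u j))) * cell y u ∂unitCube ι =
        ∏ j, (f j (ladderSucc (Y j) (b j) (y j)) - f j (y j)) := by
    intro y hy
    have hy' := fun j => Fintype.mem_piFinset.1 hy j
    have e : ∀ u : ι → ℝ, (∏ j, (b j * f' j (b j * u j))) * cell y u =
        ∏ j, (fun x : ℝ => if y j < b j * x ∧ b j * x ≤ ladderSucc (Y j) (b j) (y j) then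
          b j * f' j (b j * x) else 0) (u j) := by
      intro u
      simp only [cell]
      rw [← Finset.prod_mul_distrib]
      exact Finset.prod_congr rfl fun j _ => by simp only [mul_ite, mul_one, mul_zero]
    rw [unitCube, integral_congr_ae (Eventually.of_forall e)]
    refine (integral_fintype_prod_eq_prod (μ := fun _ => volume.restrict (Ioc (0 : ℝ) 1))
      (fun j x => if y j < b j * x ∧ b j * x ≤ ladderSucc (Y j) (b j) (y j) then
          b j * f' j (b j * x) else 0)).trans (Finset.prod_congr rfl fun j _ => ?_)
    have hs := ladderSucc_mem_Icc (hY j) (hb j).le (hy' j)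
    exact integral_cell_eq (hf j) (hf' j) (hb j) ((hY j).left_le (hy' j)) hs.1 hs.2
  have hI : ∫ u, h (b * u) * ∏ j, (b j * f' j (b j * u j)) ∂unitCube ι =
      ∑ y ∈ Fintype.piFinset Y,
        ∫ u, h (b * u) * (∏ j, (b j * f' j (b j * u j))) * cell y u ∂unitCube ι := by
    rw [← integral_finsetSum _ fun y _ => hint y hhF]
    refine integral_congr_ae ?_
    filter_upwards [hone] with u hu
    rw [← Finset.mul_sum, hu, mul_one]
  -- The increment over a cell is the integral of the density over it, so each summand differs from
  -- its share of the integral only through the oscillation of `h` on the cell.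
  have hdiff : ∀ y ∈ Fintype.piFinset Y,
      |h (c y) * (C * ∏ j, (f j (ladderSucc (Y j) (b j) (y j)) - f j (y j))) -
        C * ∫ u, h (b * u) * (∏ j, (b j * f' j (b j * u j))) * cell y u ∂unitCube ι| ≤
        |C| * (K * (η / (|C| * K + 1)) * ∫ u, cell y u ∂unitCube ι) := by
    intro y hy
    have hy' := fun j => Fintype.mem_piFinset.1 hy j
    rw [← hFcell y hy, mul_left_comm, ← mul_sub, abs_mul, ← integral_const_mul,
      ← integral_sub ((hint y hFc).const_mul _) (hint y hhF), ← integral_const_mul]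
    refine mul_le_mul_of_nonneg_left ?_ (abs_nonneg C)
    have hci : Integrable (cell y) (unitCube ι) := by
      simpa using hint y (g := fun _ => 1) continuous_const
    rw [← Real.norm_eq_abs]
    refine norm_integral_le_of_norm_le (hci.const_mul _) ?_
    filter_upwards [ae_unitCube] with u hu'
    by_cases hcell : cell y u = 0
    · simp [hcell]
    have hin : ∀ j, y j < b j * u j ∧ b j * u j ≤ ladderSucc (Y j) (b j) (y j) := by
      intro j
      by_contra hcon
      exact hcell (Finset.prod_eq_zero (Finset.mem_univ j) (if_neg hcon))
    have hsb := fun j => ladderSucc_mem_Icc (hY j) (hb j).le (hy' j)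
    have hd : dist (c y) (b * u) < δ := by
      rw [dist_pi_lt_iff hδ]
      intro j
      rw [Real.dist_eq, abs_lt]
      have h1 := (hc y hy).1 j
      have h2 := (hc y hy).2 j
      have h3 := hmesh j (y j) (hy' j)
      have h4 := hin j
      simp only [Pi.mul_apply, succPt] at *
      constructor <;> linarith [h4.1, h4.2]
    have h1 := hu (c y) ⟨fun j => ((hY j).left_le (hy' j)).trans ((hc y hy).1 j),
        fun j => ((hc y hy).2 j).trans (hsb j).2⟩ (b * u)
      ⟨fun j => (mul_pos (hb j) (hu' j).1).le, fun j => (hin j).2.trans (hsb j).2⟩ hd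
    have h2 := hK u ⟨fun j => (hu' j).1.le, fun j => (hu' j).2⟩
    rw [mul_assoc, ← sub_mul, ← mul_assoc, norm_mul, norm_mul, Real.norm_eq_abs (cell y u),
      abs_of_nonneg (hcell01 y u).1, mul_comm K]
    refine mul_le_mul_of_nonneg_right ?_ (hcell01 y u).1
    exact mul_le_mul h1.le h2 (norm_nonneg _) (by positivity)
  rw [hI, Finset.mul_sum, Finset.sum_congr rfl fun y _ => by rw [altSum_const_mul_prod],
    ← Finset.sum_sub_distrib]
  refine (Finset.abs_sum_le_sum_abs _ _).trans_lt
    ((Finset.sum_le_sum fun y hy => hdiff y hy).trans_lt ?_)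
  rw [← Finset.mul_sum, ← Finset.mul_sum, ← integral_finsetSum _ fun y _ => by
      simpa using hint y (g := fun _ => 1) continuous_const,
    integral_congr_ae hone]
  simp only [integral_const, probReal_univ, smul_eq_mul, mul_one]
  rw [← mul_assoc, mul_div_assoc', div_lt_iff₀ (by positivity)]
  nlinarith [mul_nonneg (abs_nonneg C) hK0]

end RiemannStieltjes

/-! ### Smoothness and bounds of the reconstruction kernel -/

section Kernel

/-- On the real line `sinc` is the difference quotient of the sine at `0`, which extends to an
entire function. -/
theorem contDiff_sinc : ContDiff ℝ 1 Real.sinc := by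
  have h1 : ContDiff ℂ 1 (dslope Complex.sin 0) := by
    refine Differentiable.contDiff ?_
    rw [← differentiableOn_univ, Complex.differentiableOn_dslope univ_mem]
    exact Complex.differentiable_sin.differentiableOn
  have h2 := h1.real_of_complex
  suffices h3 : Real.sinc = fun x : ℝ => (dslope Complex.sin 0 x).re by rw [h3]; exact h2
  funext x
  rcases eq_or_ne x 0 with rfl | hx
  · simp
  · have hx' : (x : ℂ) ≠ 0 := by exact_mod_cast hx
    rw [Real.sinc_of_ne_zero hx, dslope_of_ne _ hx', slope_def_field]
    simp only [Complex.sin_zero, sub_zero]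
    rw [← Complex.ofReal_sin, ← Complex.ofReal_div, Complex.ofReal_re]

/-- One factor of the reconstruction kernel. -/
noncomputable def kfac (a y : ℝ) : ℝ := a / Real.pi * Real.sinc (a * y)

/-- The derivative of a factor of the reconstruction kernel. -/
noncomputable def kfacDeriv (a y : ℝ) : ℝ := a / Real.pi * (deriv Real.sinc (a * y) * a)

theorem hasDerivAt_kfac (a y : ℝ) : HasDerivAt (kfac a) (kfacDeriv a y) y := by
  have h1 : HasDerivAt Real.sinc (deriv Real.sinc (a * y)) (a * y) :=
    (contDiff_sinc.differentiable one_ne_zero _).hasDerivAt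
  have h2 : HasDerivAt (fun y => a * y) a y := by simpa using (hasDerivAt_id y).const_mul a
  exact (h1.comp y h2).const_mul _

theorem continuous_kfacDeriv (a : ℝ) : Continuous (kfacDeriv a) := by
  have := contDiff_sinc.continuous_deriv le_rfl
  unfold kfacDeriv
  fun_prop

theorem continuous_kfac (a : ℝ) : Continuous (kfac a) := by
  have := Real.continuous_sinc
  unfold kfac
  fun_prop

theorem abs_kfac_le (a y : ℝ) : |kfac a y| ≤ |a| / Real.pi := by
  rw [kfac, abs_mul, abs_div, abs_of_pos Real.pi_pos]
  exact mul_le_of_le_one_right (by positivity) (Real.abs_sinc_le_one _)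

theorem kernel_eq_prod_kfac (Om x : Fin 3 → ℝ) : kernel Om x = ∏ j, kfac (Om j) (x j) := rfl

theorem continuous_kernel (Om : Fin 3 → ℝ) : Continuous (kernel Om) :=
  continuous_finsetProd _ fun j _ => (continuous_kfac (Om j)).comp (continuous_apply j)

theorem abs_kernel_le (Om x : Fin 3 → ℝ) : |kernel Om x| ≤ ∏ j, (|Om j| / Real.pi) := by
  rw [kernel_eq_prod_kfac, Finset.abs_prod]
  exact Finset.prod_le_prod (fun _ _ => abs_nonneg _) fun j _ => abs_kfac_le _ _

end Kernel

/-! ### Integration by parts in one variable, as an integral over `δ_1 + dv` -/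

section Weight

/-- The measure `δ_1 + dv` on `(0, 1]`, against which integration by parts takes place. -/
noncomputable def partsMeasure : Measure ℝ := Measure.dirac 1 + volume.restrict (Ioc 0 1)

instance isFiniteMeasure_partsMeasure : IsFiniteMeasure partsMeasure := by
  unfold partsMeasure; infer_instance

/-- The density with respect to `partsMeasure` that represents `z ↦ kfac a (t - κ z)` on `(0, b]`,
where `z = b v`. -/
noncomputable def weight (a b κ t v : ℝ) : ℝ :=
  if v = 1 then kfac a (t - κ * b) else κ * (b * kfacDeriv a (t - κ * (b * v)))

theorem measurable_weight (a b κ t : ℝ) : Measurable (weight a b κ t) := by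
  have h := continuous_kfacDeriv a
  exact Measurable.ite (measurableSet_singleton 1) measurable_const
    (by fun_prop : Continuous fun v : ℝ => κ * (b * kfacDeriv a (t - κ * (b * v)))).measurable

theorem exists_weight_bound (a R : ℝ) : ∃ C, 0 ≤ C ∧ ∀ b κ t v, |b| ≤ R → |κ| ≤ R → |t| ≤ R →
    |v| ≤ 1 → |weight a b κ t v| ≤ C := by
  obtain ⟨C, hC⟩ := (isCompact_Icc (a := -(R + R * R)) (b := R + R * R)).exists_bound_of_continuousOn
    (continuous_kfacDeriv a).continuousOn
  refine ⟨max (|a| / Real.pi) (R * R * C), le_max_of_le_left (by positivity),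
    fun b κ t v hb hκ ht hv => ?_⟩
  have hR : 0 ≤ R := (abs_nonneg _).trans hb
  unfold weight
  split_ifs
  · exact (abs_kfac_le _ _).trans (le_max_left _ _)
  · refine le_max_of_le_right ?_
    have h1 : |κ * (b * v)| ≤ R * R := by
      rw [abs_mul, abs_mul]
      exact mul_le_mul hκ ((mul_le_of_le_one_right (abs_nonneg _) hv).trans hb) (by positivity) hR
    have h2 : |t - κ * (b * v)| ≤ R + R * R := (abs_sub _ _).trans (add_le_add ht h1)
    have h3 := hC _ (abs_le.1 h2)
    rw [abs_mul, abs_mul, ← mul_assoc]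
    exact mul_le_mul (mul_le_mul hκ hb (abs_nonneg _) hR) h3 (abs_nonneg _) (by positivity)

theorem continuous_weight (a v : ℝ) :
    Continuous fun p : ℝ × ℝ × ℝ => weight a p.1 p.2.1 p.2.2 v := by
  have h1 := continuous_kfac a
  have h2 := continuous_kfacDeriv a
  unfold weight
  split_ifs <;> fun_prop

theorem ae_partsMeasure : ∀ᵐ v ∂partsMeasure, v ∈ Ioc (0 : ℝ) 1 := by
  rw [partsMeasure, ae_add_measure_iff]
  exact ⟨(ae_dirac_iff (p := fun v => v ∈ Ioc (0 : ℝ) 1) measurableSet_Ioc).2 (by simp), ae_restrict_mem measurableSet_Ioc⟩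

theorem integral_partsMeasure {f : ℝ → ℝ} (hf : Integrable f (volume.restrict (Ioc 0 1))) :
    ∫ v, f v ∂partsMeasure = f 1 + ∫ v in Ioc 0 1, f v := by
  rw [partsMeasure, integral_add_measure (integrable_dirac (by simp)) hf, integral_dirac]

/-- The fundamental theorem of calculus on `[z, b]`: the atom at `1` contributes the boundary value
at `b`, the Lebesgue part the integral of the derivative. -/
theorem integral_weight (a κ t : ℝ) {b z : ℝ} (hz : 0 ≤ z) (hb : 0 < b) (hzb : z ≤ b) :
    ∫ v, (if z ≤ b * v then weight a b κ t v else 0) ∂partsMeasure = kfac a (t - κ * z) := by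
  have hc := continuous_kfacDeriv a
  have hd : ∀ x, HasDerivAt (fun x => -kfac a (t - κ * x)) (κ * kfacDeriv a (t - κ * x)) x := by
    intro x
    have h1 : HasDerivAt (fun x => t - κ * x) (-κ) x := by
      simpa using ((hasDerivAt_id x).const_mul κ).const_sub t
    have := ((hasDerivAt_kfac a (t - κ * x)).comp x h1).fun_neg
    simpa [Function.comp_def, mul_comm] using this
  have key := integral_cell_eq hd (by fun_prop) hb hz hzb le_rfl
  have hint : Integrable (fun v => if z ≤ b * v then weight a b κ t v else 0)
      (volume.restrict (Ioc 0 1)) := by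
    obtain ⟨C, hC0, hC⟩ := exists_weight_bound a (max |b| (max |κ| |t|))
    refine Integrable.of_bound (Measurable.ite (measurableSet_le measurable_const (by fun_prop))
      (measurable_weight a b κ t) measurable_const).aestronglyMeasurable C ?_
    filter_upwards [ae_restrict_mem measurableSet_Ioc] with v hv
    split_ifs
    · exact hC b κ t v (le_max_left _ _) ((le_max_left _ _).trans (le_max_right _ _))
        ((le_max_right _ _).trans (le_max_right _ _)) (abs_le.2 ⟨by linarith [hv.1], hv.2⟩)
    · simpa using hC0
  rw [integral_partsMeasure hint]
  -- Two null events are discarded: at `v = 1` the weight takes its boundary value, and at `v = z /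
  -- b` strict and weak inequality differ.
  have hae : ∀ᵐ v ∂volume.restrict (Ioc (0 : ℝ) 1), (if z ≤ b * v then weight a b κ t v else 0) =
      if z < b * v ∧ b * v ≤ b then b * (κ * kfacDeriv a (t - κ * (b * v))) else 0 := by
    have h0 : ∀ c : ℝ, ∀ᵐ v ∂volume.restrict (Ioc (0 : ℝ) 1), v ≠ c := fun c =>
      ae_restrict_of_ae (Measure.ae_ne volume c)
    filter_upwards [ae_restrict_mem measurableSet_Ioc, h0 1, h0 (z / b)] with v hv hv1 hvz
    have h1 : b * v ≤ b := by nlinarith [hv.2]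
    have h2 : z ≠ b * v := fun h => hvz (by rw [h]; field_simp)
    rw [weight, if_neg hv1]
    by_cases h3 : z ≤ b * v
    · rw [if_pos h3, if_pos ⟨lt_of_le_of_ne h3 h2, h1⟩]; ring
    · rw [if_neg h3, if_neg fun h => h3 h.1.le]
  rw [integral_congr_ae hae, key, mul_one, if_pos hzb, weight, if_pos rfl]
  ring

end Weight

/-! ### The functional of the path that results from integration by parts -/

section PartsFunctional

/-- The product of the measures `partsMeasure`. -/
noncomputable def partsCube (ι : Type*) [Fintype ι] : Measure (ι → ℝ) :=
  Measure.pi fun _ => partsMeasure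

variable {ι : Type*} [Fintype ι]

instance isFiniteMeasure_partsCube : IsFiniteMeasure (partsCube ι) := by
  unfold partsCube; infer_instance

theorem ae_partsCube : ∀ᵐ u ∂partsCube ι, ∀ j, u j ∈ Ioc (0 : ℝ) 1 := by
  rw [ae_all_iff]
  intro j
  exact (Measure.quasiMeasurePreserving_eval (fun _ : ι => partsMeasure) j).ae ae_partsMeasure

/-- The density with respect to `partsCube` that represents `z ↦ kernel (t - κ z)`. -/
noncomputable def weightProd (Om b κ t v : ι → ℝ) : ℝ :=
  ∏ j, weight (Om j) (b j) (κ j) (t j) (v j)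

theorem measurable_weightProd (Om b κ t : ι → ℝ) : Measurable (weightProd Om b κ t) :=
  Finset.measurable_prod _ fun j _ => (measurable_weight _ _ _ _).comp (measurable_pi_apply j)

theorem continuous_weightProd (Om v : ι → ℝ) :
    Continuous fun p : (ι → ℝ) × (ι → ℝ) × (ι → ℝ) => weightProd Om p.1 p.2.1 p.2.2 v :=
  continuous_finsetProd _ fun j _ => (continuous_weight (Om j) (v j)).comp
    (g := fun q : ℝ × ℝ × ℝ => weight (Om j) q.1 q.2.1 q.2.2 (v j))
    (f := fun p : (ι → ℝ) × (ι → ℝ) × (ι → ℝ) => (p.1 j, p.2.1 j, p.2.2 j)) (by fun_prop)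

theorem exists_weightProd_bound (Om : ι → ℝ) (R : ℝ) : ∃ C, 0 ≤ C ∧ ∀ b κ t v : ι → ℝ,
    (∀ j, |b j| ≤ R) → (∀ j, |κ j| ≤ R) → (∀ j, |t j| ≤ R) → (∀ j, |v j| ≤ 1) →
    |weightProd Om b κ t v| ≤ C := by
  choose C hC0 hC using fun j => exists_weight_bound (Om j) R
  refine ⟨∏ j, C j, Finset.prod_nonneg fun j _ => hC0 j, fun b κ t v hb hκ ht hv => ?_⟩
  rw [weightProd, Finset.abs_prod]
  exact Finset.prod_le_prod (fun _ _ => abs_nonneg _)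
    fun j _ => hC j _ _ _ _ (hb j) (hκ j) (ht j) (hv j)

theorem abs_le_one_of_mem_Ioc {v : ℝ} (hv : v ∈ Ioc (0 : ℝ) 1) : |v| ≤ 1 :=
  abs_le.2 ⟨by linarith [hv.1], hv.2⟩

theorem integrable_weightProd (Om b κ t : ι → ℝ) :
    Integrable (weightProd Om b κ t) (partsCube ι) := by
  obtain ⟨C, hC0, hC⟩ := exists_weightProd_bound Om (‖b‖ + ‖κ‖ + ‖t‖)
  refine Integrable.of_bound (measurable_weightProd _ _ _ _).aestronglyMeasurable C ?_
  filter_upwards [ae_partsCube] with v hv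
  refine hC _ _ _ _ (fun j => ?_) (fun j => ?_) (fun j => ?_) fun j => abs_le_one_of_mem_Ioc (hv j)
  · have := norm_le_pi_norm b j
    rw [Real.norm_eq_abs] at this
    linarith [norm_nonneg κ, norm_nonneg t]
  · have := norm_le_pi_norm κ j
    rw [Real.norm_eq_abs] at this
    linarith [norm_nonneg b, norm_nonneg t]
  · have := norm_le_pi_norm t j
    rw [Real.norm_eq_abs] at this
    linarith [norm_nonneg b, norm_nonneg κ]

/-- The integral `∫ kernel (t - κ z) dβ(z)` over `(0, b]`, after integration by parts, for
functions `β` that vanish on the lower faces. -/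
noncomputable def partsIntegral (Om : ι → ℝ) (β : (ι → ℝ) → ℝ) (b κ t : ι → ℝ) : ℝ :=
  ∫ v, β (b * v) * weightProd Om b κ t v ∂partsCube ι

/-- Dominated convergence. The parameter `b` also rescales the argument of `β`, which is why `β`
must be continuous. -/
theorem continuous_partsIntegral (Om : ι → ℝ) {β : (ι → ℝ) → ℝ} (hβ : Continuous β) {M : ℝ}
    (hM : ∀ z, |β z| ≤ M) :
    Continuous fun p : (ι → ℝ) × (ι → ℝ) × (ι → ℝ) => partsIntegral Om β p.1 p.2.1 p.2.2 := by
  rw [continuous_iff_continuousAt]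
  intro p
  obtain ⟨C, hC0, hC⟩ := exists_weightProd_bound Om (‖p‖ + 1)
  have hM0 : 0 ≤ M := (abs_nonneg _).trans (hM 0)
  refine continuousAt_of_dominated (bound := fun _ => M * C) ?_ ?_ (integrable_const _) ?_
  · refine Eventually.of_forall fun p => ?_
    exact ((hβ.comp (by fun_prop : Continuous fun v => p.1 * v)).measurable.mul
      (measurable_weightProd _ _ _ _)).aestronglyMeasurable
  · filter_upwards [Metric.ball_mem_nhds p one_pos] with r hr
    have hr' : ‖r‖ ≤ ‖p‖ + 1 := by
      have := norm_sub_norm_le r p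
      rw [Metric.mem_ball, dist_eq_norm] at hr
      linarith
    have h1 : ∀ j, |r.1 j| ≤ ‖p‖ + 1 := fun j =>
      (norm_le_pi_norm r.1 j).trans ((norm_fst_le r).trans hr')
    have h2 : ∀ j, |r.2.1 j| ≤ ‖p‖ + 1 := fun j =>
      (norm_le_pi_norm r.2.1 j).trans ((norm_fst_le r.2).trans ((norm_snd_le r).trans hr'))
    have h3 : ∀ j, |r.2.2 j| ≤ ‖p‖ + 1 := fun j =>
      (norm_le_pi_norm r.2.2 j).trans ((norm_snd_le r.2).trans ((norm_snd_le r).trans hr'))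
    filter_upwards [ae_partsCube] with v hv
    rw [norm_mul]
    exact mul_le_mul (hM _) (hC _ _ _ _ h1 h2 h3 fun j => abs_le_one_of_mem_Ioc (hv j))
      (norm_nonneg _) hM0
  · refine Eventually.of_forall fun v => Continuous.continuousAt ?_
    exact (hβ.comp (by fun_prop)).mul (continuous_weightProd Om v)

end PartsFunctional

/-! ### Extension of paths from the unit cube to the whole space -/

section Clamp

variable {ι : Type*}

/-- The coordinatewise projection onto the unit cube. -/
noncomputable def clampCube (z : ι → ℝ) : ι → ℝ := fun j => max 0 (min 1 (z j))

theorem clampCube_mem (z : ι → ℝ) : clampCube z ∈ Icc (0 : ι → ℝ) 1 :=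
  ⟨fun _ => le_max_left _ _, fun _ => max_le zero_le_one (min_le_left _ _)⟩

theorem clampCube_of_mem {z : ι → ℝ} (hz : z ∈ Icc (0 : ι → ℝ) 1) : clampCube z = z := by
  funext j
  have h0 : 0 ≤ z j := hz.1 j
  have h1 : z j ≤ 1 := hz.2 j
  simp [clampCube, h0, h1]

theorem continuous_clampCube : Continuous (clampCube : (ι → ℝ) → ι → ℝ) := by
  unfold clampCube
  fun_prop

theorem continuous_comp_clampCube {β : (ι → ℝ) → ℝ} (hβ : ContinuousOn β (Icc 0 1)) :
    Continuous fun z => β (clampCube z) :=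
  hβ.comp_continuous continuous_clampCube clampCube_mem

end Clamp

/-! ### Products and boxes under gluing of coordinates -/

section Glue

variable {ι : Type*} [DecidableEq ι]

theorem glue_apply_mem {v : Finset ι} {x : v → ℝ} {z : ι → ℝ} (j : v) : glue v x z j = x j := by
  simp [glue]

theorem glue_apply_notMem {v : Finset ι} {x : v → ℝ} {z : ι → ℝ} {j : ι} (hj : j ∉ v) :
    glue v x z j = z j := by
  simp [glue, hj]

theorem continuous_glue (v : Finset ι) (z : ι → ℝ) : Continuous fun x : v → ℝ => glue v x z := by
  refine continuous_pi fun j => ?_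
  unfold glue
  split_ifs <;> fun_prop

theorem glue_mem_Icc {v : Finset ι} {x a b : v → ℝ} {z p q : ι → ℝ} (hx : x ∈ Icc a b)
    (hz : z ∈ Icc p q) (ha : ∀ j : v, p j ≤ a j) (hb : ∀ j : v, b j ≤ q j) :
    glue v x z ∈ Icc p q := by
  constructor <;> intro j <;> unfold glue <;> split_ifs with hj
  · exact (ha ⟨j, hj⟩).trans (hx.1 ⟨j, hj⟩)
  · exact hz.1 j
  · exact (hx.2 ⟨j, hj⟩).trans (hb ⟨j, hj⟩)
  · exact hz.2 j

theorem prod_glue [Fintype ι] (F : ι → ℝ → ℝ) (v : Finset ι) (x : v → ℝ) (z : ι → ℝ) :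
    ∏ j, F j (glue v x z j) = (∏ j ∈ vᶜ, F j (z j)) * ∏ j : v, F j (x j) := by
  rw [← Finset.prod_mul_prod_compl v, mul_comm,
    ← Finset.prod_coe_sort v fun j => F j (glue v x z j)]
  congr 1
  · exact Finset.prod_congr rfl fun j hj => by
      rw [glue_apply_notMem (Finset.mem_compl.1 hj)]
  · exact Finset.prod_congr rfl fun j _ => by rw [glue_apply_mem]

end Glue

/-! ### The Stieltjes integral as an integral of the path -/

section IntegrationByParts

variable {ι : Type*} [Fintype ι] [DecidableEq ι]

/-- Expanding the product of the measures `dv + δ_1` gives one term for each upper face of the cube,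
matching the terms of the integration by parts formula. -/
theorem partsCube_eq_sum :
    partsCube ι = ∑ v : Finset ι, (unitCube v).map fun u => glue v u 1 := by
  refine Measure.pi_eq fun s hs => ?_
  have h1 : ∀ j, partsMeasure (s j) =
      (volume.restrict (Ioc 0 1)) (s j) + Measure.dirac 1 (s j) := fun j => by
    rw [partsMeasure, Measure.add_apply, add_comm]
  simp_rw [h1, Finset.prod_add, Finset.powerset_univ]
  rw [Measure.finsetSum_apply]
  refine Finset.sum_congr rfl fun v _ => ?_
  rw [Measure.map_apply (continuous_glue v 1).measurable (MeasurableSet.univ_pi hs)]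
  -- If some side off `v` misses the atom, both sides vanish.
  by_cases hv : ∀ j ∉ v, (1 : ℝ) ∈ s j
  · have h2 : (fun u => glue v u 1) ⁻¹' (univ.pi s) = univ.pi fun j : v => s j := by
      ext u
      simp only [mem_preimage, mem_univ_pi]
      refine ⟨fun h j => by simpa [glue_apply_mem] using h j, fun h j => ?_⟩
      by_cases hj : j ∈ v
      · simpa [glue, hj] using h ⟨j, hj⟩
      · simpa [glue, hj] using hv j hj
    rw [h2, unitCube, Measure.pi_pi, Finset.prod_coe_sort v fun j =>
      (volume.restrict (Ioc (0 : ℝ) 1)) (s j), Finset.prod_eq_one (s := Finset.univ \ v), mul_one]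
    intro j hj
    have := hv j (Finset.mem_sdiff.1 hj).2
    simp [Measure.dirac_apply' _ (hs j), this]
  · push Not at hv
    obtain ⟨j, hj, hjs⟩ := hv
    have h2 : (fun u => glue v u 1) ⁻¹' (univ.pi s) = ∅ := by
      rw [eq_empty_iff_forall_notMem]
      intro u hu
      have := mem_univ_pi.1 hu j
      rw [show (fun u => glue v u 1) u j = 1 from glue_apply_notMem hj] at this
      exact hjs this
    rw [h2, measure_empty, Finset.prod_eq_zero (i := j) (s := Finset.univ \ v) (by simp [hj])
      (by simp [Measure.dirac_apply' _ (hs j), hjs]), mul_zero]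

theorem integral_partsCube {g : (ι → ℝ) → ℝ} (hg : Measurable g) (hi : Integrable g (partsCube ι)) :
    ∫ v, g v ∂partsCube ι = ∑ v : Finset ι, ∫ u, g (glue v u 1) ∂unitCube v := by
  rw [partsCube_eq_sum, integrable_finsetSum_measure] at hi
  rw [partsCube_eq_sum, integral_finsetSum_measure hi]
  exact Finset.sum_congr rfl fun v _ =>
    integral_map (continuous_glue v 1).measurable.aemeasurable hg.aestronglyMeasurable

theorem hasRSIntegral_slice {β : (ι → ℝ) → ℝ} (hβ : ContinuousOn β (Icc 0 1)) {F F' : ι → ℝ → ℝ}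
    (hF : ∀ j x, HasDerivAt (F j) (F' j x) x) (hF' : ∀ j, Continuous (F' j)) {b : ι → ℝ}
    (hb : ∀ j, 0 < b j) (hb1 : ∀ j, b j ≤ 1) (v w : Finset ι) :
    HasRSIntegral (slice β v (corner w 0 b)) (slice (fun z => ∏ j, F j (z j)) v (corner w 0 b))
      (part v 0) (part v b)
      ((∏ j ∈ vᶜ, F j (corner w 0 b j)) *
        ∫ u, slice (fun z => β (clampCube z)) v (corner w 0 b) (part v b * u) *
          ∏ j : v, (b j * F' j (b j * u j)) ∂unitCube v) := by
  have hs : slice (fun z => ∏ j, F j (z j)) v (corner w 0 b) =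
      fun x => (∏ j ∈ vᶜ, F j (corner w 0 b j)) * ∏ j : v, F j (x j) :=
    funext fun x => prod_glue F v x _
  rw [hs]
  have hc : corner w 0 b ∈ Icc (0 : ι → ℝ) 1 := by
    constructor <;> intro j <;> simp only [corner, Pi.zero_apply, Pi.one_apply] <;> split_ifs
    exacts [le_rfl, (hb j).le, zero_le_one, hb1 j]
  refine (hasRSIntegral_prod (ι := v) (((continuous_comp_clampCube hβ).comp
    (continuous_glue v (corner w 0 b)))) _ (fun j => hF j) (fun j => hF' j)
    (b := part v b) fun j => hb j).congr (fun j => (hb j).le) fun x hx => ?_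
  have := glue_mem_Icc hx hc (fun _ => le_rfl) fun j => hb1 j
  simp only [slice, Function.comp_apply]
  rw [clampCube_of_mem this]

theorem stieltjesExists_prod {β : (ι → ℝ) → ℝ} (hβ : ContinuousOn β (Icc 0 1)) {F F' : ι → ℝ → ℝ}
    (hF : ∀ j x, HasDerivAt (F j) (F' j x) x) (hF' : ∀ j, Continuous (F' j)) {b : ι → ℝ}
    (hb : ∀ j, 0 < b j) (hb1 : ∀ j, b j ≤ 1) :
    StieltjesExists (fun z => ∏ j, F j (z j)) β 0 b :=
  fun v w _ => ⟨_, hasRSIntegral_slice hβ hF hF' hb hb1 v w⟩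

/-- For nonempty `w` the corner has a zero coordinate off `v`, so the path vanishes on the whole
slice; only the upper faces `w = ∅` remain. -/
theorem stieltjes_prod {β : (ι → ℝ) → ℝ} (hβ : ContinuousOn β (Icc 0 1))
    (hβ0 : ∀ z ∈ Icc (0 : ι → ℝ) 1, (∃ j, z j = 0) → β z = 0) {F F' : ι → ℝ → ℝ}
    (hF : ∀ j x, HasDerivAt (F j) (F' j x) x) (hF' : ∀ j, Continuous (F' j)) {b : ι → ℝ}
    (hb : ∀ j, 0 < b j) (hb1 : ∀ j, b j ≤ 1) :
    stieltjes (fun z => ∏ j, F j (z j)) β 0 b = ∑ v : Finset ι, (-1 : ℝ) ^ v.card *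
      ((∏ j ∈ vᶜ, F j (b j)) * ∫ u, β (clampCube (glue v (part v b * u) b)) *
          ∏ j : v, (b j * F' j (b j * u j)) ∂unitCube v) := by
  refine Finset.sum_congr rfl fun v _ => ?_
  have hpart : ∀ j : v, part v 0 j < part v b j := fun j => hb j
  congr 1
  rw [Finset.sum_eq_single ∅]
  · have h0 : corner ∅ 0 b = b := by funext j; simp [corner]
    have := (hasRSIntegral_slice hβ hF hF' hb hb1 v ∅).rsIntegral_eq hpart
    rw [this, h0]
    simp [slice]
  · intro w hw hwne
    obtain ⟨j, hj⟩ := Finset.nonempty_iff_ne_empty.2 hwne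
    have hjv : j ∉ v := Finset.mem_compl.1 (Finset.mem_powerset.1 hw hj)
    rw [(hasRSIntegral_slice hβ hF hF' hb hb1 v w).rsIntegral_eq hpart]
    have : ∀ x, slice (fun z => β (clampCube z)) v (corner w 0 b) x = 0 := fun x => by
      refine hβ0 _ (clampCube_mem _) ⟨j, ?_⟩
      simp [clampCube, glue, hjv, corner, hj]
    simp [this]
  · simp

theorem hasDerivAt_kfac_sub (a t κ x : ℝ) :
    HasDerivAt (fun x => kfac a (t - κ * x)) (-(κ * kfacDeriv a (t - κ * x))) x := by
  have h1 : HasDerivAt (fun x => t - κ * x) (-κ) x := by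
    simpa using ((hasDerivAt_id x).const_mul κ).const_sub t
  have := (hasDerivAt_kfac a (t - κ * x)).comp x h1
  convert! this using 1
  ring

theorem continuous_kfacDeriv_sub (a t κ : ℝ) :
    Continuous fun x => -(κ * kfacDeriv a (t - κ * x)) := by
  have := continuous_kfacDeriv a
  fun_prop

theorem stieltjes_prod_kfac {β : (ι → ℝ) → ℝ} (hβ : ContinuousOn β (Icc 0 1))
    (hβ0 : ∀ z ∈ Icc (0 : ι → ℝ) 1, (∃ j, z j = 0) → β z = 0) (Om κ t : ι → ℝ) {b : ι → ℝ}
    (hb : ∀ j, 0 < b j) (hb1 : ∀ j, b j ≤ 1) :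
    stieltjes (fun z => ∏ j, kfac (Om j) (t j - κ j * z j)) β 0 b =
      partsIntegral Om (fun z => β (clampCube z)) b κ t := by
  have hd := fun j x => hasDerivAt_kfac_sub (Om j) (t j) (κ j) x
  have hdc := fun j => continuous_kfacDeriv_sub (Om j) (t j) (κ j)
  rw [stieltjes_prod hβ hβ0 hd hdc hb hb1, partsIntegral]
  have hβc := continuous_comp_clampCube hβ
  obtain ⟨M, -, hM⟩ := exists_bound_Icc hβ
  have hgm : Measurable fun v => β (clampCube (b * v)) * weightProd Om b κ t v :=
    (hβc.comp (by fun_prop : Continuous fun v => b * v)).measurable.mul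
      (measurable_weightProd _ _ _ _)
  have hgi : Integrable (fun v => β (clampCube (b * v)) * weightProd Om b κ t v) (partsCube ι) :=
    (integrable_weightProd Om b κ t).bdd_mul (c := M)
      (hβc.comp (by fun_prop : Continuous fun v => b * v)).measurable.aestronglyMeasurable
      (Eventually.of_forall fun v => hM _ (clampCube_mem _))
  rw [integral_partsCube hgm hgi]
  refine Finset.sum_congr rfl fun v _ => ?_
  rw [← integral_const_mul, ← integral_const_mul]
  refine integral_congr_ae ?_
  -- Almost surely no coordinate in `v` equals `1`, so the weights take the derivative branch
  -- exactly on `v` and the boundary branch off it. The sign `(-1) ^ v.card` turns the negative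
  -- derivatives into the weights.
  have hne : ∀ᵐ u ∂unitCube v, ∀ j, u j ≠ 1 := by
    rw [ae_all_iff]
    intro j
    exact (Measure.quasiMeasurePreserving_eval
      (fun _ : v => volume.restrict (Ioc (0 : ℝ) 1)) j).ae
      (ae_restrict_of_ae (Measure.ae_ne volume (1 : ℝ)))
  filter_upwards [hne] with u hu
  have h1 : b * glue v u 1 = glue v (part v b * u) b := by
    funext j
    by_cases hj : j ∈ v <;> simp [glue, hj, part]
  have h2 : weightProd Om b κ t (glue v u 1) = (∏ j ∈ vᶜ, kfac (Om j) (t j - κ j * b j)) *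
      ((-1) ^ v.card * ∏ j : v, (b j * -(κ j * kfacDeriv (Om j) (t j - κ j * (b j * u j))))) := by
    rw [weightProd, prod_glue (fun j => weight (Om j) (b j) (κ j) (t j))]
    congr 1
    · exact Finset.prod_congr rfl fun j _ => by simp [weight]
    · have : (-1 : ℝ) ^ v.card = ∏ _j : v, (-1 : ℝ) := by simp
      rw [this, ← Finset.prod_mul_distrib]
      refine Finset.prod_congr rfl fun j _ => ?_
      rw [weight, if_neg (hu j)]
      ring
  rw [h1, h2]
  ring

end IntegrationByParts

/-! ### Summation by parts and the noise part of the detection process -/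

section Noise

/-- The normalized partial sums of an array. -/
noncomputable def arraySum (e : (Fin 3 → ℤ) → ℝ) (n : Fin 3 → ℕ) (v : Fin 3 → ℝ) : ℝ :=
  (√(∏ j, (n j : ℝ)))⁻¹ * ∑ i ∈ Finset.Icc (1 : Fin 3 → ℤ) (fun j => ⌊(n j : ℝ) * v j⌋), e i

/-- The detection process for the residuals `c`. -/
noncomputable def residualField (Om : Fin 3 → ℝ) (τ : Fin 3 → ℕ → ℝ) (n : Fin 3 → ℕ)
    (c : (Fin 3 → ℤ) → ℝ) (x : Fin 4 → ℝ) : ℝ :=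
  √(∏ j, τ j (n j)) *
    ∑ l ∈ Finset.Icc (1 : Fin 3 → ℤ)
        (Function.update (fun j => (n j : ℤ)) 0 ⌊(n 0 : ℝ) * x 0⌋),
      c l * kernel Om (Fin.tail x - samplePt τ n l)

theorem residualField_add (Om : Fin 3 → ℝ) (τ : Fin 3 → ℕ → ℝ) (n : Fin 3 → ℕ)
    (c c' : (Fin 3 → ℤ) → ℝ) (x : Fin 4 → ℝ) :
    residualField Om τ n (fun l => c l + c' l) x =
      residualField Om τ n c x + residualField Om τ n c' x := by
  simp only [residualField, add_mul, Finset.sum_add_distrib, mul_add]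

/-- Summation by parts, exact for every array: the kernel at each sampling point is an integral of
indicators, and summing the indicators first leaves a partial sum of the array. -/
theorem sum_mul_prod_kfac {ι : Type*} [Fintype ι] [DecidableEq ι] (Om κ t : ι → ℝ) {n : ι → ℕ}
    (hn : ∀ j, 1 ≤ n j) (K : ι → ℤ) (e : (ι → ℤ) → ℝ) :
    ∑ l ∈ Finset.Icc 1 K, e l * ∏ j, kfac (Om j) (t j - κ j * (l j / n j)) =
      ∫ v, (∑ l ∈ Finset.Icc (1 : ι → ℤ) (fun j => ⌊(n j : ℝ) * ((K j : ℝ) / n j * v j)⌋), e l) *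
        weightProd Om (fun j => (K j : ℝ) / n j) κ t v ∂partsCube ι := by
  have hn0 : ∀ j, (0 : ℝ) < n j := fun j => by exact_mod_cast hn j
  set b : ι → ℝ := fun j => (K j : ℝ) / n j with hb
  let ind : (ι → ℤ) → (ι → ℝ) → ℝ := fun l v =>
    ∏ j, if (l j : ℝ) / n j ≤ b j * v j then (1 : ℝ) else 0
  have hind : ∀ l v, ind l v = if ∀ j, (l j : ℝ) / n j ≤ b j * v j then 1 else 0 := fun l v => by
    simp only [ind, Finset.prod_ite_zero, Finset.prod_const_one, Finset.mem_univ, true_implies]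
  have hindm : ∀ l, Measurable (ind l) := fun l =>
    Finset.measurable_prod _ fun j _ => Measurable.ite
      (measurableSet_le measurable_const ((measurable_pi_apply j).const_mul _))
      measurable_const measurable_const
  have hint : ∀ l, Integrable (fun v => weightProd Om b κ t v * ind l v) (partsCube ι) := fun l =>
    (integrable_weightProd _ _ _ _).mul_bdd (c := 1) (hindm l).aestronglyMeasurable
      (Eventually.of_forall fun v => by rw [hind]; split_ifs <;> simp)
  have h1 : ∀ l ∈ Finset.Icc 1 K, ∏ j, kfac (Om j) (t j - κ j * (l j / n j)) =
      ∫ v, weightProd Om b κ t v * ind l v ∂partsCube ι := by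
    intro l hl
    rw [Finset.mem_Icc] at hl
    have e1 : ∀ v, weightProd Om b κ t v * ind l v = ∏ j, (fun x => if (l j : ℝ) / n j ≤ b j * x
        then weight (Om j) (b j) (κ j) (t j) x else 0) (v j) := by
      intro v
      simp only [ind, weightProd]
      rw [← Finset.prod_mul_distrib]
      exact Finset.prod_congr rfl fun j _ => by simp only [mul_ite, mul_one, mul_zero]
    rw [integral_congr_ae (Eventually.of_forall e1), partsCube]
    refine Eq.symm ((integral_fintype_prod_eq_prod (μ := fun _ => partsMeasure)
      (fun j x => if (l j : ℝ) / n j ≤ b j * x then weight (Om j) (b j) (κ j) (t j) x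
        else 0)).trans (Finset.prod_congr rfl fun j _ => ?_))
    have hl1 : (1 : ℝ) ≤ l j := by exact_mod_cast hl.1 j
    have hlK : (l j : ℝ) ≤ K j := by exact_mod_cast hl.2 j
    refine integral_weight (Om j) (κ j) (t j) (div_nonneg (by linarith) (hn0 j).le)
      (div_pos (by linarith) (hn0 j)) ?_
    exact div_le_div_of_nonneg_right hlK (hn0 j).le
  rw [Finset.sum_congr rfl fun l hl => by rw [h1 l hl, ← integral_const_mul],
    ← integral_finsetSum _ fun l _ => (hint l).const_mul _]
  refine integral_congr_ae ?_
  filter_upwards [ae_partsCube] with v hv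
  -- The constraint `l ≤ K` is implied by the indicators, since `v ≤ 1` on the cube and a sum with
  -- `l ≥ 1` forces `b j > 0`.
  have h2 : Finset.Icc (1 : ι → ℤ) (fun j => ⌊(n j : ℝ) * (b j * v j)⌋) =
      (Finset.Icc 1 K).filter fun l => ∀ j, (l j : ℝ) / n j ≤ b j * v j := by
    ext l
    have hiff : ∀ j, l j ≤ ⌊(n j : ℝ) * (b j * v j)⌋ ↔ (l j : ℝ) / n j ≤ b j * v j := fun j => by
      rw [Int.le_floor, div_le_iff₀' (hn0 j)]
    simp only [Finset.mem_filter, Finset.mem_Icc]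
    constructor
    · rintro ⟨h1, h2⟩
      have h2' := fun j => (hiff j).1 (h2 j)
      refine ⟨⟨h1, fun j => ?_⟩, h2'⟩
      have h3 : (1 : ℝ) ≤ l j := by exact_mod_cast h1 j
      have h4 : (0 : ℝ) < (l j : ℝ) / n j := div_pos (by linarith) (hn0 j)
      have h5 : 0 < b j := by
        by_contra hcon
        nlinarith [(hv j).1, h2' j]
      have h6 : (l j : ℝ) / n j ≤ (K j : ℝ) / n j := (h2' j).trans
        (mul_le_of_le_one_right h5.le (hv j).2)
      rw [div_le_div_iff_of_pos_right (hn0 j)] at h6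
      exact_mod_cast h6
    · rintro ⟨⟨h1, -⟩, h2⟩
      exact ⟨h1, fun j => (hiff j).2 (h2 j)⟩
  rw [h2, Finset.sum_filter, Finset.sum_mul]
  refine Finset.sum_congr rfl fun l _ => ?_
  rw [hind]
  split_ifs <;> ring

/-- The grid time in which the first coordinate is rounded down. -/
noncomputable def gridTime (n : Fin 3 → ℕ) (s : ℝ) : Fin 3 → ℝ :=
  Function.update 1 0 ((⌊(n 0 : ℝ) * s⌋ : ℝ) / n 0)

/-- The products of the sample sizes and the sampling periods. -/
noncomputable def sampleLength (τ : Fin 3 → ℕ → ℝ) (n : Fin 3 → ℕ) : Fin 3 → ℝ :=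
  fun j => (n j : ℝ) * τ j (n j)

/-- The functional is the one of the limit; the sample size enters only through the array sums, the
rounded time and the sampled lengths. -/
theorem residualField_eq_partsIntegral (Om : Fin 3 → ℝ) (τ : Fin 3 → ℕ → ℝ) {n : Fin 3 → ℕ}
    (hn : ∀ j, 1 ≤ n j) (e : (Fin 3 → ℤ) → ℝ) (x : Fin 4 → ℝ) :
    residualField Om τ n e x = √(∏ j, sampleLength τ n j) *
      partsIntegral Om (arraySum e n) (gridTime n (x 0)) (sampleLength τ n) (Fin.tail x) := by
  have hn0 : ∀ j, (0 : ℝ) < n j := fun j => by exact_mod_cast hn j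
  have hpos : 0 < ∏ j, (n j : ℝ) := Finset.prod_pos fun j _ => hn0 j
  set K : Fin 3 → ℤ := Function.update (fun j => (n j : ℤ)) 0 ⌊(n 0 : ℝ) * x 0⌋ with hK
  have hb : gridTime n (x 0) = fun j => (K j : ℝ) / n j := by
    funext j
    rcases eq_or_ne j 0 with rfl | hj
    · simp [gridTime, hK]
    · simp [gridTime, hK, hj, (hn0 j).ne']
  have h1 : ∀ l : Fin 3 → ℤ, kernel Om (Fin.tail x - samplePt τ n l) =
      ∏ j, kfac (Om j) (Fin.tail x j - sampleLength τ n j * (l j / n j)) := by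
    intro l
    rw [kernel_eq_prod_kfac]
    refine Finset.prod_congr rfl fun j _ => ?_
    congr 1
    simp only [Pi.sub_apply, samplePt, sampleLength]
    have := (hn0 j).ne'
    field_simp
  have h2 : √(∏ j, sampleLength τ n j) = √(∏ j, (n j : ℝ)) * √(∏ j, τ j (n j)) := by
    rw [← Real.sqrt_mul hpos.le, ← Finset.prod_mul_distrib]
    rfl
  rw [residualField, Finset.sum_congr rfl fun l _ => by rw [h1 l],
    sum_mul_prod_kfac Om (sampleLength τ n) (Fin.tail x) hn K e, h2, partsIntegral, hb]
  have h3 : ∀ v, arraySum e n ((fun j => (K j : ℝ) / n j) * v) *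
      weightProd Om (fun j => (K j : ℝ) / n j) (sampleLength τ n) (Fin.tail x) v =
      (√(∏ j, (n j : ℝ)))⁻¹ * ((∑ l ∈ Finset.Icc (1 : Fin 3 → ℤ)
        (fun j => ⌊(n j : ℝ) * ((K j : ℝ) / n j * v j)⌋), e l) *
        weightProd Om (fun j => (K j : ℝ) / n j) (sampleLength τ n) (Fin.tail x) v) := by
    intro v
    simp only [arraySum, Pi.mul_apply]
    ring
  simp_rw [h3]
  rw [integral_const_mul]
  have := (Real.sqrt_pos.2 hpos).ne'
  field_simp

theorem measurable_arraySum (e : (Fin 3 → ℤ) → ℝ) (n : Fin 3 → ℕ) : Measurable (arraySum e n) := by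
  unfold arraySum
  refine Measurable.const_mul ?_ _
  have h1 : Measurable fun K : Fin 3 → ℤ => ∑ i ∈ Finset.Icc (1 : Fin 3 → ℤ) K, e i :=
    measurable_of_countable _
  refine h1.comp (measurable_pi_lambda _ fun j => ?_)
  exact Int.measurable_floor.comp ((measurable_pi_apply j).const_mul _)

theorem tendsto_eval_atTop (j : Fin 3) : Tendsto (fun n : Fin 3 → ℕ => n j) atTop atTop :=
  tendsto_atTop.2 fun b => (eventually_ge_atTop fun _ => b).mono fun _ h => h j

theorem eventually_one_le : ∀ᶠ n : Fin 3 → ℕ in atTop, ∀ j, 1 ≤ n j :=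
  (eventually_ge_atTop fun _ => 1).mono fun _ h => h

theorem abs_partsIntegral_sub_le {ι : Type*} [Fintype ι] (Om : ι → ℝ) {α β : (ι → ℝ) → ℝ}
    (hα : Measurable α) (hβ : Continuous β) {b κ t : ι → ℝ} (hb : b ∈ Icc (0 : ι → ℝ) 1) {C δ M : ℝ}
    (hC : ∀ v, (∀ j, |v j| ≤ 1) → |weightProd Om b κ t v| ≤ C) (hM : ∀ z, |β z| ≤ M)
    (h : ∀ z ∈ Icc (0 : ι → ℝ) 1, |α z - β z| ≤ δ) :
    |partsIntegral Om α b κ t - partsIntegral Om β b κ t| ≤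
      δ * C * (partsCube ι).real univ := by
  have hmem : ∀ v : ι → ℝ, (∀ j, v j ∈ Ioc (0 : ℝ) 1) → b * v ∈ Icc (0 : ι → ℝ) 1 := fun v hv =>
    ⟨fun j => mul_nonneg (hb.1 j) (hv j).1.le, fun j =>
      (mul_le_of_le_one_right (hb.1 j) (hv j).2).trans (hb.2 j)⟩
  have hδ : 0 ≤ δ := (abs_nonneg _).trans (h 0 ⟨le_rfl, zero_le_one⟩)
  have hcont : Continuous fun v => b * v := by fun_prop
  have hβi : Integrable (fun v => β (b * v) * weightProd Om b κ t v) (partsCube ι) :=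
    (integrable_weightProd _ _ _ _).bdd_mul (c := M)
      (hβ.comp hcont).measurable.aestronglyMeasurable (Eventually.of_forall fun v => hM _)
  have hαi : Integrable (fun v => α (b * v) * weightProd Om b κ t v) (partsCube ι) := by
    refine (integrable_weightProd _ _ _ _).bdd_mul (c := M + δ)
      (hα.comp hcont.measurable).aestronglyMeasurable ?_
    filter_upwards [ae_partsCube] with v hv
    have h1 := h _ (hmem v hv)
    have h2 := hM (b * v)
    calc |α (b * v)| = |β (b * v) + (α (b * v) - β (b * v))| := by ring_nf
      _ ≤ M + δ := (abs_add_le _ _).trans (add_le_add h2 h1)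
  rw [partsIntegral, partsIntegral, ← integral_sub hαi hβi, ← Real.norm_eq_abs]
  refine norm_integral_le_of_norm_le_const ?_
  filter_upwards [ae_partsCube] with v hv
  rw [← sub_mul, norm_mul]
  exact mul_le_mul (h _ (hmem v hv)) (hC v fun j => abs_le_one_of_mem_Ioc (hv j)) (norm_nonneg _) hδ

theorem gridTime_mem {n : Fin 3 → ℕ} {s : ℝ} (hs : s ∈ Icc (0 : ℝ) 1) :
    gridTime n s ∈ Icc (0 : Fin 3 → ℝ) 1 := by
  have h0 : (0 : ℝ) ≤ n 0 := Nat.cast_nonneg _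
  have h1 : (0 : ℝ) ≤ ⌊(n 0 : ℝ) * s⌋ := by
    exact_mod_cast Int.floor_nonneg.2 (mul_nonneg h0 hs.1)
  have h2 : (⌊(n 0 : ℝ) * s⌋ : ℝ) ≤ n 0 :=
    (Int.floor_le _).trans (mul_le_of_le_one_right h0 hs.2)
  constructor <;> intro j <;> rcases eq_or_ne j 0 with rfl | hj
  · simpa [gridTime] using div_nonneg h1 h0
  · simp [gridTime, hj]
  · simpa [gridTime] using div_le_one_of_le₀ h2 h0
  · simp [gridTime, hj]

theorem dist_gridTime_le {n : Fin 3 → ℕ} (hn : 1 ≤ n 0) (s : ℝ) :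
    dist (gridTime n s) (Function.update 1 0 s) ≤ 1 / n 0 := by
  have hn0 : (0 : ℝ) < n 0 := by exact_mod_cast hn
  rw [dist_pi_le_iff (by positivity)]
  intro j
  rcases eq_or_ne j 0 with rfl | hj
  · simp only [gridTime, Function.update_self]
    have h1 := Int.floor_le ((n 0 : ℝ) * s)
    have h2 := Int.lt_floor_add_one ((n 0 : ℝ) * s)
    have h3 : (⌊(n 0 : ℝ) * s⌋ : ℝ) / n 0 - s = (⌊(n 0 : ℝ) * s⌋ - n 0 * s) / n 0 := by
      field_simp
    rw [Real.dist_eq, h3, abs_div, abs_of_pos hn0]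
    refine div_le_div_of_nonneg_right (abs_le.2 ⟨?_, ?_⟩) hn0.le <;> linarith
  · simp only [gridTime, Function.update_of_ne hj, dist_self]
    positivity

/-- The argument `(s, t, r)` of the detection process: time in `[s₀, 1]`, place in `[0, τbar]`. -/
theorem mem_box {s₀ : ℝ} {τbar : Fin 3 → ℝ} {x : Fin 4 → ℝ}
    (hx : x ∈ Icc (Fin.cons s₀ 0 : Fin 4 → ℝ) (Fin.cons 1 τbar)) :
    x 0 ∈ Icc s₀ 1 ∧ Fin.tail x ∈ Icc 0 τbar :=
  ⟨⟨hx.1 0, hx.2 0⟩, fun j => hx.1 j.succ, fun j => hx.2 j.succ⟩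

/-- If the partial sums of an array are uniformly close to a continuous function `β`, then the
detection process of the array is uniformly close to the integral of the kernel by `β`. -/
theorem eventually_residualField_near (Om : Fin 3 → ℝ) {s₀ : ℝ} (hs₀ : 0 ≤ s₀)
    {τbar : Fin 3 → ℝ} (hτbar : ∀ j, 0 < τbar j) {τ : Fin 3 → ℕ → ℝ}
    (hτ : ∀ j m, 1 ≤ m → 0 < τ j m) (hκ : Tendsto (sampleLength τ) atTop (𝓝 τbar))
    {β : (Fin 3 → ℝ) → ℝ} (hβ : ContinuousOn β (Icc 0 1)) {η : ℝ} (hη : 0 < η) :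
    ∃ δ : ℝ, 0 < δ ∧ ∀ᶠ n : Fin 3 → ℕ in atTop, ∀ e : (Fin 3 → ℤ) → ℝ,
      (∀ v ∈ Icc (0 : Fin 3 → ℝ) 1, |arraySum e n v - β v| ≤ δ) →
      ∀ x ∈ Icc (Fin.cons s₀ 0 : Fin 4 → ℝ) (Fin.cons 1 τbar),
        |residualField Om τ n e x - √(∏ j, τbar j) * partsIntegral Om
          (fun z => β (clampCube z)) (Function.update 1 0 (x 0)) τbar (Fin.tail x)| ≤ η := by
  obtain ⟨M, hM0, hM⟩ := exists_bound_Icc hβ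
  have hβc := continuous_comp_clampCube hβ
  have hβM : ∀ z : Fin 3 → ℝ, |β (clampCube z)| ≤ M := fun z => hM _ (clampCube_mem z)
  -- A compact set of parameters; the margin `τbar + 1` leaves room for the sampled lengths, which
  -- may exceed `τbar`.
  let Q : Set ((Fin 3 → ℝ) × (Fin 3 → ℝ) × (Fin 3 → ℝ)) :=
    Icc 0 1 ×ˢ (Icc 0 (τbar + 1) ×ˢ Icc 0 τbar)
  have hQ : IsCompact Q := isCompact_Icc.prod (isCompact_Icc.prod isCompact_Icc)
  let G : (Fin 3 → ℝ) × (Fin 3 → ℝ) × (Fin 3 → ℝ) → ℝ := fun p =>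
    √(∏ j, p.2.1 j) * partsIntegral Om (fun z => β (clampCube z)) p.1 p.2.1 p.2.2
  have hG : Continuous G := by
    refine Continuous.mul ?_ (continuous_partsIntegral Om hβc hβM)
    exact Real.continuous_sqrt.comp (by fun_prop)
  obtain ⟨δ₁, hδ₁, hu⟩ := Metric.uniformContinuousOn_iff.1
    (hQ.uniformContinuousOn_of_continuous hG.continuousOn) (η / 2) (half_pos hη)
  have hR : ∀ y : Fin 3 → ℝ, y ∈ Icc 0 (τbar + 1) → ∀ j, |y j| ≤ ‖τbar‖ + 1 := by
    intro y hy j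
    have h1 : y j ≤ τbar j + 1 := hy.2 j
    have h2 : 0 ≤ y j := hy.1 j
    have h3 := (le_abs_self _).trans (norm_le_pi_norm τbar j)
    rw [abs_of_nonneg h2]
    linarith
  obtain ⟨C, hC0, hC⟩ := exists_weightProd_bound Om (‖τbar‖ + 1)
  set L : ℝ := √(∏ j, (τbar j + 1)) with hL
  set m : ℝ := (partsCube (Fin 3)).real univ with hm
  have hm0 : 0 ≤ m := measureReal_nonneg
  have hL0 : 0 ≤ L := Real.sqrt_nonneg _
  have hLCm : 0 ≤ L * C * m := by positivity
  -- Here `L` bounds the normalizing root, `C` the weight and `m` is the total mass, so the error of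
  -- replacing the array sums by `β` is at most `η / 2`. The other half is left for the change of
  -- parameters.
  refine ⟨η / 2 / (L * C * m + 1), by positivity, ?_⟩
  have hn0 : ∀ᶠ n : Fin 3 → ℕ in atTop, 1 / (n 0 : ℝ) < δ₁ := by
    have h1 : Tendsto (fun n : Fin 3 → ℕ => 1 / (n 0 : ℝ)) atTop (𝓝 0) :=
      tendsto_one_div_atTop_nhds_zero_nat.comp (tendsto_eval_atTop 0)
    exact h1.eventually (gt_mem_nhds hδ₁)
  filter_upwards [eventually_one_le, hn0,
    hκ.eventually (Metric.ball_mem_nhds τbar (lt_min hδ₁ one_pos))] with n hn hn0 hκn e he x hx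
  obtain ⟨hx0, hxt⟩ := mem_box hx
  have hx0' : x 0 ∈ Icc (0 : ℝ) 1 := ⟨hs₀.trans hx0.1, hx0.2⟩
  rw [residualField_eq_partsIntegral Om τ hn e x]
  set κ := sampleLength τ n with hκdef
  have hκmem : κ ∈ Icc 0 (τbar + 1) := by
    refine ⟨fun j => (mul_pos (by exact_mod_cast hn j) (hτ j _ (hn j))).le, fun j => ?_⟩
    have h1 : dist (κ j) (τbar j) < 1 :=
      (dist_le_pi_dist κ τbar j).trans_lt ((Metric.mem_ball.1 hκn).trans_le (min_le_right _ _))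
    rw [Real.dist_eq, abs_lt] at h1
    simp only [Pi.add_apply, Pi.one_apply]
    linarith [h1.2]
  have htmem : Fin.tail x ∈ Icc 0 (τbar + 1) :=
    ⟨hxt.1, hxt.2.trans (le_add_of_nonneg_right zero_le_one)⟩
  have hbmem := gridTime_mem (n := n) hx0'
  have hupd : (Function.update 1 0 (x 0) : Fin 3 → ℝ) ∈ Icc (0 : Fin 3 → ℝ) 1 := by
    constructor <;> intro j <;> rcases eq_or_ne j 0 with rfl | hj <;> simp [*, hx0'.1, hx0'.2]
  have hupd : ((Function.update 1 0 (x 0) : Fin 3 → ℝ), τbar, Fin.tail x) ∈ Q :=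
    ⟨hupd, ⟨fun j => (hτbar j).le, le_add_of_nonneg_right zero_le_one⟩, hxt⟩
  have h1 : dist (G (gridTime n (x 0), κ, Fin.tail x))
      (G (Function.update 1 0 (x 0), τbar, Fin.tail x)) < η / 2 := by
    refine hu _ ⟨hbmem, hκmem, hxt⟩ _ hupd ?_
    rw [Prod.dist_eq, Prod.dist_eq, dist_self]
    refine max_lt ((dist_gridTime_le (hn 0) _).trans_lt hn0) (max_lt ?_ hδ₁)
    exact (Metric.mem_ball.1 hκn).trans_le (min_le_left _ _)
  have h2 := abs_partsIntegral_sub_le Om (measurable_arraySum e n) hβc hbmem (κ := κ)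
    (t := Fin.tail x) (C := C) (δ := η / 2 / (L * C * m + 1))
    (fun v hv => hC _ _ _ _ (fun j => ?_) (hR κ hκmem) (hR _ htmem) fun j =>
      (hv j).trans (by linarith [norm_nonneg τbar])) hβM (fun z hz => by
        rw [clampCube_of_mem hz]; exact he z hz)
  swap
  · have h3 : 0 ≤ gridTime n (x 0) j := hbmem.1 j
    have h4 : gridTime n (x 0) j ≤ 1 := hbmem.2 j
    rw [abs_of_nonneg h3]
    linarith [norm_nonneg τbar]
  have hsq : √(∏ j, κ j) ≤ L := Real.sqrt_le_sqrt
    (Finset.prod_le_prod (fun j _ => hκmem.1 j) fun j _ => hκmem.2 j)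
  have h5 : |√(∏ j, κ j) * partsIntegral Om (arraySum e n) (gridTime n (x 0)) κ (Fin.tail x) -
      G (gridTime n (x 0), κ, Fin.tail x)| ≤ η / 2 := by
    simp only [G]
    rw [← mul_sub, abs_mul, abs_of_nonneg (Real.sqrt_nonneg _)]
    refine (mul_le_mul hsq h2 (abs_nonneg _) hL0).trans ?_
    rw [show L * (η / 2 / (L * C * m + 1) * C * m) = η / 2 * (L * C * m) / (L * C * m + 1) by ring,
      div_le_iff₀ (by positivity)]
    nlinarith
  calc _ ≤ _ := abs_sub_le _ (G (gridTime n (x 0), κ, Fin.tail x)) _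
    _ ≤ η / 2 + η / 2 := add_le_add h5 h1.le
    _ = η := add_halves η

end Noise

/-! ### Riemann sums of the disturbance and their uniform convergence -/

section Drift

/-- The index of the cell of the sampling grid that contains `z`. -/
noncomputable def cellIndex (τbar : Fin 3 → ℝ) (n : Fin 3 → ℕ) (z : Fin 3 → ℝ) : Fin 3 → ℤ :=
  fun j => ⌈(n j : ℝ) * z j / τbar j⌉

/-- A path of the disturbance whose samples are bounded and converge almost everywhere. -/
structure IsSampleable (τ : Fin 3 → ℕ → ℝ) (τbar : Fin 3 → ℝ) (d : (Fin 3 → ℝ) → ℝ) : Prop where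
  bounded : ∃ M : ℝ, ∀ᶠ n : Fin 3 → ℕ in atTop, ∀ l ∈ indexBox n, |d (samplePt τ n l)| ≤ M
  tendsto : ∀ᵐ z ∂volume.restrict (univ.pi fun j => Ioc 0 (τbar j)),
    Tendsto (fun n => d (samplePt τ n (cellIndex τbar n z))) atTop (𝓝 (d z))

variable {τ : Fin 3 → ℕ → ℝ} {τbar : Fin 3 → ℝ}

theorem cellIndex_mem_indexBox (hτbar : ∀ j, 0 < τbar j) {n : Fin 3 → ℕ} (hn : ∀ j, 1 ≤ n j)
    {z : Fin 3 → ℝ} (hz : ∀ j, z j ∈ Ioc 0 (τbar j)) : cellIndex τbar n z ∈ indexBox n := by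
  have hn0 : ∀ j, (0 : ℝ) < n j := fun j => by exact_mod_cast hn j
  rw [indexBox, Finset.mem_Icc]
  constructor <;> intro j
  · exact Int.one_le_ceil_iff.2 (div_pos (mul_pos (hn0 j) (hz j).1) (hτbar j))
  · refine Int.ceil_le.2 ?_
    rw [div_le_iff₀ (hτbar j)]
    exact mul_le_mul_of_nonneg_left (hz j).2 (hn0 j).le

theorem measurable_cellIndex (τbar : Fin 3 → ℝ) (n : Fin 3 → ℕ) :
    Measurable (cellIndex τbar n) :=
  measurable_pi_lambda _ fun j =>
    Int.measurable_ceil.comp (((measurable_pi_apply j).const_mul _).div_const _)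

/-- The cells have sides `τbar j / n j`, not `τ j (n j)`, so they tile the box exactly for every `n`
and the sum is the integral of a step function over a fixed domain. -/
theorem setIntegral_cellIndex (hτbar : ∀ j, 0 < τbar j) {n : Fin 3 → ℕ} (hn : ∀ j, 1 ≤ n j)
    (F : (Fin 3 → ℤ) → ℝ) :
    ∫ z in univ.pi fun j => Ioc 0 (τbar j), F (cellIndex τbar n z) =
      (∏ j, τbar j / n j) * ∑ l ∈ indexBox n, F l := by
  have hn0 : ∀ j, (0 : ℝ) < n j := fun j => by exact_mod_cast hn j
  let cell : (Fin 3 → ℤ) → Set (Fin 3 → ℝ) := fun l =>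
    univ.pi fun j => Ioc (((l j : ℝ) - 1) * (τbar j / n j)) (l j * (τbar j / n j))
  have hcell : ∀ l z, z ∈ cell l ↔ cellIndex τbar n z = l := by
    intro l z
    simp only [cell, mem_univ_pi, funext_iff]
    refine forall_congr' fun j => ?_
    have e : (n j : ℝ) * z j / τbar j = z j / (τbar j / n j) := by
      have := (hn0 j).ne'; have := (hτbar j).ne'
      field_simp
    have hp : 0 < τbar j / n j := div_pos (hτbar j) (hn0 j)
    rw [cellIndex, Int.ceil_eq_iff, e, mem_Ioc, lt_div_iff₀ hp, div_le_iff₀ hp]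
  have hvol : ∀ l, volume.real (cell l) = ∏ j, τbar j / n j := by
    intro l
    rw [measureReal_def, Real.volume_pi_Ioc, ENNReal.toReal_prod]
    refine Finset.prod_congr rfl fun j _ => ?_
    have hp : 0 < τbar j / n j := div_pos (hτbar j) (hn0 j)
    rw [show (l j : ℝ) * (τbar j / n j) - (l j - 1) * (τbar j / n j) = τbar j / n j by ring,
      ENNReal.toReal_ofReal hp.le]
  have hsub : ∀ l ∈ indexBox n, cell l ⊆ univ.pi fun j => Ioc 0 (τbar j) := by
    intro l hl z hz j _
    rw [indexBox, Finset.mem_Icc] at hl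
    have h1 : (1 : ℝ) ≤ l j := by exact_mod_cast hl.1 j
    have h2 : (l j : ℝ) ≤ n j := by exact_mod_cast hl.2 j
    have hz' := mem_univ_pi.1 hz j
    have hp : 0 < τbar j / n j := div_pos (hτbar j) (hn0 j)
    refine ⟨lt_of_le_of_lt (mul_nonneg (by linarith) hp.le) hz'.1, hz'.2.trans ?_⟩
    calc (l j : ℝ) * (τbar j / n j) ≤ n j * (τbar j / n j) :=
          mul_le_mul_of_nonneg_right h2 hp.le
      _ = τbar j := mul_div_cancel₀ _ (hn0 j).ne'
  have hmeas : ∀ l, MeasurableSet (cell l) := fun l =>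
    MeasurableSet.univ_pi fun j => measurableSet_Ioc
  have hfin : ∀ l, volume (cell l) ≠ ⊤ := fun l => by
    rw [Real.volume_pi_Ioc]
    exact ENNReal.prod_ne_top fun j _ => ENNReal.ofReal_ne_top
  have h1 : EqOn (fun z => F (cellIndex τbar n z))
      (fun z => ∑ l ∈ indexBox n, (cell l).indicator (fun _ => F l) z)
      (univ.pi fun j => Ioc 0 (τbar j)) := by
    intro z hz
    have hmem := cellIndex_mem_indexBox hτbar hn fun j => mem_univ_pi.1 hz j
    simp only
    rw [Finset.sum_eq_single_of_mem _ hmem]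
    · rw [indicator_of_mem ((hcell _ _).2 rfl)]
    · intro l _ hne
      rw [indicator_of_notMem fun h => hne ((hcell _ _).1 h).symm]
  rw [setIntegral_congr_fun (MeasurableSet.univ_pi fun j => measurableSet_Ioc) h1,
    integral_finsetSum, Finset.mul_sum]
  · refine Finset.sum_congr rfl fun l hl => ?_
    rw [setIntegral_indicator (hmeas l), inter_eq_right.2 (hsub l hl), setIntegral_const, hvol,
      smul_eq_mul]
  · intro l _
    exact ((integrable_indicator_iff (hmeas l)).2
      (integrableOn_const (hfin l))).integrableOn

theorem tendsto_samplePt_cellIndex (hτbar : ∀ j, 0 < τbar j)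
    (hκ : Tendsto (sampleLength τ) atTop (𝓝 τbar)) (z : Fin 3 → ℝ) :
    Tendsto (fun n => samplePt τ n (cellIndex τbar n z)) atTop (𝓝 z) := by
  rw [tendsto_pi_nhds]
  intro j
  have h1 : Tendsto (fun n : Fin 3 → ℕ => (⌈(n j : ℝ) * z j / τbar j⌉ : ℝ) / n j) atTop
      (𝓝 (z j / τbar j)) := by
    have h2 : Tendsto (fun m : ℕ => z j / τbar j + 1 / (m : ℝ)) atTop (𝓝 (z j / τbar j)) := by
      simpa using (tendsto_one_div_atTop_nhds_zero_nat (𝕜 := ℝ)).const_add (z j / τbar j)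
    have h3 : Tendsto (fun m : ℕ => (⌈(m : ℝ) * z j / τbar j⌉ : ℝ) / m) atTop
        (𝓝 (z j / τbar j)) := by
      refine tendsto_of_tendsto_of_tendsto_of_le_of_le' tendsto_const_nhds h2 ?_ ?_
      · filter_upwards [eventually_ge_atTop 1] with m hm
        have hm0 : (0 : ℝ) < m := by exact_mod_cast hm
        rw [le_div_iff₀ hm0, show z j / τbar j * m = m * z j / τbar j by ring]
        exact Int.le_ceil _
      · filter_upwards [eventually_ge_atTop 1] with m hm
        have hm0 : (0 : ℝ) < m := by exact_mod_cast hm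
        rw [div_le_iff₀ hm0, add_mul, one_div_mul_cancel hm0.ne',
          show z j / τbar j * m = m * z j / τbar j by ring]
        exact (Int.ceil_lt_add_one _).le
    exact h3.comp (tendsto_eval_atTop j)
  have h2 := h1.mul (tendsto_pi_nhds.1 hκ j)
  rw [div_mul_cancel₀ _ (hτbar j).ne'] at h2
  refine h2.congr' ?_
  filter_upwards [eventually_one_le] with n hn
  have hn0 : (n j : ℝ) ≠ 0 := by exact_mod_cast (Nat.one_le_iff_ne_zero.1 (hn j))
  simp only [sampleLength, samplePt, cellIndex]
  field_simp

/-- The path itself is not assumed measurable; it is an almost everywhere limit of step functions of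
its samples. -/
theorem IsSampleable.aemeasurable {d : (Fin 3 → ℝ) → ℝ} (hd : IsSampleable τ τbar d) :
    AEMeasurable d (volume.restrict (univ.pi fun j => Ioc 0 (τbar j))) := by
  refine aemeasurable_of_tendsto_metrizable_ae atTop (fun n => ?_) hd.tendsto
  exact ((measurable_of_countable fun l => d (samplePt τ n l)).comp
    (measurable_cellIndex τbar n)).aemeasurable

theorem IsSampleable.exists_bound {d : (Fin 3 → ℝ) → ℝ} (hd : IsSampleable τ τbar d)
    (hτbar : ∀ j, 0 < τbar j) :
    ∃ M : ℝ, 0 ≤ M ∧ (∀ᶠ n : Fin 3 → ℕ in atTop, ∀ l ∈ indexBox n, |d (samplePt τ n l)| ≤ M) ∧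
      ∀ᵐ z ∂volume.restrict (univ.pi fun j => Ioc 0 (τbar j)), |d z| ≤ M := by
  obtain ⟨M, hM⟩ := hd.bounded
  have hM' : ∀ᶠ n : Fin 3 → ℕ in atTop, ∀ l ∈ indexBox n, |d (samplePt τ n l)| ≤ max M 0 :=
    hM.mono fun n h l hl => (h l hl).trans (le_max_left _ _)
  refine ⟨max M 0, le_max_right _ _, hM', ?_⟩
  filter_upwards [hd.tendsto, ae_restrict_mem (MeasurableSet.univ_pi fun j => measurableSet_Ioc)]
    with z hz hmem
  refine le_of_tendsto hz.abs ?_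
  filter_upwards [hM', eventually_one_le] with n h hn
  exact h _ (cellIndex_mem_indexBox hτbar hn fun j => mem_univ_pi.1 hmem j)

theorem Icc_update_eq {s : ℝ} (hτbar : ∀ j, 0 < τbar j) (hs : s ≤ 1) :
    Icc (0 : Fin 3 → ℝ) (Function.update τbar 0 (s * τbar 0)) =
      Icc 0 τbar ∩ {z | z 0 ≤ s * τbar 0} := by
  have h1 : s * τbar 0 ≤ τbar 0 := mul_le_of_le_one_left (hτbar 0).le hs
  ext z
  simp only [mem_inter_iff, mem_Icc, mem_ofPred_eq, le_update_iff]
  constructor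
  · rintro ⟨h0, h2, h3⟩
    refine ⟨⟨h0, fun j => ?_⟩, h2⟩
    rcases eq_or_ne j 0 with rfl | hj
    · exact h2.trans h1
    · exact h3 j hj
  · rintro ⟨⟨h0, h2⟩, h3⟩
    exact ⟨h0, h3, fun j _ => h2 j⟩

/-- The dependence of the domain on the time `s` is moved into an indicator on a fixed box, where
dominated convergence applies. -/
theorem restrict_Icc_update {s : ℝ} (hτbar : ∀ j, 0 < τbar j) (hs : s ≤ 1) :
    volume.restrict (Icc (0 : Fin 3 → ℝ) (Function.update τbar 0 (s * τbar 0))) =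
      (volume.restrict (univ.pi fun j => Ioc 0 (τbar j))).restrict {z | z 0 ≤ s * τbar 0} := by
  have hm : MeasurableSet {z : Fin 3 → ℝ | z 0 ≤ s * τbar 0} :=
    measurableSet_le (measurable_pi_apply 0) measurable_const
  have h2 : (univ.pi fun j => Ioc ((0 : Fin 3 → ℝ) j) (τbar j) : Set (Fin 3 → ℝ)) =ᵐ[volume]
      Icc 0 τbar := Measure.univ_pi_Ioc_ae_eq_Icc
  rw [Icc_update_eq hτbar hs, inter_comm, ← Measure.restrict_restrict hm,
    ← Measure.restrict_congr_set h2]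
  rfl

theorem isFiniteMeasure_box (τbar : Fin 3 → ℝ) :
    IsFiniteMeasure (volume.restrict (univ.pi fun j => Ioc 0 (τbar j))) := by
  refine ⟨?_⟩
  rw [Measure.restrict_apply_univ, Real.volume_pi_Ioc]
  exact ENNReal.prod_lt_top fun j _ => ENNReal.ofReal_lt_top

theorem IsSampleable.integrableOn (hτbar : ∀ j, 0 < τbar j) {d : (Fin 3 → ℝ) → ℝ}
    (hd : IsSampleable τ τbar d) (Om t : Fin 3 → ℝ) :
    IntegrableOn (fun z => kernel Om (t - z) * d z) (univ.pi fun j => Ioc 0 (τbar j)) := by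
  obtain ⟨M, hM0, -, hM⟩ := hd.exists_bound hτbar
  have hfin := isFiniteMeasure_box τbar
  have hk : Continuous fun z => kernel Om (t - z) :=
    (continuous_kernel Om).comp (by fun_prop)
  refine Integrable.of_bound (hk.measurable.aemeasurable.mul hd.aemeasurable).aestronglyMeasurable
    ((∏ j, (|Om j| / Real.pi)) * M) ?_
  filter_upwards [hM] with z hz
  rw [norm_mul]
  exact mul_le_mul (abs_kernel_le _ _) hz (norm_nonneg _)
    (Finset.prod_nonneg fun j _ => by positivity)

theorem drift_eq (hτbar : ∀ j, 0 < τbar j) (Om : Fin 3 → ℝ) (d : (Fin 3 → ℝ) → ℝ) {x : Fin 4 → ℝ}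
    (hx : x 0 ≤ 1) :
    drift Om τbar d x = (√(∏ j, τbar j))⁻¹ * ∫ z in univ.pi fun j => Ioc 0 (τbar j),
      if z 0 ≤ x 0 * τbar 0 then kernel Om (Fin.tail x - z) * d z else 0 := by
  have hm : MeasurableSet {z : Fin 3 → ℝ | z 0 ≤ x 0 * τbar 0} :=
    measurableSet_le (measurable_pi_apply 0) measurable_const
  rw [drift, restrict_Icc_update hτbar hx, ← integral_indicator hm]
  rfl

theorem Icc_update_floor_eq_filter (n : Fin 3 → ℕ) {s : ℝ} (hs : s ≤ 1) :
    Finset.Icc (1 : Fin 3 → ℤ) (Function.update (fun j => (n j : ℤ)) 0 ⌊(n 0 : ℝ) * s⌋) =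
      (indexBox n).filter fun l => (l 0 : ℝ) ≤ n 0 * s := by
  have h2 : ⌊(n 0 : ℝ) * s⌋ ≤ n 0 := by
    rw [← Int.cast_le (R := ℝ)]
    refine (Int.floor_le _).trans ?_
    simpa using mul_le_of_le_one_right (Nat.cast_nonneg _) hs
  ext l
  simp only [indexBox, Finset.mem_filter, Finset.mem_Icc, le_update_iff, Int.le_floor]
  constructor
  · rintro ⟨h0, h3, h4⟩
    refine ⟨⟨h0, fun j => ?_⟩, h3⟩
    rcases eq_or_ne j 0 with rfl | hj
    · exact (Int.le_floor.2 h3).trans h2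
    · exact h4 j hj
  · rintro ⟨⟨h0, h3⟩, h4⟩
    exact ⟨h0, h4, fun j _ => h3 j⟩

theorem residualField_eq_setIntegral (hτbar : ∀ j, 0 < τbar j) (Om : Fin 3 → ℝ) {n : Fin 3 → ℕ}
    (hn : ∀ j, 1 ≤ n j) (d : (Fin 3 → ℝ) → ℝ) {x : Fin 4 → ℝ} (hx : x 0 ≤ 1) :
    residualField Om τ n (fun l => d (samplePt τ n l) / √(∏ j, (n j : ℝ))) x =
      √(∏ j, sampleLength τ n j) * (∏ j, τbar j)⁻¹ * ∫ z in univ.pi fun j => Ioc 0 (τbar j),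
        if (cellIndex τbar n z 0 : ℝ) ≤ n 0 * x 0 then
          kernel Om (Fin.tail x - samplePt τ n (cellIndex τbar n z)) *
            d (samplePt τ n (cellIndex τbar n z)) else 0 := by
  have hn0 : ∀ j, (0 : ℝ) < n j := fun j => by exact_mod_cast hn j
  have hpos : 0 < ∏ j, (n j : ℝ) := Finset.prod_pos fun j _ => hn0 j
  have hτpos : 0 < ∏ j, τbar j := Finset.prod_pos fun j _ => hτbar j
  rw [setIntegral_cellIndex hτbar hn fun l => if (l 0 : ℝ) ≤ n 0 * x 0 then
    kernel Om (Fin.tail x - samplePt τ n l) * d (samplePt τ n l) else 0, residualField,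
    ← Finset.sum_filter]
  have h3 : √(∏ j, sampleLength τ n j) = √(∏ j, (n j : ℝ)) * √(∏ j, τ j (n j)) := by
    rw [← Real.sqrt_mul hpos.le, ← Finset.prod_mul_distrib]
    rfl
  rw [Icc_update_floor_eq_filter n hx, h3, Finset.prod_div_distrib, Finset.mul_sum, Finset.mul_sum, Finset.mul_sum]
  refine Finset.sum_congr rfl fun l _ => ?_
  have h4 : √(∏ j, (n j : ℝ)) * √(∏ j, (n j : ℝ)) = ∏ j, (n j : ℝ) := Real.mul_self_sqrt hpos.le
  have h5 := (Real.sqrt_pos.2 hpos).ne'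
  generalize √(∏ j, (n j : ℝ)) = r at h4 h5 ⊢
  rw [← h4]
  field_simp

/-- Off the hyperplane `z 0 = s * τbar 0` the rounded indicator eventually agrees with its limit,
even though the time moves too. -/
theorem tendsto_cellIndex_indicator (hτbar : ∀ j, 0 < τbar j) {s : ℝ} {z : Fin 3 → ℝ}
    (hne : z 0 ≠ s * τbar 0) {ρ : Type*} {l : Filter ρ} {N : ρ → Fin 3 → ℕ} {S : ρ → ℝ}
    (hN : Tendsto N l atTop) (hS : Tendsto S l (𝓝 s)) :
    ∀ᶠ r in l, ((cellIndex τbar (N r) z 0 : ℝ) ≤ N r 0 * S r ↔ z 0 ≤ s * τbar 0) := by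
  have hN0 : Tendsto (fun r => (N r 0 : ℝ)) l atTop :=
    tendsto_natCast_atTop_atTop.comp ((tendsto_eval_atTop 0).comp hN)
  have hz : z 0 / τbar 0 * τbar 0 = z 0 := div_mul_cancel₀ _ (hτbar 0).ne'
  have hrw : ∀ r, (N r 0 : ℝ) * z 0 / τbar 0 = N r 0 * (z 0 / τbar 0) := fun r => by ring
  rcases lt_or_gt_of_ne hne with h | h
  · have h1 : z 0 / τbar 0 < s := by rwa [div_lt_iff₀ (hτbar 0)]
    have h2 : Tendsto (fun r => S r - z 0 / τbar 0) l (𝓝 (s - z 0 / τbar 0)) := hS.sub_const _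
    have h3 := hN0.atTop_mul_pos (sub_pos.2 h1) h2
    -- A margin of `1` absorbs the rounding up in the cell index.
    filter_upwards [h3.eventually_ge_atTop 1] with r hr
    refine iff_of_true ?_ h.le
    have := (Int.ceil_lt_add_one ((N r 0 : ℝ) * z 0 / τbar 0)).le
    rw [hrw] at this
    simp only [cellIndex, hrw]
    nlinarith
  · have h1 : s < z 0 / τbar 0 := by rwa [lt_div_iff₀ (hτbar 0)]
    filter_upwards [hS.eventually (gt_mem_nhds h1), hN0.eventually_gt_atTop 0] with r hr hr0
    refine iff_of_false (not_le.2 ?_) (not_le.2 h)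
    have := Int.le_ceil ((N r 0 : ℝ) * z 0 / τbar 0)
    refine lt_of_lt_of_le ?_ this
    rw [hrw]
    exact mul_lt_mul_of_pos_left hr hr0

theorem ae_ne_hyperplane (c : ℝ) : ∀ᵐ z : Fin 3 → ℝ, z 0 ≠ c :=
  (Measure.quasiMeasurePreserving_eval (fun _ : Fin 3 => (volume : Measure ℝ)) 0).ae
    (Measure.ae_ne volume c)

/-- The sample size and the argument move at the same time. This joint convergence contains both the
continuity of the drift and the local uniformity of the convergence. -/
theorem IsSampleable.tendsto_residualField (hτbar : ∀ j, 0 < τbar j)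
    (hκ : Tendsto (sampleLength τ) atTop (𝓝 τbar)) {d : (Fin 3 → ℝ) → ℝ}
    (hd : IsSampleable τ τbar d) (Om : Fin 3 → ℝ) {K : Set (Fin 4 → ℝ)} (hK : ∀ x ∈ K, x 0 ≤ 1)
    {x : Fin 4 → ℝ} (hx : x ∈ K) :
    Tendsto (fun p : (Fin 3 → ℕ) × (Fin 4 → ℝ) => residualField Om τ p.1
      (fun l => d (samplePt τ p.1 l) / √(∏ j, (p.1 j : ℝ))) p.2) (atTop ×ˢ 𝓝[K] x)
      (𝓝 (drift Om τbar d x)) := by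
  obtain ⟨M, hM0, hMn, hM⟩ := hd.exists_bound hτbar
  have hτpos : 0 < ∏ j, τbar j := Finset.prod_pos fun j _ => hτbar j
  have hfin := isFiniteMeasure_box τbar
  have hfst : Tendsto (fun p : (Fin 3 → ℕ) × (Fin 4 → ℝ) => p.1) (atTop ×ˢ 𝓝[K] x) atTop :=
    tendsto_fst
  have hsnd : Tendsto (fun p : (Fin 3 → ℕ) × (Fin 4 → ℝ) => p.2) (atTop ×ˢ 𝓝[K] x) (𝓝 x) :=
    tendsto_snd.mono_right nhdsWithin_le_nhds
  have hmemK : ∀ᶠ p : (Fin 3 → ℕ) × (Fin 4 → ℝ) in atTop ×ˢ 𝓝[K] x, p.2 ∈ K :=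
    tendsto_snd.eventually self_mem_nhdsWithin
  have hlim : Tendsto (fun p : (Fin 3 → ℕ) × (Fin 4 → ℝ) =>
      ∫ z in univ.pi fun j => Ioc 0 (τbar j),
        if (cellIndex τbar p.1 z 0 : ℝ) ≤ p.1 0 * p.2 0 then
          kernel Om (Fin.tail p.2 - samplePt τ p.1 (cellIndex τbar p.1 z)) *
            d (samplePt τ p.1 (cellIndex τbar p.1 z)) else 0) (atTop ×ˢ 𝓝[K] x)
      (𝓝 (∫ z in univ.pi fun j => Ioc 0 (τbar j),
        if z 0 ≤ x 0 * τbar 0 then kernel Om (Fin.tail x - z) * d z else 0)) := by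
    refine tendsto_integral_filter_of_dominated_convergence
      (fun _ => (∏ j, (|Om j| / Real.pi)) * M) ?_ ?_ (integrable_const _) ?_
    · refine Eventually.of_forall fun p => ?_
      exact ((measurable_of_countable fun l : Fin 3 → ℤ => if (l 0 : ℝ) ≤ p.1 0 * p.2 0 then
        kernel Om (Fin.tail p.2 - samplePt τ p.1 l) * d (samplePt τ p.1 l) else 0).comp
        (measurable_cellIndex τbar p.1)).aestronglyMeasurable
    · filter_upwards [hfst.eventually hMn, hfst.eventually eventually_one_le] with p hp hp1
      filter_upwards [ae_restrict_mem (MeasurableSet.univ_pi fun j => measurableSet_Ioc)] with z hz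
      have hC : 0 ≤ ∏ j, (|Om j| / Real.pi) := Finset.prod_nonneg fun j _ => by positivity
      split_ifs
      · rw [norm_mul]
        exact mul_le_mul (abs_kernel_le _ _)
          (hp _ (cellIndex_mem_indexBox hτbar hp1 fun j => mem_univ_pi.1 hz j)) (norm_nonneg _) hC
      · simpa using mul_nonneg hC hM0
    · filter_upwards [hd.tendsto, ae_restrict_of_ae (ae_ne_hyperplane (x 0 * τbar 0))]
        with z hz hne
      have h1 := tendsto_cellIndex_indicator hτbar (S := fun p => p.2 0) hne hfst (((continuous_apply 0).tendsto x).comp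
        hsnd)
      have h2 : Tendsto (fun p : (Fin 3 → ℕ) × (Fin 4 → ℝ) =>
          kernel Om (Fin.tail p.2 - samplePt τ p.1 (cellIndex τbar p.1 z)) *
            d (samplePt τ p.1 (cellIndex τbar p.1 z))) (atTop ×ˢ 𝓝[K] x)
          (𝓝 (kernel Om (Fin.tail x - z) * d z)) := by
        have htail : Continuous fun x : Fin 4 → ℝ => Fin.tail x :=
          continuous_pi fun j => continuous_apply j.succ
        refine Tendsto.mul ?_ (hz.comp hfst)
        refine ((continuous_kernel Om).tendsto _).comp (Tendsto.sub ?_ ?_)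
        · exact (htail.tendsto x).comp hsnd
        · exact (tendsto_samplePt_cellIndex hτbar hκ z).comp hfst
      by_cases hle : z 0 ≤ x 0 * τbar 0
      · rw [if_pos hle]
        refine h2.congr' ?_
        filter_upwards [h1] with p hp
        rw [if_pos (hp.2 hle)]
      · rw [if_neg hle]
        refine tendsto_const_nhds.congr' ?_
        filter_upwards [h1] with p hp
        rw [if_neg fun h => hle (hp.1 h)]
  have hcoef : Tendsto (fun p : (Fin 3 → ℕ) × (Fin 4 → ℝ) =>
      √(∏ j, sampleLength τ p.1 j) * (∏ j, τbar j)⁻¹) (atTop ×ˢ 𝓝[K] x)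
      (𝓝 (√(∏ j, τbar j))⁻¹) := by
    have h1 : Tendsto (fun p : (Fin 3 → ℕ) × (Fin 4 → ℝ) => √(∏ j, sampleLength τ p.1 j))
        (atTop ×ˢ 𝓝[K] x) (𝓝 (√(∏ j, τbar j))) := by
      refine (Real.continuous_sqrt.tendsto _).comp (tendsto_finsetProd _ fun j _ => ?_)
      exact (tendsto_pi_nhds.1 hκ j).comp hfst
    have h2 := h1.mul_const (∏ j, τbar j)⁻¹
    have h3 : √(∏ j, τbar j) * (∏ j, τbar j)⁻¹ = (√(∏ j, τbar j))⁻¹ := by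
      have h4 : √(∏ j, τbar j) * √(∏ j, τbar j) = ∏ j, τbar j := Real.mul_self_sqrt hτpos.le
      have h5 := (Real.sqrt_pos.2 hτpos).ne'
      nth_rewrite 2 [← h4]
      field_simp
    rwa [h3] at h2
  rw [drift_eq hτbar Om d (hK x hx)]
  refine (hcoef.mul hlim).congr' ?_
  filter_upwards [hmemK, hfst.eventually eventually_one_le] with p hp hp1
  rw [residualField_eq_setIntegral hτbar Om hp1 d (hK _ hp)]

theorem IsSampleable.continuousOn_drift (hτbar : ∀ j, 0 < τbar j)
    (hκ : Tendsto (sampleLength τ) atTop (𝓝 τbar)) {d : (Fin 3 → ℝ) → ℝ}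
    (hd : IsSampleable τ τbar d) (Om : Fin 3 → ℝ) {K : Set (Fin 4 → ℝ)} (hK : ∀ x ∈ K, x 0 ≤ 1) :
    ContinuousOn (drift Om τbar d) K := by
  intro x hx
  refine (Metric.nhds_basis_closedBall.tendsto_right_iff).2 fun r hr => ?_
  have h := (hd.tendsto_residualField hτbar hκ Om hK hx).eventually
    (Metric.closedBall_mem_nhds _ hr)
  obtain ⟨p, hp, q, hq, hpq⟩ := eventually_prod_iff.1 h
  -- For `y` near the point the fields are within `r` of the drift at the point, for all large `n`
  -- at once; letting `n` grow with `y` fixed preserves the bound.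
  filter_upwards [hq, self_mem_nhdsWithin] with y hy hyK
  have h2 : Tendsto (fun n : Fin 3 → ℕ => residualField Om τ n
      (fun l => d (samplePt τ n l) / √(∏ j, (n j : ℝ))) y) atTop (𝓝 (drift Om τbar d y)) := by
    refine (hd.tendsto_residualField hτbar hκ Om hK hyK).comp
      (tendsto_id.prodMk (tendsto_const_pure.mono_right ?_))
    exact pure_le_nhdsWithin hyK
  exact Metric.isClosed_closedBall.mem_of_tendsto h2 (hp.mono fun n hn => hpq hn hy)

theorem IsSampleable.eventually_residualField_near (hτbar : ∀ j, 0 < τbar j)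
    (hκ : Tendsto (sampleLength τ) atTop (𝓝 τbar)) {d : (Fin 3 → ℝ) → ℝ}
    (hd : IsSampleable τ τbar d) (Om : Fin 3 → ℝ) {K : Set (Fin 4 → ℝ)} (hK : ∀ x ∈ K, x 0 ≤ 1)
    (hc : IsCompact K) {η : ℝ} (hη : 0 < η) :
    ∀ᶠ n : Fin 3 → ℕ in atTop, ∀ x ∈ K, |residualField Om τ n
      (fun l => d (samplePt τ n l) / √(∏ j, (n j : ℝ))) x - drift Om τbar d x| ≤ η := by
  have hloc : TendstoLocallyUniformlyOn (fun (n : Fin 3 → ℕ) x => residualField Om τ n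
      (fun l => d (samplePt τ n l) / √(∏ j, (n j : ℝ))) x) (drift Om τbar d) atTop K := by
    rw [tendstoLocallyUniformlyOn_iff_forall_tendsto]
    intro x hx
    have h1 := hd.tendsto_residualField hτbar hκ Om hK hx
    have h2 : Tendsto (fun p : (Fin 3 → ℕ) × (Fin 4 → ℝ) => drift Om τbar d p.2)
        (atTop ×ˢ 𝓝[K] x) (𝓝 (drift Om τbar d x)) :=
      (hd.continuousOn_drift hτbar hκ Om hK x hx).tendsto.comp tendsto_snd
    exact (h2.prodMk_nhds h1).mono_right (nhds_le_uniformity _)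
  have hunif := (tendstoLocallyUniformlyOn_iff_tendstoUniformlyOn_of_compact hc).1 hloc
  filter_upwards [Metric.tendstoUniformlyOn_iff.1 hunif η hη] with n hn x hx
  rw [abs_sub_comm]
  exact (hn x hx).le

end Drift

/-! ### Both cases of the assumption give sampleable paths -/

section Sampleable

variable {τ : Fin 3 → ℕ → ℝ} {τbar : Fin 3 → ℝ}

theorem tendsto_sampleLength
    (h : ∀ j, Tendsto (fun m : ℕ => (m : ℝ) * τ j m) atTop (𝓝 (τbar j))) :
    Tendsto (sampleLength τ) atTop (𝓝 τbar) :=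
  tendsto_pi_nhds.2 fun j => (h j).comp (tendsto_eval_atTop j)

/-- In case (a) sampling points may leave `[0, τbar]` and `D` need not be compact, so a bound is
needed at points of `D` close to the box. -/
theorem exists_bound_near_of_continuousOn {D K : Set (Fin 3 → ℝ)} {d : (Fin 3 → ℝ) → ℝ}
    (hd : ContinuousOn d D) (hK : IsCompact K) (hKD : K ⊆ D) :
    ∃ M δ : ℝ, 0 < δ ∧ ∀ p ∈ D, ∀ q ∈ K, dist q p < δ → |d p| ≤ M := by
  obtain ⟨M, hM⟩ := hK.exists_bound_of_continuousOn (hd.mono hKD)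
  have hK' : IsCompact ((↑) ⁻¹' K : Set D) := by
    rw [Subtype.isCompact_iff, Subtype.image_preimage_coe, inter_eq_right.2 hKD]
    exact hK
  have hu := hK'.uniformContinuousAt_of_continuousAt (fun p : D => d p)
    (fun p _ => (continuousOn_iff_continuous_domRestrict.1 hd).continuousAt)
    (Metric.dist_mem_uniformity one_pos)
  obtain ⟨δ, hδ, h⟩ := Metric.mem_uniformity_dist.1 hu
  refine ⟨M + 1, δ, hδ, fun p hp q hq hpq => ?_⟩
  have h1 : dist (d q) (d p) < 1 := h (a := ⟨q, hKD hq⟩) (b := ⟨p, hp⟩) hpq hq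
  have h2 := hM q hq
  rw [Real.dist_eq, abs_lt] at h1
  rw [Real.norm_eq_abs, abs_le] at h2
  exact abs_le.2 ⟨by linarith [h1.2], by linarith [h1.1]⟩

theorem isSampleable_of_continuousOn (hτbar : ∀ j, 0 < τbar j)
    (hκ : Tendsto (sampleLength τ) atTop (𝓝 τbar)) {D : Set (Fin 3 → ℝ)} (hD : Icc 0 τbar ⊆ D)
    (hsample : ∀ n : Fin 3 → ℕ, ∀ i ∈ indexBox n, samplePt τ n i ∈ D) {d : (Fin 3 → ℝ) → ℝ}
    (hd : ContinuousOn d D) : IsSampleable τ τbar d := by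
  constructor
  · obtain ⟨M, δ, hδ, hM⟩ := exists_bound_near_of_continuousOn hd isCompact_Icc hD
    refine ⟨M, ?_⟩
    filter_upwards [hκ.eventually (Metric.ball_mem_nhds τbar hδ), eventually_one_le]
      with n hn hn1 l hl
    have hn0 : ∀ j, (0 : ℝ) < n j := fun j => by exact_mod_cast hn1 j
    have hl' := hl
    rw [indexBox, Finset.mem_Icc] at hl'
    have h0 : ∀ j, (0 : ℝ) ≤ (l j : ℝ) / n j := fun j => by
      have : (1 : ℝ) ≤ l j := by exact_mod_cast hl'.1 j
      exact div_nonneg (by linarith) (hn0 j).le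
    have h1 : ∀ j, (l j : ℝ) / n j ≤ 1 := fun j => by
      rw [div_le_one (hn0 j)]
      exact_mod_cast hl'.2 j
    -- The sampling point is compared with the point of the box at the same relative position; their
    -- distance is at most that of the sampled lengths from `τbar`.
    refine hM _ (hsample n l hl) (fun j => (l j : ℝ) / n j * τbar j)
      ⟨fun j => mul_nonneg (h0 j) (hτbar j).le, fun j => mul_le_of_le_one_left (hτbar j).le (h1 j)⟩
      ?_
    rw [dist_pi_lt_iff hδ]
    intro j
    have h2 := (dist_le_pi_dist (sampleLength τ n) τbar j).trans_lt (Metric.mem_ball.1 hn)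
    have h3 : samplePt τ n l j = (l j : ℝ) / n j * sampleLength τ n j := by
      have := (hn0 j).ne'
      simp only [samplePt, sampleLength]
      field_simp
    rw [h3, Real.dist_eq, ← mul_sub, abs_mul, abs_of_nonneg (h0 j), ← Real.dist_eq, dist_comm]
    exact (mul_le_of_le_one_left dist_nonneg (h1 j)).trans_lt h2
  · refine (ae_restrict_mem (MeasurableSet.univ_pi fun j => measurableSet_Ioc)).mono fun z hz => ?_
    have hz' := fun j => mem_univ_pi.1 hz j
    have hzD : z ∈ D := hD ⟨fun j => (hz' j).1.le, fun j => (hz' j).2⟩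
    refine (hd z hzD).tendsto.comp (tendsto_nhdsWithin_iff.2
      ⟨tendsto_samplePt_cellIndex hτbar hκ z, ?_⟩)
    filter_upwards [eventually_one_le] with n hn
    exact hsample n _ (cellIndex_mem_indexBox hτbar hn hz')

/-- With exact sampled lengths no sampling point leaves the box, so bounded variation there gives
the bound and continuity almost everywhere gives the convergence. -/
theorem isSampleable_of_BVHK (hτbar : ∀ j, 0 < τbar j)
    (hκ : ∀ j, ∀ m : ℕ, 1 ≤ m → (m : ℝ) * τ j m = τbar j) {d : (Fin 3 → ℝ) → ℝ}
    (hd : BVHK d 0 τbar) : IsSampleable τ τbar d := by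
  have hlim : Tendsto (sampleLength τ) atTop (𝓝 τbar) := tendsto_sampleLength fun j =>
    tendsto_const_nhds.congr' ((eventually_ge_atTop 1).mono fun m hm => (hκ j m hm).symm)
  constructor
  · obtain ⟨M, hM⟩ := hd.bounded
    refine ⟨M, ?_⟩
    filter_upwards [eventually_one_le] with n hn l hl
    have hn0 : ∀ j, (0 : ℝ) < n j := fun j => by exact_mod_cast hn j
    rw [indexBox, Finset.mem_Icc] at hl
    have h3 : ∀ j, samplePt τ n l j = (l j : ℝ) / n j * τbar j := fun j => by
      have := (hn0 j).ne'
      rw [← hκ j (n j) (hn j), samplePt]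
      field_simp
    refine hM _ ⟨fun j => ?_, fun j => ?_⟩
    · have : (1 : ℝ) ≤ l j := by exact_mod_cast hl.1 j
      rw [h3]
      exact mul_nonneg (div_nonneg (by linarith) (hn0 j).le) (hτbar j).le
    · have : (l j : ℝ) ≤ n j := by exact_mod_cast hl.2 j
      rw [h3]
      exact mul_le_of_le_one_left (hτbar j).le ((div_le_one (hn0 j)).2 this)
  · have hne : ∀ᵐ z : Fin 3 → ℝ, ∀ j, z j ≠ τbar j := ae_all_iff.2 fun j =>
      (Measure.quasiMeasurePreserving_eval (fun _ : Fin 3 => (volume : Measure ℝ)) j).ae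
        (Measure.ae_ne volume (τbar j))
    filter_upwards [ae_restrict_mem (MeasurableSet.univ_pi fun j => measurableSet_Ioc),
      ae_restrict_of_ae hd.ae_continuousAt, ae_restrict_of_ae hne] with z hz hc hne
    have hz' := fun j => mem_univ_pi.1 hz j
    exact (hc fun j => ⟨(hz' j).1, lt_of_le_of_ne (hz' j).2 (hne j)⟩).tendsto.comp
      (tendsto_samplePt_cellIndex hτbar hlim z)

end Sampleable

/-! ### Paths and measurability of the detection process -/

section ResidualPaths

variable (Om : Fin 3 → ℝ) (τ : Fin 3 → ℕ → ℝ) (s₀ : ℝ) (τbar : Fin 3 → ℝ)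

/-- The contribution of the sampling point with index `l` to the detection process. -/
noncomputable def sampleTerm (n : Fin 3 → ℕ) (l : Fin 3 → ℤ) (x : Fin 4 → ℝ) : ℝ :=
  if (l 0 : ℝ) / n 0 ≤ x 0 then √(∏ j, τ j (n j)) * kernel Om (Fin.tail x - samplePt τ n l) else 0

theorem one_le_of_mem_indexBox {n : Fin 3 → ℕ} {l : Fin 3 → ℤ} (hl : l ∈ indexBox n) (j : Fin 3) :
    1 ≤ n j := by
  rw [indexBox, Finset.mem_Icc] at hl
  have h1 : (1 : ℤ) ≤ l j := hl.1 j
  have h2 : l j ≤ n j := hl.2 j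
  omega

/-- For fixed `n` the process is a finite combination of fixed step paths, which gives at once paths
in the Skorohod space and continuity in the residuals. -/
theorem residualField_eq_sum (n : Fin 3 → ℕ) (c : (Fin 3 → ℤ) → ℝ) {x : Fin 4 → ℝ}
    (hx : x 0 ≤ 1) :
    residualField Om τ n c x = ∑ l ∈ indexBox n, c l * sampleTerm Om τ n l x := by
  rw [residualField, Icc_update_floor_eq_filter n hx, Finset.sum_filter, Finset.mul_sum]
  refine Finset.sum_congr rfl fun l hl => ?_
  have hn : (0 : ℝ) < n 0 := by exact_mod_cast one_le_of_mem_indexBox hl 0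
  simp only [sampleTerm, div_le_iff₀' hn]
  split_ifs <;> ring

theorem residualField_congr (n : Fin 3 → ℕ) {c c' : (Fin 3 → ℤ) → ℝ}
    (h : ∀ l ∈ indexBox n, c l = c' l) {x : Fin 4 → ℝ} (hx : x 0 ≤ 1) :
    residualField Om τ n c x = residualField Om τ n c' x := by
  rw [residualField_eq_sum Om τ n c hx, residualField_eq_sum Om τ n c' hx]
  exact Finset.sum_congr rfl fun l hl => by rw [h l hl]

theorem continuous_tail : Continuous fun x : Fin 4 → ℝ => (Fin.tail x : Fin 3 → ℝ) :=
  continuous_pi fun j => continuous_apply j.succ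

theorem isCadlag_sampleTerm (a b : Fin 4 → ℝ) (n : Fin 3 → ℕ) (l : Fin 3 → ℤ) :
    IsCadlag (path a b (sampleTerm Om τ n l)) := by
  have hc : Continuous fun x : Fin 4 → ℝ =>
      √(∏ j, τ j (n j)) * kernel Om (Fin.tail x - samplePt τ n l) :=
    continuous_const.mul ((continuous_kernel Om).comp (continuous_tail.sub continuous_const))
  exact isCadlag_step_mul hc.continuousOn 0 _

theorem path_congr {q : ℕ} {a b : Fin q → ℝ} {f g : (Fin q → ℝ) → ℝ}
    (h : ∀ x ∈ Icc a b, f x = g x) : path a b f = path a b g :=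
  funext fun t => h t t.2

theorem toD_congr {q : ℕ} {a b : Fin q → ℝ} {f g : (Fin q → ℝ) → ℝ}
    (h : ∀ x ∈ Icc a b, f x = g x) : toD a b f = toD a b g := by
  have h' := path_congr h
  by_cases hg : IsCadlag (path a b g)
  · have hf : IsCadlag (path a b f) := h' ▸ hg
    exact (dif_pos hf).trans (Eq.trans (Subtype.ext h') (dif_pos hg).symm)
  · have hf : ¬ IsCadlag (path a b f) := h' ▸ hg
    simp [toD, hf, hg]

theorem isCadlag_residualField (n : Fin 3 → ℕ) (c : (Fin 3 → ℤ) → ℝ) :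
    IsCadlag (path (Fin.cons s₀ 0 : Fin 4 → ℝ) (Fin.cons 1 τbar) (residualField Om τ n c)) := by
  rw [path_congr fun x hx => residualField_eq_sum Om τ n c (mem_box hx).1.2]
  exact IsCadlag.finset_sum _ fun l => (isCadlag_sampleTerm Om τ _ _ n l).const_mul _

theorem continuous_toD_residualField (n : Fin 3 → ℕ) :
    Continuous fun c : (Fin 3 → ℤ) → ℝ =>
      toD (Fin.cons s₀ 0 : Fin 4 → ℝ) (Fin.cons 1 τbar) (residualField Om τ n c) := by
  have h : ∀ c : (Fin 3 → ℤ) → ℝ,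
      toD (Fin.cons s₀ 0 : Fin 4 → ℝ) (Fin.cons 1 τbar) (residualField Om τ n c) =
        toD (Fin.cons s₀ 0 : Fin 4 → ℝ) (Fin.cons 1 τbar)
          fun x => ∑ l ∈ indexBox n, c l * sampleTerm Om τ n l x :=
    fun c => toD_congr fun x hx => residualField_eq_sum Om τ n c (mem_box hx).1.2
  simp_rw [h]
  refine continuous_toD_sum _ (isCadlag_sampleTerm Om τ _ _ n)
    (M := √(∏ j, τ j (n j)) * ∏ j, (|Om j| / Real.pi)) fun l x _ => ?_
  have h0 : 0 ≤ √(∏ j, τ j (n j)) * ∏ j, (|Om j| / Real.pi) :=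
    mul_nonneg (Real.sqrt_nonneg _) (Finset.prod_nonneg fun j _ => by positivity)
  unfold sampleTerm
  split_ifs
  · rw [abs_mul, abs_of_nonneg (Real.sqrt_nonneg _)]
    exact mul_le_mul_of_nonneg_left (abs_kernel_le _ _) (Real.sqrt_nonneg _)
  · simpa using h0

end ResidualPaths

/-! ### Arrays whose partial sums approximate a given path -/

section GridArray

/-- The array of the increments of `β` over the cells of the grid, scaled so that its normalized
partial sums interpolate `β`. -/
noncomputable def gridArray (β : (Fin 3 → ℝ) → ℝ) (n : Fin 3 → ℕ) (l : Fin 3 → ℤ) : ℝ :=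
  √(∏ j, (n j : ℝ)) * altSum (fun z => β fun j => z j / n j) (fun j => (l j : ℝ) - 1)
    fun j => (l j : ℝ)

theorem sum_Icc_sub_int (f : ℝ → ℝ) {k : ℤ} (hk : 0 ≤ k) :
    ∑ t ∈ Finset.Icc 1 k, (f t - f ((t : ℝ) - 1)) = f k - f 0 := by
  obtain ⟨m, rfl⟩ := Int.eq_ofNat_of_zero_le hk
  induction m with
  | zero => simp
  | succ m ih =>
    have h1 : Finset.Icc (1 : ℤ) ((m + 1 : ℕ) : ℤ) = insert ((m : ℤ) + 1) (Finset.Icc 1 (m : ℤ)) := by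
      ext t
      simp only [Finset.mem_Icc, Finset.mem_insert]
      omega
    rw [h1, Finset.sum_insert (by simp), ih (by omega)]
    push_cast
    ring_nf

theorem altSum_of_zero {ι : Type*} [Fintype ι] [DecidableEq ι] {h : (ι → ℝ) → ℝ} {b : ι → ℝ}
    (h0 : ∀ v : Finset ι, v.Nonempty → h (corner v 0 b) = 0) : altSum h 0 b = h b := by
  rw [altSum, Finset.sum_eq_single ∅]
  · have : corner ∅ (0 : ι → ℝ) b = b := by funext j; simp [corner]
    simp [this]
  · intro v _ hv
    rw [h0 v (Finset.nonempty_iff_ne_empty.2 hv), mul_zero]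
  · simp

/-- The cell increments add up to the alternating sum over the whole box, which is the value at the
upper corner because `β` vanishes on the lower faces. -/
theorem arraySum_gridArray {β : (Fin 3 → ℝ) → ℝ}
    (hβ0 : ∀ z ∈ Icc (0 : Fin 3 → ℝ) 1, (∃ j, z j = 0) → β z = 0) {n : Fin 3 → ℕ}
    (hn : ∀ j, 1 ≤ n j) {v : Fin 3 → ℝ} (hv : v ∈ Icc (0 : Fin 3 → ℝ) 1) :
    arraySum (gridArray β n) n v = β fun j => (⌊(n j : ℝ) * v j⌋ : ℝ) / n j := by
  have hn0 : ∀ j, (0 : ℝ) < n j := fun j => by exact_mod_cast hn j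
  have hpos : 0 < ∏ j, (n j : ℝ) := Finset.prod_pos fun j _ => hn0 j
  have hk0 : ∀ j, 0 ≤ ⌊(n j : ℝ) * v j⌋ := fun j =>
    Int.floor_nonneg.2 (mul_nonneg (hn0 j).le (hv.1 j))
  have hk1 : ∀ j, (⌊(n j : ℝ) * v j⌋ : ℝ) / n j ≤ 1 := fun j => by
    rw [div_le_one (hn0 j)]
    exact (Int.floor_le _).trans (mul_le_of_le_one_right (hn0 j).le (hv.2 j))
  have key := sum_altSum_piFinset (fun j => Finset.Icc (1 : ℤ) ⌊(n j : ℝ) * v j⌋)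
    (fun _ t => (t : ℝ) - 1) (fun _ t => (t : ℝ)) 0 (fun j => (⌊(n j : ℝ) * v j⌋ : ℝ))
    (fun j f => by simpa using sum_Icc_sub_int f (hk0 j)) (fun z => β fun j => z j / n j)
  have hz : altSum (fun z : Fin 3 → ℝ => β fun j => z j / n j) 0
      (fun j => (⌊(n j : ℝ) * v j⌋ : ℝ)) = β fun j => (⌊(n j : ℝ) * v j⌋ : ℝ) / n j := by
    refine altSum_of_zero fun w ⟨j, hj⟩ => hβ0 _ ⟨fun i => ?_, fun i => ?_⟩ ⟨j, by simp [corner, hj]⟩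
    · simp only [corner, Pi.zero_apply]
      split_ifs
      · simp
      · exact div_nonneg (Int.cast_nonneg (hk0 i)) (hn0 i).le
    · simp only [corner, Pi.zero_apply]
      split_ifs
      · simp
      · exact hk1 i
  rw [hz] at key
  rw [arraySum, ← key]
  simp only [gridArray]
  rw [← Finset.mul_sum, ← mul_assoc, inv_mul_cancel₀ (Real.sqrt_pos.2 hpos).ne', one_mul]
  rfl

theorem eventually_arraySum_gridArray_near {β : (Fin 3 → ℝ) → ℝ} (hβ : ContinuousOn β (Icc 0 1))
    (hβ0 : ∀ z ∈ Icc (0 : Fin 3 → ℝ) 1, (∃ j, z j = 0) → β z = 0) {δ : ℝ} (hδ : 0 < δ) :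
    ∀ᶠ n : Fin 3 → ℕ in atTop, ∀ v ∈ Icc (0 : Fin 3 → ℝ) 1,
      |arraySum (gridArray β n) n v - β v| ≤ δ := by
  obtain ⟨δ₁, hδ₁, hu⟩ := Metric.uniformContinuousOn_iff.1
    (isCompact_Icc.uniformContinuousOn_of_continuous hβ) δ hδ
  have hlim : ∀ᶠ n : Fin 3 → ℕ in atTop, ∀ j, 1 / (n j : ℝ) < δ₁ := eventually_all.2 fun j =>
    (tendsto_one_div_atTop_nhds_zero_nat.comp (tendsto_eval_atTop j)).eventually (gt_mem_nhds hδ₁)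
  filter_upwards [eventually_one_le, hlim] with n hn hlt v hv
  have hn0 : ∀ j, (0 : ℝ) < n j := fun j => by exact_mod_cast hn j
  rw [arraySum_gridArray hβ0 hn hv]
  refine (hu _ ⟨fun j => ?_, fun j => ?_⟩ v hv ?_).le
  · exact div_nonneg (Int.cast_nonneg (Int.floor_nonneg.2 (mul_nonneg (hn0 j).le (hv.1 j))))
      (hn0 j).le
  · exact (div_le_one (hn0 j)).2
      ((Int.floor_le _).trans (mul_le_of_le_one_right (hn0 j).le (hv.2 j)))
  · rw [dist_pi_lt_iff hδ₁]
    intro j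
    refine lt_of_le_of_lt ?_ (hlt j)
    have h1 := Int.floor_le ((n j : ℝ) * v j)
    have h2 := Int.lt_floor_add_one ((n j : ℝ) * v j)
    have h3 : (⌊(n j : ℝ) * v j⌋ : ℝ) / n j - v j = (⌊(n j : ℝ) * v j⌋ - n j * v j) / n j := by
      have := (hn0 j).ne'
      field_simp
    rw [Real.dist_eq, h3, abs_div, abs_of_pos (hn0 j)]
    refine div_le_div_of_nonneg_right (abs_le.2 ⟨?_, ?_⟩) (hn0 j).le <;> linarith

/-- For `l` in the index box all corners of the cell lie in the unit cube, where the field is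
assumed measurable. -/
theorem measurable_gridArray {Ω' : Type*} [MeasurableSpace Ω'] {B : Ω' → (Fin 3 → ℝ) → ℝ}
    (hB : ∀ t ∈ Icc (0 : Fin 3 → ℝ) 1, Measurable fun ω => B ω t) {n : Fin 3 → ℕ}
    {l : Fin 3 → ℤ} (hl : l ∈ indexBox n) : Measurable fun ω => gridArray (B ω) n l := by
  have hn0 : ∀ j, (0 : ℝ) < n j := fun j => by exact_mod_cast one_le_of_mem_indexBox hl j
  rw [indexBox, Finset.mem_Icc] at hl
  refine Measurable.const_mul (Finset.measurable_sum _ fun v _ => (hB _ ?_).const_mul _) _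
  have h1 : ∀ j, (1 : ℝ) ≤ l j := fun j => by exact_mod_cast hl.1 j
  have h2 : ∀ j, (l j : ℝ) ≤ n j := fun j => by exact_mod_cast hl.2 j
  constructor <;> intro j
  · refine div_nonneg ?_ (hn0 j).le
    simp only [corner]
    split_ifs <;> linarith [h1 j]
  · refine (div_le_one (hn0 j)).2 ?_
    simp only [corner]
    split_ifs <;> linarith [h2 j]

end GridArray

/-! ### The limit process and its measurability -/

section Limit

variable {Om : Fin 3 → ℝ} {τ : Fin 3 → ℕ → ℝ} {s₀ : ℝ} {τbar : Fin 3 → ℝ}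

/-- The limit path for the path `β` of the noise and the path `d` of the disturbance. -/
noncomputable def limitPath (Om τbar : Fin 3 → ℝ) (β d : (Fin 3 → ℝ) → ℝ) (x : Fin 4 → ℝ) : ℝ :=
  √(∏ j, τbar j) * partsIntegral Om (fun z => β (clampCube z)) (Function.update 1 0 (x 0)) τbar
    (Fin.tail x) + drift Om τbar d x

theorem continuousOn_limitPath (hτbar : ∀ j, 0 < τbar j)
    (hκ : Tendsto (sampleLength τ) atTop (𝓝 τbar)) {β d : (Fin 3 → ℝ) → ℝ}
    (hβ : ContinuousOn β (Icc 0 1)) (hd : IsSampleable τ τbar d) :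
    ContinuousOn (limitPath Om τbar β d) (Icc (Fin.cons s₀ 0 : Fin 4 → ℝ) (Fin.cons 1 τbar)) := by
  obtain ⟨M, -, hM⟩ := exists_bound_Icc hβ
  refine ContinuousOn.add (Continuous.continuousOn ?_)
    (hd.continuousOn_drift hτbar hκ Om fun x hx => (mem_box hx).1.2)
  have h1 := continuous_partsIntegral Om (continuous_comp_clampCube hβ)
    fun z => hM _ (clampCube_mem z)
  have h2 : Continuous fun x : Fin 4 → ℝ =>
      ((Function.update 1 0 (x 0) : Fin 3 → ℝ), τbar, (Fin.tail x : Fin 3 → ℝ)) :=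
    ((continuous_const (y := (1 : Fin 3 → ℝ))).update 0 (continuous_apply 0)).prodMk
      ((continuous_const (y := τbar)).prodMk continuous_tail)
  exact continuous_const.mul (h1.comp h2)

/-- Positivity of the time is needed: on a degenerate box the Riemann-Stieltjes integral is not
determined. -/
theorem nullLimit_eq (Om : Fin 3 → ℝ) (τbar : Fin 3 → ℝ) (σ : ℝ) {β : (Fin 3 → ℝ) → ℝ}
    (hβ : ContinuousOn β (Icc 0 1))
    (hβ0 : ∀ z ∈ Icc (0 : Fin 3 → ℝ) 1, (∃ j, z j = 0) → β z = 0) {x : Fin 4 → ℝ}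
    (hx0 : 0 < x 0) (hx1 : x 0 ≤ 1) :
    nullLimit Om τbar σ β x = √(∏ j, τbar j) * partsIntegral Om (fun z => σ * β (clampCube z))
      (Function.update 1 0 (x 0)) τbar (Fin.tail x) := by
  have hb : ∀ j, 0 < (Function.update 1 0 (x 0) : Fin 3 → ℝ) j := fun j => by
    rcases eq_or_ne j 0 with rfl | hj <;> simp [*]
  have hb1 : ∀ j, (Function.update 1 0 (x 0) : Fin 3 → ℝ) j ≤ 1 := fun j => by
    rcases eq_or_ne j 0 with rfl | hj <;> simp [*]
  have h1 := stieltjes_prod_kfac hβ hβ0 Om τbar (Fin.tail x) hb hb1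
  have h2 : (fun z : Fin 3 → ℝ => kernel Om (Fin.tail x - τbar * z)) =
      fun z => ∏ j, kfac (Om j) (Fin.tail x j - τbar j * z j) := rfl
  rw [nullLimit, h2, h1, partsIntegral, partsIntegral, mul_assoc, ← integral_const_mul]
  simp only [mul_assoc]

/-- The deterministic core: for fixed paths the same `δ` and the same `n` serve all arrays. It is
used with the noise for the convergence and with Brownian increments for the measurability of the
limit. -/
theorem eventually_edist_limitPath_le (hs₀ : 0 ≤ s₀) (hτbar : ∀ j, 0 < τbar j)
    (hτ : ∀ j m, 1 ≤ m → 0 < τ j m) (hκ : Tendsto (sampleLength τ) atTop (𝓝 τbar))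
    {β d : (Fin 3 → ℝ) → ℝ} (hβ : ContinuousOn β (Icc 0 1)) (hd : IsSampleable τ τbar d) {η : ℝ}
    (hη : 0 < η) :
    ∃ δ : ℝ, 0 < δ ∧ ∀ᶠ n : Fin 3 → ℕ in atTop, ∀ e : (Fin 3 → ℤ) → ℝ,
      (∀ v ∈ Icc (0 : Fin 3 → ℝ) 1, |arraySum e n v - β v| ≤ δ) →
      edist (toD (Fin.cons s₀ 0 : Fin 4 → ℝ) (Fin.cons 1 τbar) (residualField Om τ n
          fun l => d (samplePt τ n l) / √(∏ j, (n j : ℝ)) + e l))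
        (toD (Fin.cons s₀ 0 : Fin 4 → ℝ) (Fin.cons 1 τbar) (limitPath Om τbar β d)) ≤
        ENNReal.ofReal η := by
  obtain ⟨δ, hδ, h1⟩ := eventually_residualField_near Om hs₀ hτbar hτ hκ hβ (half_pos hη)
  refine ⟨δ, hδ, ?_⟩
  filter_upwards [h1, hd.eventually_residualField_near hτbar hκ Om
    (K := Icc (Fin.cons s₀ 0 : Fin 4 → ℝ) (Fin.cons 1 τbar)) (fun x hx => (mem_box hx).1.2)
    isCompact_Icc (half_pos hη)] with n hn1 hn2 e he
  refine edist_toD_le (isCadlag_residualField Om τ s₀ τbar n _)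
    (isCadlag_of_continuousOn (continuousOn_limitPath hτbar hκ hβ hd)) fun x hx => ?_
  have h3 := abs_le.1 (hn1 e he x hx)
  have h4 := abs_le.1 (hn2 x hx)
  rw [residualField_add, limitPath]
  exact abs_le.2 ⟨by linarith [h3.1, h4.1], by linarith [h3.2, h4.2]⟩

/-- The limit process is a random element of the Skorohod space. -/
theorem aemeasurable_toD_limitPath {Ω Ω' : Type*} [MeasurableSpace Ω] [MeasurableSpace Ω']
    {P : Measure Ω} [IsProbabilityMeasure P] {P' : Measure Ω'} [IsProbabilityMeasure P']
    (hs₀ : 0 ≤ s₀) (hτbar : ∀ j, 0 < τbar j) (hτ : ∀ j m, 1 ≤ m → 0 < τ j m)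
    (hκ : Tendsto (sampleLength τ) atTop (𝓝 τbar)) {B : Ω' → (Fin 3 → ℝ) → ℝ}
    (hBm : ∀ t ∈ Icc (0 : Fin 3 → ℝ) 1, Measurable fun ω => B ω t)
    (hBc : ∀ᵐ ω ∂P', ContinuousOn (B ω) (Icc 0 1))
    (hB0 : ∀ᵐ ω ∂P', ∀ z ∈ Icc (0 : Fin 3 → ℝ) 1, (∃ j, z j = 0) → B ω z = 0)
    {Δ : Ω → (Fin 3 → ℝ) → ℝ}
    (hΔm : ∀ n : Fin 3 → ℕ, ∀ l ∈ indexBox n, Measurable fun ω => Δ ω (samplePt τ n l))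
    (hΔ : ∀ᵐ ω ∂P, IsSampleable τ τbar (Δ ω)) :
    AEMeasurable (fun p : Ω × Ω' => toD (Fin.cons s₀ 0 : Fin 4 → ℝ) (Fin.cons 1 τbar)
      (limitPath Om τbar (B p.2) (Δ p.1))) (P.prod P') := by
  let c : (Fin 3 → ℕ) → Ω × Ω' → (Fin 3 → ℤ) → ℝ := fun n p l =>
    Δ p.1 (samplePt τ n l) / √(∏ j, (n j : ℝ)) + gridArray (B p.2) n l
  -- Outside the index box measurability is unknown; setting the array to `0` there does not change
  -- the field.
  let c' : (Fin 3 → ℕ) → Ω × Ω' → (Fin 3 → ℤ) → ℝ := fun n p l =>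
    if l ∈ indexBox n then c n p l else 0
  have hc' : ∀ n, Measurable (c' n) := fun n => measurable_pi_lambda _ fun l => by
    by_cases hl : l ∈ indexBox n
    · simp only [c', if_pos hl, c]
      exact (((hΔm n l hl).comp measurable_fst).div_const _).add
        ((measurable_gridArray hBm hl).comp measurable_snd)
    · simp only [c', if_neg hl]
      exact measurable_const
  refine aemeasurable_of_tendsto_metrizable_ae (atTop : Filter (Fin 3 → ℕ))
    (f := fun n p => toD (Fin.cons s₀ 0 : Fin 4 → ℝ) (Fin.cons 1 τbar)
      (residualField Om τ n (c' n p)))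
    (fun n => ((continuous_toD_residualField Om τ s₀ τbar n).measurable.comp
      (hc' n)).aemeasurable) ?_
  have h1 : ∀ᵐ p ∂P.prod P', IsSampleable τ τbar (Δ p.1) :=
    Measure.quasiMeasurePreserving_fst.ae hΔ
  have h2 : ∀ᵐ p ∂P.prod P', ContinuousOn (B p.2) (Icc 0 1) ∧
      ∀ z ∈ Icc (0 : Fin 3 → ℝ) 1, (∃ j, z j = 0) → B p.2 z = 0 :=
    Measure.quasiMeasurePreserving_snd.ae (hBc.and hB0)
  filter_upwards [h1, h2] with p hp1 hp2
  have heq : ∀ n, toD (Fin.cons s₀ 0 : Fin 4 → ℝ) (Fin.cons 1 τbar)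
      (residualField Om τ n (c' n p)) = toD (Fin.cons s₀ 0 : Fin 4 → ℝ) (Fin.cons 1 τbar)
      (residualField Om τ n (c n p)) := fun n => toD_congr fun x hx =>
    residualField_congr Om τ n (fun l hl => if_pos hl) (mem_box hx).1.2
  simp_rw [heq]
  rw [tendsto_iff_edist_tendsto_0, ENNReal.tendsto_nhds_zero]
  intro r hr
  obtain ⟨η, hη, hηr⟩ : ∃ η : ℝ, 0 < η ∧ ENNReal.ofReal η ≤ r := by
    obtain ⟨q, hq0, hq⟩ := ENNReal.lt_iff_exists_real_btwn.1 hr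
    exact ⟨q, ENNReal.ofReal_pos.1 hq.1, hq.2.le⟩
  obtain ⟨δ, hδ, h⟩ := eventually_edist_limitPath_le (Om := Om) hs₀ hτbar hτ hκ hp2.1 hp1 hη
  filter_upwards [h, eventually_arraySum_gridArray_near hp2.1 hp2.2 hδ] with n hn hn'
  exact (hn _ hn').trans hηr

end Limit

/-! ### Brownian paths on the lower faces -/

section Brownian

/-- The exceptional null set may depend on the point; a countable dense subset of the lower faces
and path continuity give a single one. -/
theorem IsBrownianMotion.ae_zero {Ω : Type*} [MeasurableSpace Ω] {P : Measure Ω}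
    {B : Ω → (Fin 3 → ℝ) → ℝ} (hB : IsBrownianMotion P B) :
    ∀ᵐ ω ∂P, ∀ z ∈ Icc (0 : Fin 3 → ℝ) 1, (∃ j, z j = 0) → B ω z = 0 := by
  let S : Set (Fin 3 → ℝ) := {z ∈ Icc (0 : Fin 3 → ℝ) 1 | ∃ j, z j = 0}
  obtain ⟨T, hTc, hTd⟩ := TopologicalSpace.exists_countable_dense S
  have h1 : ∀ᵐ ω ∂P, ∀ z ∈ T, B ω z = 0 := by
    rw [ae_ball_iff hTc]
    exact fun z _ => hB.zero z z.2.1 z.2.2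
  filter_upwards [h1, hB.continuous] with ω hω hc z hz hz0
  have hcont : Continuous fun z : S => B ω z :=
    (hc.mono fun z hz => hz.1).comp_continuous continuous_subtype_val fun z => z.2
  exact congr_fun (hcont.ext_on hTd continuous_const fun z hz => hω z hz) ⟨z, hz, hz0⟩

end Brownian

/-- For independent `X` and `Y`, the two arguments may be sampled on a product space. -/
theorem integral_comp_eq_integral_prod {Ω α γ : Type*} [MeasurableSpace Ω] [MeasurableSpace α]
    [MeasurableSpace γ] {P : Measure Ω} [IsProbabilityMeasure P] {X : Ω → α} {Y : Ω → γ}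
    (h : IndepFun X Y P) (hX : Measurable X) (hY : Measurable Y) {φ : α × γ → ℝ}
    (hφ : Measurable φ) :
    ∫ ω, φ (X ω, Y ω) ∂P = ∫ p, φ (X p.1, Y p.2) ∂P.prod P := by
  have h1 := (indepFun_iff_map_prod_eq_prod_map_map hX.aemeasurable hY.aemeasurable).1 h
  rw [← integral_map (hX.prodMk hY).aemeasurable hφ.aestronglyMeasurable, h1,
    Measure.map_prod_map _ _ hX hY, integral_map (hX.prodMap hY).aemeasurable
      hφ.aestronglyMeasurable]
  rfl

/-! ### Convergence of expectations, first for a frozen disturbance -/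

section Convergence

variable {Om : Fin 3 → ℝ} {τ : Fin 3 → ℕ → ℝ} {s₀ : ℝ} {τbar : Fin 3 → ℝ}

open Classical in
/-- The residuals at the sampling points for the path `p.1` of the disturbance on `D` and the path
`p.2` of the noise. -/
noncomputable def sampledResidual (τ : Fin 3 → ℕ → ℝ) (D : Set (Fin 3 → ℝ)) (n : Fin 3 → ℕ)
    (p : (D → ℝ) × ((Fin 3 → ℤ) → ℝ)) (l : Fin 3 → ℤ) : ℝ :=
  (if h : samplePt τ n l ∈ D then p.1 ⟨_, h⟩ else 0) / √(∏ j, (n j : ℝ)) + p.2 l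

theorem measurable_sampledResidual (D : Set (Fin 3 → ℝ)) (n : Fin 3 → ℕ) :
    Measurable (sampledResidual τ D n) := by
  refine measurable_pi_lambda _ fun l => Measurable.add (Measurable.div_const ?_ _) ?_
  · by_cases h : samplePt τ n l ∈ D
    · simp only [dif_pos h]
      exact (measurable_pi_apply _).comp measurable_fst
    · simp only [dif_neg h]
      exact measurable_const
  · exact (measurable_pi_apply l).comp measurable_snd

theorem toD_residualField_sampledResidual (Om : Fin 3 → ℝ) (s₀ : ℝ) (τbar : Fin 3 → ℝ)
    {D : Set (Fin 3 → ℝ)} {n : Fin 3 → ℕ} (hsample : ∀ i ∈ indexBox n, samplePt τ n i ∈ D)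
    (d : (Fin 3 → ℝ) → ℝ) (e : (Fin 3 → ℤ) → ℝ) :
    toD (Fin.cons s₀ 0 : Fin 4 → ℝ) (Fin.cons 1 τbar)
        (residualField Om τ n (sampledResidual τ D n (fun x : D => d x, e))) =
      toD (Fin.cons s₀ 0 : Fin 4 → ℝ) (Fin.cons 1 τbar) (residualField Om τ n
        fun l => d (samplePt τ n l) / √(∏ j, (n j : ℝ)) + e l) :=
  toD_congr fun x hx => residualField_congr Om τ n
    (fun l hl => by rw [sampledResidual, dif_pos (hsample l hl)]) (mem_box hx).1.2

theorem measurable_toD_sampledResidual (Om : Fin 3 → ℝ) (s₀ : ℝ) (τbar : Fin 3 → ℝ)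
    (D : Set (Fin 3 → ℝ)) (n : Fin 3 → ℕ) :
    Measurable fun p : (D → ℝ) × ((Fin 3 → ℤ) → ℝ) =>
      toD (Fin.cons s₀ 0 : Fin 4 → ℝ) (Fin.cons 1 τbar)
        (residualField Om τ n (sampledResidual τ D n p)) :=
  (continuous_toD_residualField Om τ s₀ τbar n).measurable.comp (measurable_sampledResidual D n)

variable {Ω Ω' : Type*} [MeasurableSpace Ω] [MeasurableSpace Ω']
  {P : Measure Ω} [IsProbabilityMeasure P] {P' : Measure Ω'} [IsProbabilityMeasure P']

/-- The convergence for a fixed path `d` of the disturbance. -/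
theorem tendsto_integral_residualField_of_isSampleable (hs₀ : 0 ≤ s₀) (hτbar : ∀ j, 0 < τbar j)
    (hτ : ∀ j m, 1 ≤ m → 0 < τ j m) (hκ : Tendsto (sampleLength τ) atTop (𝓝 τbar))
    {B : Ω' → (Fin 3 → ℝ) → ℝ} (hBc : ∀ᵐ ω ∂P', ContinuousOn (B ω) (Icc 0 1))
    {ε : (Fin 3 → ℤ) → Ω → ℝ} (hclt : WeakConvD 0 1 (partialSum ε) atTop B P P')
    {d : (Fin 3 → ℝ) → ℝ} (hd : IsSampleable τ τbar d)
    (h : BoundedContinuousFunction (DSpace (Fin.cons s₀ 0 : Fin 4 → ℝ) (Fin.cons 1 τbar)) ℝ)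
    (hψm : ∀ n : Fin 3 → ℕ, AEStronglyMeasurable (fun ω => h (toD _ _ (residualField Om τ n
      fun l => d (samplePt τ n l) / √(∏ j, (n j : ℝ)) + ε l ω))) P)
    (hHm : AEStronglyMeasurable (fun ω' => h (toD _ _ (limitPath Om τbar (B ω') d))) P') :
    Tendsto (fun n : Fin 3 → ℕ => ∫ ω, h (toD _ _ (residualField Om τ n
        fun l => d (samplePt τ n l) / √(∏ j, (n j : ℝ)) + ε l ω)) ∂P) atTop
      (𝓝 (∫ ω', h (toD _ _ (limitPath Om τbar (B ω') d)) ∂P')) := by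
  -- On the set `A` all partial sum paths are genuine elements of the Skorohod space, so that `toD`
  -- is not its default value `0`.
  refine tendsto_integral_of_continuous_convergence
    (A := {ω | ∀ n, IsCadlag (path 0 1 (partialSum ε n ω))}) hclt.2.2
    (fun n ω => h.norm_coe_le_norm _) hψm (fun ω' => h.norm_coe_le_norm _) hHm
    (ae_all_iff.2 hclt.1) ?_
  filter_upwards [hBc] with ω' hω' η hη
  obtain ⟨ρ, hρ, hρh⟩ := EMetric.tendsto_nhds_nhds.1
    (h.continuous.tendsto (toD _ _ (limitPath Om τbar (B ω') d))) (ENNReal.ofReal η)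
    (ENNReal.ofReal_pos.2 hη)
  obtain ⟨r, hr, hrρ⟩ : ∃ r : ℝ, 0 < r ∧ ENNReal.ofReal r < ρ := by
    obtain ⟨q, hq0, hq⟩ := ENNReal.lt_iff_exists_real_btwn.1 hρ
    exact ⟨q, ENNReal.ofReal_pos.1 hq.1, hq.2⟩
  obtain ⟨δ, hδ, hev⟩ := eventually_edist_limitPath_le (Om := Om) hs₀ hτbar hτ hκ hω' hd hr
  obtain ⟨δ', hδ', hclose⟩ := exists_forall_abs_sub_lt_of_edist_toD_lt hω' hδ
  refine ⟨_, hev, δ', hδ', fun n hn ω hω hdist => ?_⟩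
  have h1 := hn (fun l => ε l ω) fun v hv => (hclose _ (hω n) hdist v hv).le
  have h2 := hρh (h1.trans_lt hrρ)
  rwa [edist_lt_ofReal, Real.dist_eq] at h2

/-- Independence turns the expectation into an iterated integral. The inner one converges for almost
every path of the disturbance, and the bound on `h` permits passing to the limit in the outer one.
-/
theorem tendsto_integral_residualField (hs₀ : 0 ≤ s₀) (hτbar : ∀ j, 0 < τbar j)
    (hτ : ∀ j m, 1 ≤ m → 0 < τ j m) (hκ : Tendsto (sampleLength τ) atTop (𝓝 τbar))
    {B : Ω' → (Fin 3 → ℝ) → ℝ} (hBm : ∀ t ∈ Icc (0 : Fin 3 → ℝ) 1, Measurable fun ω => B ω t)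
    (hBc : ∀ᵐ ω ∂P', ContinuousOn (B ω) (Icc 0 1))
    (hB0 : ∀ᵐ ω ∂P', ∀ z ∈ Icc (0 : Fin 3 → ℝ) 1, (∃ j, z j = 0) → B ω z = 0)
    {ε : (Fin 3 → ℤ) → Ω → ℝ} (hεm : ∀ i, Measurable (ε i))
    (hclt : WeakConvD 0 1 (partialSum ε) atTop B P P')
    {D : Set (Fin 3 → ℝ)} (hsample : ∀ n : Fin 3 → ℕ, ∀ i ∈ indexBox n, samplePt τ n i ∈ D)
    {Δ : Ω → (Fin 3 → ℝ) → ℝ} (hΔm : ∀ x ∈ D, Measurable fun ω => Δ ω x)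
    (hindep : IndepFun (fun ω (x : D) => Δ ω x) (fun ω i => ε i ω) P)
    (hΔ : ∀ᵐ ω ∂P, IsSampleable τ τbar (Δ ω))
    (h : BoundedContinuousFunction (DSpace (Fin.cons s₀ 0 : Fin 4 → ℝ) (Fin.cons 1 τbar)) ℝ) :
    Tendsto (fun n : Fin 3 → ℕ => ∫ ω, h (toD _ _ (residualField Om τ n
        fun l => Δ ω (samplePt τ n l) / √(∏ j, (n j : ℝ)) + ε l ω)) ∂P) atTop
      (𝓝 (∫ p, h (toD _ _ (limitPath Om τbar (B p.2) (Δ p.1))) ∂P.prod P')) := by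
  have hX : Measurable fun ω (x : D) => Δ ω x := measurable_pi_lambda _ fun x => hΔm x x.2
  have hE : Measurable fun ω i => ε i ω := measurable_pi_lambda _ hεm
  let φ : (Fin 3 → ℕ) → (D → ℝ) × ((Fin 3 → ℤ) → ℝ) → ℝ := fun n p =>
    h (toD _ _ (residualField Om τ n (sampledResidual τ D n p)))
  have hφ : ∀ n, Measurable (φ n) := fun n =>
    h.continuous.measurable.comp (measurable_toD_sampledResidual Om s₀ τbar D n)
  have hφeq : ∀ n ω₁ ω₂, h (toD _ _ (residualField Om τ n
      fun l => Δ ω₁ (samplePt τ n l) / √(∏ j, (n j : ℝ)) + ε l ω₂)) =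
      φ n (fun x : D => Δ ω₁ x, fun i => ε i ω₂) := fun n ω₁ ω₂ =>
    congr_arg h (toD_residualField_sampledResidual Om s₀ τbar (hsample n) (Δ ω₁)
      fun i => ε i ω₂).symm
  have hφm : ∀ n, Measurable fun p : Ω × Ω => φ n (fun x : D => Δ p.1 x, fun i => ε i p.2) :=
    fun n => (hφ n).comp ((hX.comp measurable_fst).prodMk (hE.comp measurable_snd))
  have hlm : AEStronglyMeasurable (fun p : Ω × Ω' =>
      h (toD _ _ (limitPath Om τbar (B p.2) (Δ p.1)))) (P.prod P') :=
    (h.continuous.measurable.comp_aemeasurable (aemeasurable_toD_limitPath hs₀ hτbar hτ hκ hBm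
      hBc hB0 (fun n l hl => hΔm _ (hsample n l hl)) hΔ)).aestronglyMeasurable
  have hbound : ∀ {S : Type _} [MeasurableSpace S] {Q : Measure S} [IsProbabilityMeasure Q]
      (g : S → DSpace (Fin.cons s₀ 0 : Fin 4 → ℝ) (Fin.cons 1 τbar)),
      ‖∫ s, h (g s) ∂Q‖ ≤ ‖h‖ := fun {S _ Q _} g => by
    simpa using norm_integral_le_of_norm_le_const (μ := Q)
      (Eventually.of_forall fun s => h.norm_coe_le_norm (g s))
  have hL : ∀ n, ∫ ω, h (toD _ _ (residualField Om τ n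
      fun l => Δ ω (samplePt τ n l) / √(∏ j, (n j : ℝ)) + ε l ω)) ∂P =
      ∫ ω₁, ∫ ω₂, h (toD _ _ (residualField Om τ n
        fun l => Δ ω₁ (samplePt τ n l) / √(∏ j, (n j : ℝ)) + ε l ω₂)) ∂P ∂P := fun n => by
    simp_rw [hφeq]
    rw [integral_comp_eq_integral_prod hindep hX hE (hφ n), integral_prod]
    exact Integrable.of_bound (hφm n).aestronglyMeasurable ‖h‖
      (Eventually.of_forall fun p => h.norm_coe_le_norm _)
  rw [integral_prod _ (Integrable.of_bound hlm ‖h‖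
    (Eventually.of_forall fun p => h.norm_coe_le_norm _))]
  simp_rw [hL]
  refine tendsto_integral_filter_of_dominated_convergence (fun _ => ‖h‖)
    (Eventually.of_forall fun n => ?_) (Eventually.of_forall fun n =>
      Eventually.of_forall fun ω => hbound _) (integrable_const _) ?_
  · simp_rw [hφeq]
    exact (hφm n).stronglyMeasurable.integral_prod_right'.aestronglyMeasurable
  -- Joint measurability of the limit gives measurability of its sections only for almost every
  -- path, which suffices.
  · filter_upwards [hΔ, hlm.prodMk_left] with ω₁ hω₁ hω₁m
    refine tendsto_integral_residualField_of_isSampleable hs₀ hτbar hτ hκ hBc hclt hω₁ h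
      (fun n => ?_) hω₁m
    simp_rw [hφeq]
    exact ((hφm n).comp measurable_prodMk_left).aestronglyMeasurable

end Convergence

-- The theorem

end SignalDetection

theorem mainTheorem3
    {Ω Ω' : Type*} [MeasurableSpace Ω] [MeasurableSpace Ω']
    (P : Measure Ω) [IsProbabilityMeasure P] (P' : Measure Ω') [IsProbabilityMeasure P']
    -- kernel, starting time, sampling periods
    (Om : Fin 3 → ℝ) (hOm : ∀ j, 0 < Om j)
    (s₀ : ℝ) (hs₀ : 0 < s₀) (hs₁ : s₀ < 1)
    (τbar : Fin 3 → ℝ) (hτbar : ∀ j, 0 < τbar j)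
    (τ : Fin 3 → ℕ → ℝ) (hτ : ∀ j m, 1 ≤ m → 0 < τ j m)
    -- Brownian motion and noise
    (B : Ω' → (Fin 3 → ℝ) → ℝ) (hB : IsBrownianMotion P' B)
    (σ : ℝ) (ε : (Fin 3 → ℤ) → Ω → ℝ) (hε : NoiseAssumption P P' ε σ B)
    -- the domain of the signals: it contains the rectangle `[0, τbar]` and the sampling points
    (D : Set (Fin 3 → ℝ)) (hD : Icc 0 τbar ⊆ D)
    (hsample : ∀ n : Fin 3 → ℕ, ∀ i ∈ indexBox n, samplePt τ n i ∈ D)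
    -- the random disturbance, independent of the noise
    (Δ : Ω → (Fin 3 → ℝ) → ℝ) (hΔ : ∀ x ∈ D, Measurable fun ω => Δ ω x)
    (hindep : IndepFun (fun ω (x : D) => Δ ω x) (fun ω i => ε i ω) P)
    (hcase :
      ((∀ᵐ ω ∂P, ContinuousOn (Δ ω) D) ∧
        ∀ j, Tendsto (fun m : ℕ => (m : ℝ) * τ j m) atTop (𝓝 (τbar j))) ∨
      ((∀ᵐ ω ∂P, BVHK (Δ ω) 0 τbar) ∧ ∀ j, ∀ m : ℕ, 1 ≤ m → (m : ℝ) * τ j m = τbar j))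
    -- the local alternative and the sampling model
    (f0 : (Fin 3 → ℝ) → ℝ) (f : (Fin 3 → ℕ) → Ω → (Fin 3 → ℝ) → ℝ)
    (hf : ∀ n : Fin 3 → ℕ, (∀ j, 1 ≤ n j) → ∀ ω, ∀ x ∈ D,
      f n ω x - f0 x = Δ ω x / √(∏ j, (n j : ℝ)))
    (y : (Fin 3 → ℕ) → Ω → (Fin 3 → ℤ) → ℝ)
    (hy : ∀ n ω, ∀ i ∈ indexBox n, y n ω i = f n ω (samplePt τ n i) + ε i ω) :
    -- the integrals in the limit process exist
    (∀ᵐ ω' ∂P', ∀ x ∈ Icc (Fin.cons s₀ 0 : Fin 4 → ℝ) (Fin.cons 1 τbar),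
      StieltjesExists (fun z => kernel Om (Fin.tail x - τbar * z)) (B ω') 0
        (Function.update 1 0 (x 0))) ∧
    (∀ᵐ ω ∂P, ∀ x ∈ Icc (Fin.cons s₀ 0 : Fin 4 → ℝ) (Fin.cons 1 τbar),
      IntegrableOn (fun z => kernel Om (Fin.tail x - z) * Δ ω z)
        (Icc 0 (Function.update τbar 0 (x 0 * τbar 0)))) ∧
    -- weak convergence of the detection process as `min n_j → ∞`
    WeakConvD (Fin.cons s₀ 0) (Fin.cons 1 τbar)
      (fun (n : Fin 3 → ℕ) ω x => detectionProcess Om τ f0 n (y n ω) x) atTop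
      (fun (p : Ω × Ω') x => nullLimit Om τbar σ (B p.2) x + drift Om τbar (Δ p.1) x)
      P (P.prod P') := by
  have hκ : Tendsto (sampleLength τ) atTop (𝓝 τbar) := tendsto_sampleLength fun j => by
    rcases hcase with h | h
    · exact h.2 j
    · exact tendsto_const_nhds.congr' ((eventually_ge_atTop 1).mono fun m hm => (h.2 j m hm).symm)
  have hreg : ∀ᵐ ω ∂P, IsSampleable τ τbar (Δ ω) := by
    rcases hcase with h | h
    · exact h.1.mono fun ω hω => isSampleable_of_continuousOn hτbar hκ hD hsample hω
    · exact h.1.mono fun ω hω => isSampleable_of_BVHK hτbar h.2 hω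
  have hpos : ∀ x ∈ Icc (Fin.cons s₀ 0 : Fin 4 → ℝ) (Fin.cons 1 τbar), 0 < x 0 ∧ x 0 ≤ 1 :=
    fun x hx => ⟨hs₀.trans_le (mem_box hx).1.1, (mem_box hx).1.2⟩
  refine ⟨?_, ?_, ?_⟩
  · filter_upwards [hB.continuous] with ω' hω' x hx
    refine stieltjesExists_prod hω'
      (fun j u => hasDerivAt_kfac_sub (Om j) (Fin.tail x j) (τbar j) u)
      (fun j => continuous_kfacDeriv_sub (Om j) (Fin.tail x j) (τbar j)) (fun j => ?_) fun j => ?_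
    · rcases eq_or_ne j 0 with rfl | hj <;> simp [*]
    · rcases eq_or_ne j 0 with rfl | hj <;> simp [*]
  · filter_upwards [hreg] with ω hω x hx
    rw [IntegrableOn, restrict_Icc_update hτbar (hpos x hx).2]
    exact Integrable.restrict (hω.integrableOn hτbar Om (Fin.tail x))
  · have hcadlag : ∀ n ω, IsCadlag (path (Fin.cons s₀ 0 : Fin 4 → ℝ) (Fin.cons 1 τbar)
        fun x => detectionProcess Om τ f0 n (y n ω) x) := fun n ω =>
      isCadlag_residualField Om τ s₀ τbar n fun l => y n ω l - f0 (samplePt τ n l)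
    -- At the sampling points the reference signal cancels; only the scaled disturbance and the
    -- noise remain.
    have hX : ∀ n ω, toD (Fin.cons s₀ 0 : Fin 4 → ℝ) (Fin.cons 1 τbar)
        (fun x => detectionProcess Om τ f0 n (y n ω) x) =
        toD (Fin.cons s₀ 0 : Fin 4 → ℝ) (Fin.cons 1 τbar) (residualField Om τ n
          fun l => Δ ω (samplePt τ n l) / √(∏ j, (n j : ℝ)) + ε l ω) := fun n ω =>
      toD_congr fun x hx => residualField_congr Om τ n (fun l hl => by
        rw [hy n ω l hl, ← hf n (one_le_of_mem_indexBox hl) ω _ (hsample n l hl)]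
        ring) (hpos x hx).2
    have hXm : ∀ n, Measurable fun ω => toD (Fin.cons s₀ 0 : Fin 4 → ℝ) (Fin.cons 1 τbar)
        (fun x => detectionProcess Om τ f0 n (y n ω) x) := fun n => by
      simp_rw [hX, ← toD_residualField_sampledResidual Om s₀ τbar (hsample n)]
      exact (measurable_toD_sampledResidual Om s₀ τbar D n).comp
        ((measurable_pi_lambda _ fun x : D => hΔ x x.2).prodMk
          (measurable_pi_lambda _ hε.measurable))
    -- The factor `σ` is absorbed into the path, so the functional central limit theorem is used
    -- with the limit `σ B`.
    have hc : ∀ᵐ ω' ∂P', ContinuousOn (fun z => σ * B ω' z) (Icc 0 1) :=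
      hB.continuous.mono fun ω' hω' => hω'.const_smul σ
    have h0 : ∀ᵐ ω' ∂P', ∀ z ∈ Icc (0 : Fin 3 → ℝ) 1, (∃ j, z j = 0) → σ * B ω' z = 0 :=
      hB.ae_zero.mono fun ω' hω' z hz hj => by rw [hω' z hz hj, mul_zero]
    have hm : ∀ t ∈ Icc (0 : Fin 3 → ℝ) 1, Measurable fun ω' => σ * B ω' t :=
      fun t ht => (hB.measurable t ht).const_mul σ
    have hlim : ∀ᵐ p ∂P.prod P', IsSampleable τ τbar (Δ p.1) ∧ ContinuousOn (B p.2) (Icc 0 1) ∧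
        ∀ x ∈ Icc (Fin.cons s₀ 0 : Fin 4 → ℝ) (Fin.cons 1 τbar),
          nullLimit Om τbar σ (B p.2) x + drift Om τbar (Δ p.1) x =
            limitPath Om τbar (fun z => σ * B p.2 z) (Δ p.1) x := by
      filter_upwards [Measure.quasiMeasurePreserving_fst.ae hreg,
        Measure.quasiMeasurePreserving_snd.ae (hB.continuous.and hB.ae_zero)] with p hp1 hp2
      exact ⟨hp1, hp2.1, fun x hx => by
        rw [nullLimit_eq Om τbar σ hp2.1 hp2.2 (hpos x hx).1 (hpos x hx).2, limitPath]⟩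
    -- The Stieltjes form of the limit is only almost surely equal to the integrated form, so
    -- measurability and expectations are transferred along this equality.
    have hYeq : (fun p : Ω × Ω' => toD (Fin.cons s₀ 0 : Fin 4 → ℝ) (Fin.cons 1 τbar)
          (limitPath Om τbar (fun z => σ * B p.2 z) (Δ p.1))) =ᵐ[P.prod P']
        fun p => toD (Fin.cons s₀ 0 : Fin 4 → ℝ) (Fin.cons 1 τbar)
          fun x => nullLimit Om τbar σ (B p.2) x + drift Om τbar (Δ p.1) x :=
      hlim.mono fun p hp => (toD_congr hp.2.2).symm
    have hYm := (aemeasurable_toD_limitPath (Om := Om) hs₀.le hτbar hτ hκ hm hc h0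
      (fun n l hl => hΔ _ (hsample n l hl)) hreg).congr hYeq
    refine ⟨fun n => Eventually.of_forall (hcadlag n), ?_, fun n => (hXm n).aemeasurable, hYm, ?_⟩
    · filter_upwards [hlim] with p hp
      rw [path_congr hp.2.2]
      exact isCadlag_of_continuousOn
        (continuousOn_limitPath hτbar hκ (hp.2.1.const_smul σ) hp.1)
    · refine ProbabilityMeasure.tendsto_iff_forall_integral_tendsto.2 fun h => ?_
      have hconv := tendsto_integral_residualField (Om := Om) hs₀.le hτbar hτ hκ hm hc h0
        hε.measurable hε.fclt hsample hΔ hindep hreg h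
      convert hconv using 2 with n
      · refine (integral_map (hXm n).aemeasurable
          h.continuous.measurable.aestronglyMeasurable).trans ?_
        simp_rw [hX]
      · refine (integral_map hYm h.continuous.measurable.aestronglyMeasurable).trans ?_
        exact integral_congr_ae (hYeq.mono fun p hp => congr_arg h hp.symm)
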